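/- Let $n\ge 1$, $q\in\mathbb Z$, $s\in\mathbb C$ with $s\neq 0$, and let $\mathfrak g=(\mathfrak{sl}(2,\mathbb R)\times\mathfrak{so}(n))\ltimes\mathfrak h_{2n+1}$, where $\mathfrak h_{2n+1}=\{(u,v,w)\mid u,v\in\mathbb R^n,\ w\in\mathbb R\}$ has bracket $[(u,v,w),(u',v',w')]=(0,0,2(u\cdot v'-v\cdot u'))$, $\left(\begin{smallmatrix}a&b\\c&-a\end{smallmatrix}\right)$ acts on it by $(u,v,w)\mapsto(au+bv,cu-av,0)$ and $A\in\mathfrak{so}(n)$ by $(u,v,w)\mapsto(Au,Av,0)$. Let $I''$ be the space of smooth $F:\mathbb R\times\mathbb R^n\to\mathbb C$ with $F(\theta+j\pi,(-1)^jy)=i^{-jq}F(\theta,y)$ for all $j\in\mathbb Z$. It is a $\mathfrak g$-module: with $E_n=\sum_j y_j\partial_j$, the matrix $\left(\begin{smallmatrix}a&b\\c&-a\end{smallmatrix}\right)$ acts by $$(-a\sin2\theta-b\cos^2\theta+c\sin^2\theta)\,\partial_\theta+\Big(-a\cos2\theta+\tfrac{b+c}{2}\sin2\theta\Big)\Big(E_n+\tfrac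 n2\Big)-s\,\big(2a\sin2\theta+(b+c)\cos2\theta\big)\|y\|^2,$$ $A\in\mathfrak{so}(n)$ acts by $-(Ay)\cdot\partial_y$, and $(u,v,w)$ acts by $(-\cos\theta\,u+\sin\theta\,v)\cdot\partial_y-2s(\sin\theta\,u+\cos\theta\,v)\cdot y+sw$. The group $O(n)$ acts on $I''$ by $(g.F)(\theta,y)=F(\theta,g^{-1}y)$. For $k\ge0$ let $\mathcal H_k$ be the space of complex harmonic polynomials on $\mathbb R^n$ that are homogeneous of degree $k$. For $m\in\mathbb Z$, $l,k\ge 0$ and $h\in\mathcal H_k$ put, with $\rho=\|y\|$, $$F_{m,l,k}^{h}(\theta,y)=e^{-im\theta/2}e^{-is\rho^2}\rho^{2l}h(y)\;{}_1F_1\Big(\tfrac{m+4l+2k+n}{4},\,2l+k+\tfrac n2,\,2is\rho^2\Big).$$ Let $H_{l,k}\subset I''$ be the span of the $F_{m,l,k}^h$ with $h\in\mathcal H_k$ and $m\equiv 2k+q \bmod 4$; let $H_{l,k}^+$ (respectively $H_{l,k}^-$) be the span of those with in addition $m\ge 2k+4l+n$ (respectively $m\le-(2k+4l+n)$). Put $H_0=\sum_{k\ge0}H_{0,k}$,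 $H_0^\pm=\sum_{k\ge0}H_{0,k}^\pm$, $H^\pm=\sum_{l\ge1,k\ge0}H_{l,k}^\pm$ and $\mathbf H=H_0+\sum_{l\ge1,k\ge0}H_{l,k}$. Then the sum of all $H_{l,k}$, $l,k\ge0$, is direct, and as $\mathfrak g$-modules (submodules being complex subspaces stable under $\mathfrak g$): 1. If $q\not\equiv n$ and $q\not\equiv-n \bmod 4$, then $0\subset H_0\subset\mathbf H$ is a composition series of $\mathbf H$, and $H_0$ is the unique irreducible submodule of $\mathbf H$. 2. If $q\equiv n$ and $q\not\equiv-n \bmod 4$, then a composition series of $\mathbf H$ is $0\subset H_0^+\subset H_0\subset H_0\oplus H^+\subset \mathbf H$. 3. If $q\not\equiv n$ and $q\equiv-n \bmod 4$, then a composition series of $\mathbf H$ is $0\subset H_0^-\subset H_0\subset H_0\oplus H^-\subset \mathbf H$. 4. If $q\equiv n$ and $q\equiv-n \bmod 4$, then $H_0^+\cap H_0^-=0$, $H^+\cap H^-=0$, and $$0\subset H_0^-\subset H_0^+\oplus H_0^-\subset H_0\subset H_0\oplus H^-\subset H_0\oplus H^-\oplus H^+\subset\mathbf H$$ is a composition series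 of $\mathbf H$ as a $\mathfrak g$-module if $n\ne2$; for every such $n$, including $n=2$, it is a composition series with respect to submodules stable under both $\mathfrak g$ and $O(n)$. -/

import Mathlib

open scoped Matrix

/-- `𝔥_{2n+1}`: triples `(u, v, w)`. -/
def HeisenbergAlgebra (n : ℕ) : Type := (Fin n → ℝ) × (Fin n → ℝ) × ℝ

namespace HeisenbergAlgebra

variable {n : ℕ}

instance : AddCommGroup (HeisenbergAlgebra n) :=
  inferInstanceAs (AddCommGroup ((Fin n → ℝ) × (Fin n → ℝ) × ℝ))

instance : Module ℝ (HeisenbergAlgebra n) :=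
  inferInstanceAs (Module ℝ ((Fin n → ℝ) × (Fin n → ℝ) × ℝ))

def mk (u v : Fin n → ℝ) (w : ℝ) : HeisenbergAlgebra n := (u, v, w)

def u (x : HeisenbergAlgebra n) : Fin n → ℝ := x.1

def v (x : HeisenbergAlgebra n) : Fin n → ℝ := x.2.1

def w (x : HeisenbergAlgebra n) : ℝ := x.2.2

theorem ext' {x y : HeisenbergAlgebra n} (hu : x.u = y.u) (hv : x.v = y.v) (hw : x.w = y.w) :
    x = y := Prod.ext hu (Prod.ext hv hw)

@[simp] theorem u_mk (a b : Fin n → ℝ) (c : ℝ) : (mk a b c).u = a := rfl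
@[simp] theorem v_mk (a b : Fin n → ℝ) (c : ℝ) : (mk a b c).v = b := rfl
@[simp] theorem w_mk (a b : Fin n → ℝ) (c : ℝ) : (mk a b c).w = c := rfl
@[simp] theorem u_zero : (0 : HeisenbergAlgebra n).u = 0 := rfl
@[simp] theorem v_zero : (0 : HeisenbergAlgebra n).v = 0 := rfl
@[simp] theorem w_zero : (0 : HeisenbergAlgebra n).w = 0 := rfl
@[simp] theorem u_add (x y : HeisenbergAlgebra n) : (x + y).u = x.u + y.u := rfl
@[simp] theorem v_add (x y : HeisenbergAlgebra n) : (x + y).v = x.v + y.v := rfl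
@[simp] theorem w_add (x y : HeisenbergAlgebra n) : (x + y).w = x.w + y.w := rfl
@[simp] theorem u_sub (x y : HeisenbergAlgebra n) : (x - y).u = x.u - y.u := rfl
@[simp] theorem v_sub (x y : HeisenbergAlgebra n) : (x - y).v = x.v - y.v := rfl
@[simp] theorem w_sub (x y : HeisenbergAlgebra n) : (x - y).w = x.w - y.w := rfl
@[simp] theorem u_smul (c : ℝ) (x : HeisenbergAlgebra n) : (c • x).u = c • x.u := rfl
@[simp] theorem v_smul (c : ℝ) (x : HeisenbergAlgebra n) : (c • x).v = c • x.v := rfl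
@[simp] theorem w_smul (c : ℝ) (x : HeisenbergAlgebra n) : (c • x).w = c * x.w := rfl

/-- The bracket for the group law `(z, t) (z', t') = (z + z', t + t' + ⟨z, z'⟩)`, where
`⟨(u, v), (u', v')⟩ = u ⬝ v' - v ⬝ u'`. -/
instance : Bracket (HeisenbergAlgebra n) (HeisenbergAlgebra n) where
  bracket x y := mk 0 0 (2 * (x.u ⬝ᵥ y.v - x.v ⬝ᵥ y.u))

theorem lie_def (x y : HeisenbergAlgebra n) :
    ⁅x, y⁆ = mk 0 0 (2 * (x.u ⬝ᵥ y.v - x.v ⬝ᵥ y.u)) := rfl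

instance : LieRing (HeisenbergAlgebra n) where
  add_lie x y z := by apply ext' <;> simp [lie_def]; ring
  lie_add x y z := by apply ext' <;> simp [lie_def]; ring
  lie_self x := by apply ext' <;> simp [lie_def, dotProduct_comm]
  leibniz_lie x y z := by apply ext' <;> simp [lie_def]

instance : LieAlgebra ℝ (HeisenbergAlgebra n) where
  lie_smul c x y := by apply ext' <;> simp [lie_def]; ring

end HeisenbergAlgebra

/-- `𝔰𝔩(2, ℝ) × 𝔰𝔬(n)`. -/
abbrev LeviAlgebra (n : ℕ) : Type :=
  LieAlgebra.SpecialLinear.sl (Fin 2) ℝ × LieAlgebra.Orthogonal.so (Fin n) ℝ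

section
variable {n : ℕ}

theorem sl_one_one (X : LieAlgebra.SpecialLinear.sl (Fin 2) ℝ) : X.1 1 1 = - X.1 0 0 := by
  have h : Matrix.trace X.1 = 0 := X.2
  rw [Matrix.trace_fin_two] at h
  linarith

theorem so_dotProduct (A : LieAlgebra.Orthogonal.so (Fin n) ℝ) (x y : Fin n → ℝ) :
    (A.1 *ᵥ x) ⬝ᵥ y = - (x ⬝ᵥ (A.1 *ᵥ y)) := by
  have h : A.1ᵀ = - A.1 := (LieAlgebra.Orthogonal.mem_so (Fin n) ℝ A.1).1 A.2
  rw [Matrix.dotProduct_mulVec, ← Matrix.mulVec_transpose, h, Matrix.neg_mulVec, neg_dotProduct,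
    neg_neg]

/-- `(X, A)` acts on `(u, v, w)` through `(u, v) ↦ (a u + b v + A u, c u + d v + A v)`. -/
def leviDerivation (L : LeviAlgebra n) :
    LieDerivation ℝ (HeisenbergAlgebra n) (HeisenbergAlgebra n) where
  toFun x := .mk (L.1.1 0 0 • x.u + L.1.1 0 1 • x.v + L.2.1 *ᵥ x.u)
    (L.1.1 1 0 • x.u + L.1.1 1 1 • x.v + L.2.1 *ᵥ x.v) 0
  map_add' x y := by
    apply HeisenbergAlgebra.ext' <;> simp [Matrix.mulVec_add] <;> abel
  map_smul' c x := by
    apply HeisenbergAlgebra.ext' <;> simp [Matrix.mulVec_smul, smul_comm c]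
  leibniz' x y := by
    have h1 := so_dotProduct L.2 y.u x.v
    have h2 := so_dotProduct L.2 y.v x.u
    rw [dotProduct_comm] at h1 h2
    apply HeisenbergAlgebra.ext' <;> simp [HeisenbergAlgebra.lie_def]
    rw [sl_one_one, h1, h2, dotProduct_comm x.u y.u, dotProduct_comm x.v y.v,
      dotProduct_comm x.v y.u, dotProduct_comm y.v x.u]
    ring

theorem leviDerivation_apply (L : LeviAlgebra n) (x : HeisenbergAlgebra n) :
    leviDerivation L x = .mk (L.1.1 0 0 • x.u + L.1.1 0 1 • x.v + L.2.1 *ᵥ x.u)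
      (L.1.1 1 0 • x.u + L.1.1 1 1 • x.v + L.2.1 *ᵥ x.v) 0 := rfl

theorem sl_lie_apply (X Y : LieAlgebra.SpecialLinear.sl (Fin 2) ℝ) (i j : Fin 2) :
    (⁅X, Y⁆ : LieAlgebra.SpecialLinear.sl (Fin 2) ℝ).1 i j =
      X.1 i 0 * Y.1 0 j + X.1 i 1 * Y.1 1 j - (Y.1 i 0 * X.1 0 j + Y.1 i 1 * X.1 1 j) := by
  rw [LieAlgebra.SpecialLinear.sl_bracket, Matrix.sub_apply, Matrix.mul_apply, Matrix.mul_apply,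
    Fin.sum_univ_two, Fin.sum_univ_two]

theorem so_lie_mulVec (A B : LieAlgebra.Orthogonal.so (Fin n) ℝ) (x : Fin n → ℝ) :
    (⁅A, B⁆ : LieAlgebra.Orthogonal.so (Fin n) ℝ).1 *ᵥ x =
      A.1 *ᵥ (B.1 *ᵥ x) - B.1 *ᵥ (A.1 *ᵥ x) := by
  have h : (⁅A, B⁆ : LieAlgebra.Orthogonal.so (Fin n) ℝ).1 = A.1 * B.1 - B.1 * A.1 := rfl
  rw [h, Matrix.sub_mulVec, Matrix.mulVec_mulVec, Matrix.mulVec_mulVec]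

/-- The action of `𝔰𝔩(2, ℝ) × 𝔰𝔬(n)` on `𝔥_{2n+1}` by derivations. -/
def leviAction (n : ℕ) :
    LeviAlgebra n →ₗ⁅ℝ⁆ LieDerivation ℝ (HeisenbergAlgebra n) (HeisenbergAlgebra n) where
  toFun := leviDerivation
  map_add' L M := by
    ext x
    apply HeisenbergAlgebra.ext' <;>
      simp [leviDerivation_apply, add_smul, Matrix.add_mulVec] <;> abel
  map_smul' c L := by
    ext x
    apply HeisenbergAlgebra.ext' <;>
      simp [leviDerivation_apply, mul_smul, Matrix.smul_mulVec]
  map_lie' {L M} := by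
    ext x
    have hL := sl_lie_apply L.1 M.1
    have hA := so_lie_mulVec L.2 M.2
    have e1 : (⁅L, M⁆ : LeviAlgebra n).1 = ⁅L.1, M.1⁆ := rfl
    have e2 : (⁅L, M⁆ : LeviAlgebra n).2 = ⁅L.2, M.2⁆ := rfl
    rw [LieDerivation.commutator_apply]
    simp only [leviDerivation_apply, e1, e2, hA, hL]
    apply HeisenbergAlgebra.ext'
    · ext i
      simp [Matrix.mulVec_add, Matrix.mulVec_smul]
      ring
    · ext i
      simp [Matrix.mulVec_add, Matrix.mulVec_smul]
      ring
    · simp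

/-- `𝔤 = (𝔰𝔩(2, ℝ) × 𝔰𝔬(n)) ⋉ 𝔥_{2n+1}`. -/
abbrev JacobiAlgebra (n : ℕ) : Type :=
  LieAlgebra.SemiDirectSum (HeisenbergAlgebra n) (LeviAlgebra n) (leviAction n)
end

noncomputable section

open scoped ContDiff

section
variable {n : ℕ}

/-- The coefficient of `∂_θ` for the action of `(a b; c -a)` in the compact picture. -/
def slTime (X : LieAlgebra.SpecialLinear.sl (Fin 2) ℝ) (θ : ℝ) : ℝ :=
  -(X.1 0 0) * Real.sin (2 * θ) - X.1 0 1 * Real.cos θ ^ 2 + X.1 1 0 * Real.sin θ ^ 2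

/-- The coefficient of `E_n + n / 2` for the action of `(a b; c -a)` in the compact picture. -/
def slEuler (X : LieAlgebra.SpecialLinear.sl (Fin 2) ℝ) (θ : ℝ) : ℝ :=
  -(X.1 0 0) * Real.cos (2 * θ) + (X.1 0 1 + X.1 1 0) / 2 * Real.sin (2 * θ)

/-- The coefficient of `-s ‖y‖²` for the action of `(a b; c -a)` in the compact picture. -/
def slPotential (X : LieAlgebra.SpecialLinear.sl (Fin 2) ℝ) (θ : ℝ) : ℝ :=
  2 * X.1 0 0 * Real.sin (2 * θ) + (X.1 0 1 + X.1 1 0) * Real.cos (2 * θ)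

/-- The vector field part of the first order differential operator by which `Z ∈ 𝔤` acts. -/
def actionField (Z : JacobiAlgebra n) (p : ℝ × (Fin n → ℝ)) : ℝ × (Fin n → ℝ) :=
  (slTime Z.right.1 p.1,
    slEuler Z.right.1 p.1 • p.2 - Z.right.2.1 *ᵥ p.2
      - Real.cos p.1 • Z.left.u + Real.sin p.1 • Z.left.v)

/-- The real coefficient function of `s` in the zeroth order part. -/
def actionPotential (Z : JacobiAlgebra n) (p : ℝ × (Fin n → ℝ)) : ℝ :=
  Z.left.w - slPotential Z.right.1 p.1 * (p.2 ⬝ᵥ p.2)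
    - 2 * (Real.sin p.1 * (Z.left.u ⬝ᵥ p.2) + Real.cos p.1 * (Z.left.v ⬝ᵥ p.2))

/-- The zeroth order part of the differential operator by which `Z ∈ 𝔤` acts. -/
def actionMultiplier (s : ℂ) (Z : JacobiAlgebra n) (p : ℝ × (Fin n → ℝ)) : ℂ :=
  ((n / 2 * slEuler Z.right.1 p.1 : ℝ) : ℂ) + s * (actionPotential Z p : ℂ)

/-- The differential operator by which `Z = ((a b; c -a), A, (u, v, w)) ∈ 𝔤` acts in the compact
picture with parameters `r = -n/2` and `s`:
* `(a b; c -a)` acts by `(-a sin 2θ - b cos² θ + c sin² θ) ∂_θ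
  + (-a cos 2θ + (b + c)/2 sin 2θ) (E_n + n/2) - s (2 a sin 2θ + (b + c) cos 2θ) ‖y‖²`,
* `A ∈ 𝔰𝔬(n)` acts by `-(A y) ⬝ ∂_y`,
* `(u, v, w)` acts by `(-cos θ u + sin θ v) ⬝ ∂_y - 2 s (sin θ u + cos θ v) ⬝ y + s w`. -/
def actionOperator (s : ℂ) (Z : JacobiAlgebra n) (F : ℝ × (Fin n → ℝ) → ℂ) :
    ℝ × (Fin n → ℝ) → ℂ :=
  fun p => fderiv ℝ F p (actionField Z p) + actionMultiplier s Z p * F p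

theorem contDiff_slTime (X : LieAlgebra.SpecialLinear.sl (Fin 2) ℝ) :
    ContDiff ℝ ∞ (slTime X) := by
  unfold slTime
  generalize X.1 0 0 = a
  generalize X.1 0 1 = b
  generalize X.1 1 0 = c
  fun_prop

theorem contDiff_slEuler (X : LieAlgebra.SpecialLinear.sl (Fin 2) ℝ) :
    ContDiff ℝ ∞ (slEuler X) := by
  unfold slEuler
  generalize X.1 0 0 = a
  generalize X.1 0 1 = b
  generalize X.1 1 0 = c
  fun_prop

theorem contDiff_slPotential (X : LieAlgebra.SpecialLinear.sl (Fin 2) ℝ) :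
    ContDiff ℝ ∞ (slPotential X) := by
  unfold slPotential
  generalize X.1 0 0 = a
  generalize X.1 0 1 = b
  generalize X.1 1 0 = c
  fun_prop

theorem contDiff_actionField (Z : JacobiAlgebra n) : ContDiff ℝ ∞ (actionField Z) := by
  have h1 := contDiff_slTime Z.right.1
  have h2 := contDiff_slEuler Z.right.1
  have h3 : ContDiff ℝ ∞ (fun y : Fin n → ℝ => Z.right.2.1 *ᵥ y) :=
    (LinearMap.toContinuousLinearMap (Matrix.mulVecLin Z.right.2.1)).contDiff
  have h4 := h3.comp (contDiff_snd (E := ℝ) (F := Fin n → ℝ))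
  refine (h1.comp contDiff_fst).prodMk
    (((((h2.comp contDiff_fst).smul contDiff_snd).sub h4).sub ?_).add ?_)
  · exact (Real.contDiff_cos.comp contDiff_fst).smul contDiff_const
  · exact (Real.contDiff_sin.comp contDiff_fst).smul contDiff_const

theorem contDiff_actionMultiplier (s : ℂ) (Z : JacobiAlgebra n) :
    ContDiff ℝ ∞ (actionMultiplier s Z) := by
  have h0 : ContDiff ℝ ∞ (fun x : ℝ => (x : ℂ)) := Complex.ofRealCLM.contDiff
  have h1 := contDiff_slPotential Z.right.1
  have h2 := contDiff_slEuler Z.right.1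
  have h3 : ContDiff ℝ ∞ (actionPotential Z) := by
    unfold actionPotential
    simp only [dotProduct]
    fun_prop
  have h4 : ContDiff ℝ ∞ (fun p : ℝ × (Fin n → ℝ) => (n : ℝ) / 2 * slEuler Z.right.1 p.1) := by
    fun_prop
  exact (h0.comp h4).add (contDiff_const.mul (h0.comp h3))

theorem contDiff_actionOperator (s : ℂ) (Z : JacobiAlgebra n) {F : ℝ × (Fin n → ℝ) → ℂ}
    (hF : ContDiff ℝ ∞ F) : ContDiff ℝ ∞ (actionOperator s Z F) := by
  have h1 : ContDiff ℝ ∞ (fderiv ℝ F) := hF.fderiv_right (by simp)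
  exact (h1.clm_apply (contDiff_actionField Z)).add ((contDiff_actionMultiplier s Z).mul hF)

/-- The derivative of `actionField Z` at `p` in the direction `d`. -/
def actionFieldDeriv (Z : JacobiAlgebra n) (p d : ℝ × (Fin n → ℝ)) : ℝ × (Fin n → ℝ) :=
  (2 * slEuler Z.right.1 p.1 * d.1,
    (slPotential Z.right.1 p.1 * d.1) • p.2 + slEuler Z.right.1 p.1 • d.2
      - Z.right.2.1 *ᵥ d.2 + (Real.sin p.1 * d.1) • Z.left.u + (Real.cos p.1 * d.1) • Z.left.v)

/-- The derivative of `actionPotential Z` at `p` in the direction `d`. -/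
def actionPotentialDeriv (Z : JacobiAlgebra n) (p d : ℝ × (Fin n → ℝ)) : ℝ :=
  4 * slEuler Z.right.1 p.1 * d.1 * (p.2 ⬝ᵥ p.2)
    - 2 * slPotential Z.right.1 p.1 * (p.2 ⬝ᵥ d.2)
    - 2 * (Real.cos p.1 * d.1 * (Z.left.u ⬝ᵥ p.2) - Real.sin p.1 * d.1 * (Z.left.v ⬝ᵥ p.2)
      + Real.sin p.1 * (Z.left.u ⬝ᵥ d.2) + Real.cos p.1 * (Z.left.v ⬝ᵥ d.2))

theorem hasDerivAt_slTime (X : LieAlgebra.SpecialLinear.sl (Fin 2) ℝ) (θ : ℝ) :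
    HasDerivAt (slTime X) (2 * slEuler X θ) θ := by
  have h2 : HasDerivAt (fun t : ℝ => 2 * t) 2 θ := by
    simpa using (hasDerivAt_id θ).const_mul (2 : ℝ)
  have := (((h2.sin).const_mul (-(X.1 0 0))).sub
    (((Real.hasDerivAt_cos θ).pow 2).const_mul (X.1 0 1))).add
    (((Real.hasDerivAt_sin θ).pow 2).const_mul (X.1 1 0))
  refine (this.congr_deriv ?_)
  simp only [slEuler, Real.sin_two_mul]
  push_cast
  ring

theorem hasDerivAt_slEuler (X : LieAlgebra.SpecialLinear.sl (Fin 2) ℝ) (θ : ℝ) :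
    HasDerivAt (slEuler X) (slPotential X θ) θ := by
  have h2 : HasDerivAt (fun t : ℝ => 2 * t) 2 θ := by
    simpa using (hasDerivAt_id θ).const_mul (2 : ℝ)
  have := ((h2.cos).const_mul (-(X.1 0 0))).add
    ((h2.sin).const_mul ((X.1 0 1 + X.1 1 0) / 2))
  refine (this.congr_deriv ?_)
  simp only [slPotential]
  ring

theorem hasDerivAt_slPotential (X : LieAlgebra.SpecialLinear.sl (Fin 2) ℝ) (θ : ℝ) :
    HasDerivAt (slPotential X) (-4 * slEuler X θ) θ := by
  have h2 : HasDerivAt (fun t : ℝ => 2 * t) 2 θ := by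
    simpa using (hasDerivAt_id θ).const_mul (2 : ℝ)
  have := ((h2.sin).const_mul (2 * X.1 0 0)).add
    ((h2.cos).const_mul (X.1 0 1 + X.1 1 0))
  refine (this.congr_deriv ?_)
  simp only [slEuler]
  ring

/-- The directional derivative along a line, for a differentiable map. -/
theorem fderiv_eq_of_hasDerivAt_line {E G : Type*} [NormedAddCommGroup E] [NormedSpace ℝ E]
    [NormedAddCommGroup G] [NormedSpace ℝ G] {f : E → G} {p d : E} {g : G}
    (hf : DifferentiableAt ℝ f p) (h : HasDerivAt (fun t : ℝ => f (p + t • d)) g 0) :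
    fderiv ℝ f p d = g :=
  (hf.hasFDerivAt.hasLineDerivAt d).unique h

theorem fderiv_actionField (Z : JacobiAlgebra n) (p d : ℝ × (Fin n → ℝ)) :
    fderiv ℝ (actionField Z) p d = actionFieldDeriv Z p d := by
  apply fderiv_eq_of_hasDerivAt_line ((contDiff_actionField Z).differentiable (by simp) p)
  have hθ : HasDerivAt (fun t : ℝ => p.1 + t * d.1) d.1 0 := by
    simpa using ((hasDerivAt_id (0 : ℝ)).mul_const d.1).const_add p.1
  have e0 : p.1 + (0 : ℝ) * d.1 = p.1 := by ring
  have c1 := hasDerivAt_slTime Z.right.1 p.1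
  have c2 := hasDerivAt_slEuler Z.right.1 p.1
  have c3 := Real.hasDerivAt_cos p.1
  have c4 := Real.hasDerivAt_sin p.1
  rw [← e0] at c1 c2 c3 c4
  replace c1 := c1.comp (0 : ℝ) hθ
  replace c2 := c2.comp (0 : ℝ) hθ
  replace c3 := c3.comp (0 : ℝ) hθ
  replace c4 := c4.comp (0 : ℝ) hθ
  rw [e0] at c1 c2 c3 c4
  have hy : HasDerivAt (fun t : ℝ => p.2 + t • d.2) d.2 0 := by
    simpa using ((hasDerivAt_id (0 : ℝ)).smul_const d.2).const_add p.2
  have hA : HasDerivAt (fun t : ℝ => Z.right.2.1 *ᵥ p.2 + t • (Z.right.2.1 *ᵥ d.2))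
      (Z.right.2.1 *ᵥ d.2) 0 := by
    simpa using ((hasDerivAt_id (0 : ℝ)).smul_const (Z.right.2.1 *ᵥ d.2)).const_add
      (Z.right.2.1 *ᵥ p.2)
  have hfin := c1.prodMk ((((c2.smul hy).sub hA).sub (c3.smul_const Z.left.u)).add
    (c4.smul_const Z.left.v))
  refine (hfin.congr_of_eventuallyEq (Filter.Eventually.of_forall fun t => ?_)).congr_deriv ?_
  · simp [actionField, Matrix.mulVec_add, Matrix.mulVec_smul]
  · simp [actionFieldDeriv]
    abel

theorem fderiv_actionMultiplier (s : ℂ) (Z : JacobiAlgebra n) (p d : ℝ × (Fin n → ℝ)) :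
    fderiv ℝ (actionMultiplier s Z) p d =
      ((n / 2 * (slPotential Z.right.1 p.1 * d.1) : ℝ) : ℂ)
        + s * (actionPotentialDeriv Z p d : ℂ) := by
  apply fderiv_eq_of_hasDerivAt_line ((contDiff_actionMultiplier s Z).differentiable (by simp) p)
  have hθ : HasDerivAt (fun t : ℝ => p.1 + t * d.1) d.1 0 := by
    simpa using ((hasDerivAt_id (0 : ℝ)).mul_const d.1).const_add p.1
  have e0 : p.1 + (0 : ℝ) * d.1 = p.1 := by ring
  have c1 := hasDerivAt_slPotential Z.right.1 p.1
  have c2 := hasDerivAt_slEuler Z.right.1 p.1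
  have c3 := Real.hasDerivAt_cos p.1
  have c4 := Real.hasDerivAt_sin p.1
  rw [← e0] at c1 c2 c3 c4
  replace c1 := c1.comp (0 : ℝ) hθ
  replace c2 := c2.comp (0 : ℝ) hθ
  replace c3 := c3.comp (0 : ℝ) hθ
  replace c4 := c4.comp (0 : ℝ) hθ
  rw [e0] at c1 c2 c3 c4
  have hlin : ∀ a b : ℝ, HasDerivAt (fun t : ℝ => a + t * b) b 0 := fun a b => by
    simpa using ((hasDerivAt_id (0 : ℝ)).mul_const b).const_add a
  have hsq : HasDerivAt (fun t : ℝ => (p.2 ⬝ᵥ p.2) + t * (2 * (p.2 ⬝ᵥ d.2))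
      + t ^ 2 * (d.2 ⬝ᵥ d.2)) (2 * (p.2 ⬝ᵥ d.2)) 0 := by
    have := (hlin (p.2 ⬝ᵥ p.2) (2 * (p.2 ⬝ᵥ d.2))).add
      (((hasDerivAt_id (0 : ℝ)).pow 2).mul_const (d.2 ⬝ᵥ d.2))
    refine (this.congr_of_eventuallyEq
      (Filter.Eventually.of_forall fun t => ?_)).congr_deriv ?_
    · simp
    · simp
  have hpot := (((c1.mul hsq).const_sub Z.left.w).sub
    (((c4.mul (hlin (Z.left.u ⬝ᵥ p.2) (Z.left.u ⬝ᵥ d.2))).add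
      (c3.mul (hlin (Z.left.v ⬝ᵥ p.2) (Z.left.v ⬝ᵥ d.2)))).const_mul 2))
  have hfin := (c2.const_mul ((n : ℝ) / 2)).ofReal_comp.add (hpot.ofReal_comp.const_mul s)
  refine (hfin.congr_of_eventuallyEq (Filter.Eventually.of_forall fun t => ?_)).congr_deriv ?_
  · simp only [actionMultiplier, actionPotential, Pi.add_apply, Pi.sub_apply, Pi.mul_apply,
      Function.comp_apply, Prod.fst_add, Prod.snd_add, Prod.smul_fst, Prod.smul_snd, smul_eq_mul,
      add_dotProduct, dotProduct_add, smul_dotProduct, dotProduct_smul, dotProduct_comm d.2 p.2]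
    push_cast
    ring
  · simp only [actionPotentialDeriv, Function.comp_apply, zero_mul, add_zero]
    push_cast
    ring


theorem slTime_lie (X Y : LieAlgebra.SpecialLinear.sl (Fin 2) ℝ) (θ : ℝ) :
    slTime ⁅X, Y⁆ θ = 2 * slEuler Y θ * slTime X θ - 2 * slEuler X θ * slTime Y θ := by
  have h2 := Real.sin_sq_add_cos_sq (2 * θ)
  simp only [slTime, slEuler, Real.cos_sq θ, Real.sin_sq_eq_half_sub θ, sl_lie_apply, sl_one_one]
  generalize X.1 0 0 = a at *
  generalize X.1 0 1 = b at *
  generalize X.1 1 0 = c at *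
  generalize Y.1 0 0 = a' at *
  generalize Y.1 0 1 = b' at *
  generalize Y.1 1 0 = c' at *
  linear_combination (a * (b' + c') - (b + c) * a') * h2

theorem slEuler_lie (X Y : LieAlgebra.SpecialLinear.sl (Fin 2) ℝ) (θ : ℝ) :
    slEuler ⁅X, Y⁆ θ = slPotential Y θ * slTime X θ - slPotential X θ * slTime Y θ := by
  have h2 := Real.sin_sq_add_cos_sq (2 * θ)
  simp only [slTime, slEuler, slPotential, Real.cos_sq θ, Real.sin_sq_eq_half_sub θ, sl_lie_apply,
    sl_one_one]
  generalize X.1 0 0 = a at *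
  generalize X.1 0 1 = b at *
  generalize X.1 1 0 = c at *
  generalize Y.1 0 0 = a' at *
  generalize Y.1 0 1 = b' at *
  generalize Y.1 1 0 = c' at *
  ring

theorem slPotential_lie (X Y : LieAlgebra.SpecialLinear.sl (Fin 2) ℝ) (θ : ℝ) :
    slPotential ⁅X, Y⁆ θ = -4 * slEuler Y θ * slTime X θ + 4 * slEuler X θ * slTime Y θ
      + 2 * slPotential Y θ * slEuler X θ - 2 * slPotential X θ * slEuler Y θ := by
  have h2 := Real.sin_sq_add_cos_sq (2 * θ)
  simp only [slTime, slEuler, slPotential, Real.cos_sq θ, Real.sin_sq_eq_half_sub θ, sl_lie_apply,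
    sl_one_one]
  generalize X.1 0 0 = a at *
  generalize X.1 0 1 = b at *
  generalize X.1 1 0 = c at *
  generalize Y.1 0 0 = a' at *
  generalize Y.1 0 1 = b' at *
  generalize Y.1 1 0 = c' at *
  ring

theorem sl_trig (X : LieAlgebra.SpecialLinear.sl (Fin 2) ℝ) (θ : ℝ) :
    (slTime X θ * Real.sin θ + slEuler X θ * Real.cos θ
      = -(X.1 0 0) * Real.cos θ + X.1 1 0 * Real.sin θ) ∧
    (slTime X θ * Real.cos θ - slEuler X θ * Real.sin θ
      = -(X.1 0 1) * Real.cos θ - X.1 0 0 * Real.sin θ) ∧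
    (Real.cos θ * slTime X θ + Real.sin θ * slEuler X θ + Real.cos θ * slPotential X θ
      = X.1 0 0 * Real.sin θ + X.1 1 0 * Real.cos θ) ∧
    (-Real.sin θ * slTime X θ + Real.cos θ * slEuler X θ - Real.sin θ * slPotential X θ
      = X.1 0 1 * Real.sin θ - X.1 0 0 * Real.cos θ) := by
  have h := Real.sin_sq_add_cos_sq θ
  simp only [slTime, slEuler, slPotential, Real.sin_two_mul, Real.cos_two_mul']
  generalize X.1 0 0 = a at *
  generalize X.1 0 1 = b at *
  generalize X.1 1 0 = c at *
  generalize Real.sin θ = S at *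
  generalize Real.cos θ = C at *
  refine ⟨?_, ?_, ?_, ?_⟩
  · linear_combination (-a * C + c * S) * h
  · linear_combination (-b * C - a * S) * h
  · linear_combination (a * S + c * C) * h
  · linear_combination (b * S - a * C) * h

theorem actionFieldDeriv_sub (Z W : JacobiAlgebra n) (p : ℝ × (Fin n → ℝ)) :
    actionFieldDeriv W p (actionField Z p) - actionFieldDeriv Z p (actionField W p) =
      actionField ⁅Z, W⁆ p := by
  obtain ⟨x, X, A⟩ := Z
  obtain ⟨y, Y, B⟩ := W
  obtain ⟨θ, z⟩ := p
  obtain ⟨hX1, hX2, -, -⟩ := sl_trig X θ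
  obtain ⟨hY1, hY2, -, -⟩ := sl_trig Y θ
  have e1 : (⁅(X, A), (Y, B)⁆ : LeviAlgebra n) = (⁅X, Y⁆, ⁅A, B⁆) := rfl
  have e2 : leviAction n (X, A) y = leviDerivation (X, A) y := rfl
  have e3 : leviAction n (Y, B) x = leviDerivation (Y, B) x := rfl
  simp only [LieAlgebra.SemiDirectSum.lie_eq_mk, e1, e2, e3, leviDerivation_apply, actionField,
    actionFieldDeriv, slTime_lie, slEuler_lie, so_lie_mulVec, sl_one_one, HeisenbergAlgebra.lie_def,
    HeisenbergAlgebra.u_sub, HeisenbergAlgebra.v_sub, HeisenbergAlgebra.u_add,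
    HeisenbergAlgebra.v_add, HeisenbergAlgebra.u_mk, HeisenbergAlgebra.v_mk, Matrix.mulVec_add,
    Matrix.mulVec_sub, Matrix.mulVec_smul]
  refine Prod.ext rfl (funext fun i => ?_)
  simp only [Prod.snd_sub, Pi.add_apply, Pi.sub_apply, Pi.smul_apply, smul_eq_mul, Pi.zero_apply]
  linear_combination y.u i * hX1 + y.v i * hX2 - x.u i * hY1 - x.v i * hY2

theorem actionPotentialDeriv_sub (Z W : JacobiAlgebra n) (p : ℝ × (Fin n → ℝ)) :
    actionPotentialDeriv W p (actionField Z p) - actionPotentialDeriv Z p (actionField W p) =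
      actionPotential ⁅Z, W⁆ p := by
  obtain ⟨x, X, A⟩ := Z
  obtain ⟨y, Y, B⟩ := W
  obtain ⟨θ, z⟩ := p
  obtain ⟨-, -, hX1, hX2⟩ := sl_trig X θ
  obtain ⟨-, -, hY1, hY2⟩ := sl_trig Y θ
  have hs := Real.sin_sq_add_cos_sq θ
  have hA : z ⬝ᵥ A.1 *ᵥ z = 0 := by
    have := so_dotProduct A z z
    rw [dotProduct_comm] at this
    linarith
  have hB : z ⬝ᵥ B.1 *ᵥ z = 0 := by
    have := so_dotProduct B z z
    rw [dotProduct_comm] at this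
    linarith
  have e1 : (⁅(X, A), (Y, B)⁆ : LeviAlgebra n) = (⁅X, Y⁆, ⁅A, B⁆) := rfl
  have e2 : leviAction n (X, A) y = leviDerivation (X, A) y := rfl
  have e3 : leviAction n (Y, B) x = leviDerivation (Y, B) x := rfl
  simp only [LieAlgebra.SemiDirectSum.lie_eq_mk, e1, e2, e3, leviDerivation_apply, actionField,
    actionPotential, actionPotentialDeriv, slPotential_lie, sl_one_one, HeisenbergAlgebra.lie_def,
    HeisenbergAlgebra.u_sub, HeisenbergAlgebra.v_sub, HeisenbergAlgebra.w_sub,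
    HeisenbergAlgebra.u_add, HeisenbergAlgebra.v_add, HeisenbergAlgebra.w_add,
    HeisenbergAlgebra.u_mk, HeisenbergAlgebra.v_mk, HeisenbergAlgebra.w_mk,
    dotProduct_add, dotProduct_sub, dotProduct_smul, add_dotProduct, sub_dotProduct,
    smul_dotProduct, smul_eq_mul, so_dotProduct, zero_dotProduct, hA, hB]
  rw [dotProduct_comm z x.u, dotProduct_comm z x.v, dotProduct_comm z y.u, dotProduct_comm z y.v,
    dotProduct_comm y.u x.u, dotProduct_comm y.u x.v, dotProduct_comm y.v x.u,
    dotProduct_comm y.v x.v]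
  linear_combination -2 * (y.u ⬝ᵥ z) * hX1 - 2 * (y.v ⬝ᵥ z) * hX2
    + 2 * (x.u ⬝ᵥ z) * hY1 + 2 * (x.v ⬝ᵥ z) * hY2
    + 2 * (x.u ⬝ᵥ y.v - x.v ⬝ᵥ y.u) * hs

theorem actionOperator_lie (s : ℂ) (Z W : JacobiAlgebra n) {F : ℝ × (Fin n → ℝ) → ℂ}
    (hF : ContDiff ℝ ∞ F) :
    actionOperator s ⁅Z, W⁆ F =
      actionOperator s Z (actionOperator s W F) - actionOperator s W (actionOperator s Z F) := by
  have hF1 : ContDiff ℝ ∞ (fderiv ℝ F) := hF.fderiv_right (by simp)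
  have key : ∀ (Z W : JacobiAlgebra n) (p : ℝ × (Fin n → ℝ)),
      actionOperator s Z (actionOperator s W F) p =
        fderiv ℝ (fderiv ℝ F) p (actionField Z p) (actionField W p)
        + fderiv ℝ F p (actionFieldDeriv W p (actionField Z p))
        + fderiv ℝ (actionMultiplier s W) p (actionField Z p) * F p
        + actionMultiplier s W p * fderiv ℝ F p (actionField Z p)
        + actionMultiplier s Z p * fderiv ℝ F p (actionField W p)
        + actionMultiplier s Z p * actionMultiplier s W p * F p := by
    intro Z W p
    have d1 : DifferentiableAt ℝ (fderiv ℝ F) p := hF1.differentiable (by simp) p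
    have d2 : DifferentiableAt ℝ (actionField W) p :=
      (contDiff_actionField W).differentiable (by simp) p
    have d3 : DifferentiableAt ℝ (actionMultiplier s W) p :=
      (contDiff_actionMultiplier s W).differentiable (by simp) p
    have d4 : DifferentiableAt ℝ F p := hF.differentiable (by simp) p
    have h := (d1.hasFDerivAt.clm_apply d2.hasFDerivAt).add (d3.hasFDerivAt.mul d4.hasFDerivAt)
    have h' : HasFDerivAt (actionOperator s W F) _ p := h
    change fderiv ℝ (actionOperator s W F) p (actionField Z p)
      + actionMultiplier s Z p * (fderiv ℝ F p (actionField W p) + actionMultiplier s W p * F p) = _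
    rw [h'.fderiv, ← fderiv_actionField]
    simp
    ring
  funext p
  have hsymm : fderiv ℝ (fderiv ℝ F) p (actionField Z p) (actionField W p) =
      fderiv ℝ (fderiv ℝ F) p (actionField W p) (actionField Z p) := by
    have : IsSymmSndFDerivAt ℝ F p :=
      (hF.contDiffAt).isSymmSndFDerivAt (by
        simp only [minSmoothness_of_isRCLikeNormedField]
        exact WithTop.coe_le_coe.2 (le_top (a := (2 : ℕ∞))))
    exact this _ _
  have hf : fderiv ℝ F p (actionField ⁅Z, W⁆ p) =
      fderiv ℝ F p (actionFieldDeriv W p (actionField Z p))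
        - fderiv ℝ F p (actionFieldDeriv Z p (actionField W p)) := by
    rw [← map_sub, actionFieldDeriv_sub]
  have hm : actionMultiplier s ⁅Z, W⁆ p =
      fderiv ℝ (actionMultiplier s W) p (actionField Z p)
        - fderiv ℝ (actionMultiplier s Z) p (actionField W p) := by
    have e : (⁅Z, W⁆ : JacobiAlgebra n).right.1 = ⁅Z.right.1, W.right.1⁆ := rfl
    rw [fderiv_actionMultiplier, fderiv_actionMultiplier, actionMultiplier,
      ← actionPotentialDeriv_sub, e, slEuler_lie]
    simp only [actionField]
    push_cast
    ring
  rw [Pi.sub_apply, key, key, hsymm, actionOperator, hf, hm]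
  ring

/-- The space `I''(q, -n/2, s)`: the smooth functions `F(θ, y)` on `ℝ × ℝⁿ` with
`F(θ + jπ, (-1)^j y) = i^{-jq} F(θ, y)`. (The parameter `s` enters only through the action.) -/
def compactPicture (n : ℕ) (q : ℤ) (_s : ℂ) : Submodule ℂ (ℝ × (Fin n → ℝ) → ℂ) where
  carrier := {F | ContDiff ℝ ∞ F ∧ ∀ (j : ℤ) (θ : ℝ) (y : Fin n → ℝ),
    F (θ + j * Real.pi, (-1 : ℝ) ^ j • y) = Complex.I ^ (-j * q) * F (θ, y)}
  add_mem' {F G} hF hG := ⟨hF.1.add hG.1, fun j θ y => by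
    simp only [Pi.add_apply, hF.2, hG.2, mul_add]⟩
  zero_mem' := ⟨contDiff_const, fun j θ y => by simp⟩
  smul_mem' c F hF := ⟨contDiff_const.smul hF.1, fun j θ y => by
    simp only [Pi.smul_apply, hF.2, smul_eq_mul]
    ring⟩

theorem slTime_add_int_mul_pi (X : LieAlgebra.SpecialLinear.sl (Fin 2) ℝ) (θ : ℝ) (j : ℤ) :
    slTime X (θ + j * Real.pi) = slTime X θ := by
  have h1 : 2 * (θ + j * Real.pi) = 2 * θ + j * (2 * Real.pi) := by ring
  have h2 : ((-1 : ℝ) ^ j) ^ 2 = 1 := by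
    rw [← zpow_natCast, ← zpow_mul, mul_comm, zpow_mul]; simp
  simp only [slTime, h1, Real.sin_add_int_mul_two_pi, Real.cos_add_int_mul_pi,
    Real.sin_add_int_mul_pi, mul_pow, h2, one_mul]

theorem slEuler_add_int_mul_pi (X : LieAlgebra.SpecialLinear.sl (Fin 2) ℝ) (θ : ℝ) (j : ℤ) :
    slEuler X (θ + j * Real.pi) = slEuler X θ := by
  have h1 : 2 * (θ + j * Real.pi) = 2 * θ + j * (2 * Real.pi) := by ring
  simp only [slEuler, h1, Real.sin_add_int_mul_two_pi, Real.cos_add_int_mul_two_pi]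

theorem slPotential_add_int_mul_pi (X : LieAlgebra.SpecialLinear.sl (Fin 2) ℝ) (θ : ℝ) (j : ℤ) :
    slPotential X (θ + j * Real.pi) = slPotential X θ := by
  have h1 : 2 * (θ + j * Real.pi) = 2 * θ + j * (2 * Real.pi) := by ring
  simp only [slPotential, h1, Real.sin_add_int_mul_two_pi, Real.cos_add_int_mul_two_pi]

theorem actionOperator_mem {q : ℤ} {s : ℂ} (Z : JacobiAlgebra n) {F : ℝ × (Fin n → ℝ) → ℂ}
    (hF : F ∈ compactPicture n q s) : actionOperator s Z F ∈ compactPicture n q s := by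
  refine ⟨contDiff_actionOperator s Z hF.1, fun j θ y => ?_⟩
  have h2 : (-1 : ℝ) ^ j * (-1 : ℝ) ^ j = 1 := by
    rw [← sq, ← zpow_natCast, ← zpow_mul, mul_comm, zpow_mul]; simp
  have hfield : actionField Z (θ + j * Real.pi, (-1 : ℝ) ^ j • y) =
      ((actionField Z (θ, y)).1, (-1 : ℝ) ^ j • (actionField Z (θ, y)).2) := by
    simp only [actionField, slTime_add_int_mul_pi, slEuler_add_int_mul_pi,
      Real.cos_add_int_mul_pi, Real.sin_add_int_mul_pi, Matrix.mulVec_smul, smul_add, smul_sub,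
      mul_smul, smul_comm (slEuler Z.right.1 θ)]
  have hmul : actionMultiplier s Z (θ + j * Real.pi, (-1 : ℝ) ^ j • y) =
      actionMultiplier s Z (θ, y) := by
    have : actionPotential Z (θ + j * Real.pi, (-1 : ℝ) ^ j • y) = actionPotential Z (θ, y) := by
      simp only [actionPotential, slPotential_add_int_mul_pi, Real.cos_add_int_mul_pi,
        Real.sin_add_int_mul_pi, dotProduct_smul, smul_dotProduct, smul_eq_mul]
      linear_combination (-slPotential Z.right.1 θ * (y ⬝ᵥ y)
        - 2 * Real.sin θ * (Z.left.u ⬝ᵥ y) - 2 * Real.cos θ * (Z.left.v ⬝ᵥ y)) * h2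
    simp only [actionMultiplier, this, slEuler_add_int_mul_pi]
  have hderiv : fderiv ℝ F (θ + j * Real.pi, (-1 : ℝ) ^ j • y)
      ((actionField Z (θ, y)).1, (-1 : ℝ) ^ j • (actionField Z (θ, y)).2) =
      Complex.I ^ (-j * q) * fderiv ℝ F (θ, y) (actionField Z (θ, y)) := by
    have hd : Differentiable ℝ F := hF.1.differentiable (by simp)
    have a1 := (hd (θ + j * Real.pi, (-1 : ℝ) ^ j • y)).hasFDerivAt.hasLineDerivAt
      ((actionField Z (θ, y)).1, (-1 : ℝ) ^ j • (actionField Z (θ, y)).2)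
    have a2 := ((hd (θ, y)).hasFDerivAt.hasLineDerivAt (actionField Z (θ, y)))
    have a3 : HasDerivAt (fun t : ℝ => F ((θ, y) + t • actionField Z (θ, y)))
      (fderiv ℝ F (θ, y) (actionField Z (θ, y))) 0 := a2
    refine HasDerivAt.unique (x := (0 : ℝ)) a1 ((a3.const_mul _).congr_of_eventuallyEq
      (Filter.Eventually.of_forall fun t => ?_))
    have := hF.2 j (θ + t * (actionField Z (θ, y)).1) (y + t • (actionField Z (θ, y)).2)
    refine Eq.trans (congrArg F ?_) this
    ext1
    · simp; ring
    · simp [smul_comm t]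
  simp only [actionOperator]
  rw [hfield, hmul, hderiv, hF.2]
  ring

theorem actionField_add (Z W : JacobiAlgebra n) (p : ℝ × (Fin n → ℝ)) :
    actionField (Z + W) p = actionField Z p + actionField W p := by
  have e (X Y : LieAlgebra.SpecialLinear.sl (Fin 2) ℝ) (i j : Fin 2) :
    (X + Y).1 i j = X.1 i j + Y.1 i j := rfl
  ext1
  · simp [actionField, slTime, e]; ring
  · ext i
    simp [actionField, slEuler, e, Matrix.add_mulVec]; ring

theorem actionField_smul (c : ℝ) (Z : JacobiAlgebra n) (p : ℝ × (Fin n → ℝ)) :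
    actionField (c • Z) p = c • actionField Z p := by
  have e (X : LieAlgebra.SpecialLinear.sl (Fin 2) ℝ) (i j : Fin 2) :
    (c • X).1 i j = c * X.1 i j := rfl
  ext1
  · simp [actionField, slTime, e]; ring
  · ext i
    simp [actionField, slEuler, e, Matrix.smul_mulVec]; ring

theorem actionMultiplier_add (s : ℂ) (Z W : JacobiAlgebra n) (p : ℝ × (Fin n → ℝ)) :
    actionMultiplier s (Z + W) p = actionMultiplier s Z p + actionMultiplier s W p := by
  have e (X Y : LieAlgebra.SpecialLinear.sl (Fin 2) ℝ) (i j : Fin 2) :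
    (X + Y).1 i j = X.1 i j + Y.1 i j := rfl
  simp [actionMultiplier, actionPotential, slEuler, slPotential, e, add_dotProduct]; ring

theorem actionMultiplier_smul (s : ℂ) (c : ℝ) (Z : JacobiAlgebra n) (p : ℝ × (Fin n → ℝ)) :
    actionMultiplier s (c • Z) p = c * actionMultiplier s Z p := by
  have e (X : LieAlgebra.SpecialLinear.sl (Fin 2) ℝ) (i j : Fin 2) :
    (c • X).1 i j = c * X.1 i j := rfl
  simp [actionMultiplier, actionPotential, slEuler, slPotential, e, smul_dotProduct]; ring

/-- `𝔤` acts on `I''(q, -n/2, s)` by the differential operators above. -/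
instance (n : ℕ) (q : ℤ) (s : ℂ) : LieRingModule (JacobiAlgebra n) (compactPicture n q s) where
  bracket Z F := ⟨actionOperator s Z F.1, actionOperator_mem Z F.2⟩
  add_lie Z W F := by
    apply Subtype.ext
    funext p
    change actionOperator s (Z + W) F.1 p = actionOperator s Z F.1 p + actionOperator s W F.1 p
    simp only [actionOperator, actionField_add, actionMultiplier_add, map_add]
    ring
  lie_add Z F G := by
    apply Subtype.ext
    funext p
    change actionOperator s Z (F.1 + G.1) p = actionOperator s Z F.1 p + actionOperator s Z G.1 p
    have hF : DifferentiableAt ℝ F.1 p := F.2.1.differentiable (by simp) p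
    have hG : DifferentiableAt ℝ G.1 p := G.2.1.differentiable (by simp) p
    simp only [actionOperator, fderiv_add hF hG, Pi.add_apply, _root_.add_apply]
    ring
  leibniz_lie Z W F := by
    apply Subtype.ext
    change actionOperator s Z (actionOperator s W F.1) =
      actionOperator s ⁅Z, W⁆ F.1 + actionOperator s W (actionOperator s Z F.1)
    rw [actionOperator_lie s Z W F.2.1, sub_add_cancel]

theorem coe_lie_compactPicture {q : ℤ} {s : ℂ} (Z : JacobiAlgebra n) (F : compactPicture n q s) :
    ((⁅Z, F⁆ : compactPicture n q s) : ℝ × (Fin n → ℝ) → ℂ) = actionOperator s Z F := rfl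

theorem lie_smul_compactPicture {q : ℤ} {s : ℂ} (Z : JacobiAlgebra n) (c : ℂ)
    (F : compactPicture n q s) : ⁅Z, c • F⁆ = c • ⁅Z, F⁆ := by
  apply Subtype.ext
  funext p
  change actionOperator s Z (c • F.1) p = c * actionOperator s Z F.1 p
  have hF : DifferentiableAt ℝ F.1 p := F.2.1.differentiable (by simp) p
  simp only [actionOperator, fderiv_const_smul hF, Pi.smul_apply, smul_eq_mul,
    _root_.smul_apply]
  ring

instance (n : ℕ) (q : ℤ) (s : ℂ) : LieModule ℝ (JacobiAlgebra n) (compactPicture n q s) where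
  smul_lie c Z F := by
    apply Subtype.ext
    funext p
    change actionOperator s (c • Z) F.1 p = c • actionOperator s Z F.1 p
    simp only [actionOperator, actionField_smul, actionMultiplier_smul, map_smul,
      Complex.real_smul]
    ring
  lie_smul c Z F := by
    have e (G : compactPicture n q s) : c • G = (c : ℂ) • G := by
      apply Subtype.ext
      funext p
      exact (Complex.real_smul (x := c) (z := G.1 p))
    rw [e, e, lie_smul_compactPicture]

/-- The action of `O(n)` on `I''(q, -n/2, s)`: `(u.F)(θ, y) = F(θ, u⁻¹ y)`. -/
def rotate {q : ℤ} {s : ℂ} (u : Matrix.orthogonalGroup (Fin n) ℝ) (F : compactPicture n q s) :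
    compactPicture n q s :=
  ⟨fun p => F.1 (p.1, (u⁻¹).1 *ᵥ p.2), by
    have h : ContDiff ℝ ∞ (fun y : Fin n → ℝ => (u⁻¹).1 *ᵥ y) :=
      (LinearMap.toContinuousLinearMap (Matrix.mulVecLin (u⁻¹).1)).contDiff
    refine ⟨F.2.1.comp (contDiff_fst.prodMk (h.comp contDiff_snd)), fun j θ y => ?_⟩
    change F.1 (_, (u⁻¹).1 *ᵥ ((-1 : ℝ) ^ j • y)) = _ * F.1 (θ, (u⁻¹).1 *ᵥ y)
    rw [← F.2.2 j θ, Matrix.mulVec_smul]⟩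

end

/-- The confluent hypergeometric function `₁F₁(a, b, z) = ∑ (a)_j / (b)_j z^j / j!`. -/
def confluentHypergeometric (a b z : ℂ) : ℂ :=
  ∑' j : ℕ, (ascPochhammer ℂ j).eval a / (ascPochhammer ℂ j).eval b * (z ^ j / (j.factorial : ℂ))

/-- The space `𝓗_k(ℝⁿ)` of (complex) harmonic polynomials, homogeneous of degree `k`. -/
def harmonicPolynomials (n k : ℕ) : Submodule ℂ (MvPolynomial (Fin n) ℂ) :=
  MvPolynomial.homogeneousSubmodule (Fin n) ℂ k ⊓
    LinearMap.ker (∑ j : Fin n,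
      (MvPolynomial.pderiv (R := ℂ) j).toLinearMap ∘ₗ (MvPolynomial.pderiv (R := ℂ) j).toLinearMap)

/-- The function `F_{m,l,k}` attached to `h ∈ 𝓗_k(ℝⁿ)`:
`e^{-imθ/2} e^{-isρ²} ρ^{2l} h(y) ₁F₁((m+4l+2k+n)/4, 2l+k+n/2, 2isρ²)` with `ρ = ‖y‖`. -/
def kFiniteVector (n : ℕ) (s : ℂ) (m : ℤ) (l k : ℕ) (h : MvPolynomial (Fin n) ℂ) :
    ℝ × (Fin n → ℝ) → ℂ := fun p =>
  Complex.exp (-Complex.I * m * p.1 / 2) * Complex.exp (-Complex.I * s * (p.2 ⬝ᵥ p.2 : ℝ)) *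
    ((p.2 ⬝ᵥ p.2 : ℝ) : ℂ) ^ l * MvPolynomial.eval (fun j => (p.2 j : ℂ)) h *
    confluentHypergeometric ((m + 4 * l + 2 * k + n) / 4) (2 * l + k + n / 2)
      (2 * Complex.I * s * (p.2 ⬝ᵥ p.2 : ℝ))

/-- The span in `I''(q, -n/2, s)` of the `F_{m,l,k}` with `h ∈ 𝓗_k(ℝⁿ)`, `m ≡ 2k + q mod 4` and
`m ∈ M`. -/
def kFiniteSpan (n : ℕ) (q : ℤ) (s : ℂ) (M : Set ℤ) (l k : ℕ) :
    Submodule ℂ (compactPicture n q s) :=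
  Submodule.span ℂ {F | ∃ m ∈ M, ∃ h ∈ harmonicPolynomials n k,
    m ≡ 2 * k + q [ZMOD 4] ∧ (F : ℝ × (Fin n → ℝ) → ℂ) = kFiniteVector n s m l k h}

/-- `H_{l,k}`. -/
def Hlk (n : ℕ) (q : ℤ) (s : ℂ) (l k : ℕ) : Submodule ℂ (compactPicture n q s) :=
  kFiniteSpan n q s Set.univ l k

/-- `H_{l,k}^+`. -/
def HlkPlus (n : ℕ) (q : ℤ) (s : ℂ) (l k : ℕ) : Submodule ℂ (compactPicture n q s) :=
  kFiniteSpan n q s {m | (2 * k + 4 * l + n : ℤ) ≤ m} l k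

/-- `H_{l,k}^-`. -/
def HlkMinus (n : ℕ) (q : ℤ) (s : ℂ) (l k : ℕ) : Submodule ℂ (compactPicture n q s) :=
  kFiniteSpan n q s {m | m ≤ -(2 * k + 4 * l + n : ℤ)} l k

/-- `H_0`, the sum of the `H_{0,k}`. -/
def HZero (n : ℕ) (q : ℤ) (s : ℂ) : Submodule ℂ (compactPicture n q s) :=
  ⨆ k : ℕ, Hlk n q s 0 k

/-- `H_0^+`, the sum of the `H_{0,k}^+`. -/
def HZeroPlus (n : ℕ) (q : ℤ) (s : ℂ) : Submodule ℂ (compactPicture n q s) :=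
  ⨆ k : ℕ, HlkPlus n q s 0 k

/-- `H_0^-`, the sum of the `H_{0,k}^-`. -/
def HZeroMinus (n : ℕ) (q : ℤ) (s : ℂ) : Submodule ℂ (compactPicture n q s) :=
  ⨆ k : ℕ, HlkMinus n q s 0 k

/-- `H^+`, the sum of the `H_{l,k}^+` with `l ≥ 1`. -/
def HPlus (n : ℕ) (q : ℤ) (s : ℂ) : Submodule ℂ (compactPicture n q s) :=
  ⨆ (l : ℕ) (_ : 1 ≤ l) (k : ℕ), HlkPlus n q s l k

/-- `H^-`, the sum of the `H_{l,k}^-` with `l ≥ 1`. -/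
def HMinus (n : ℕ) (q : ℤ) (s : ℂ) : Submodule ℂ (compactPicture n q s) :=
  ⨆ (l : ℕ) (_ : 1 ≤ l) (k : ℕ), HlkMinus n q s l k

/-- The full space: `H_0` together with the sum of the `H_{l,k}` with `l ≥ 1`. -/
def HTotal (n : ℕ) (q : ℤ) (s : ℂ) : Submodule ℂ (compactPicture n q s) :=
  HZero n q s ⊔ ⨆ (l : ℕ) (_ : 1 ≤ l) (k : ℕ), Hlk n q s l k

/-- A `𝔤`-submodule: a complex subspace that is stable under `𝔤`. -/
def IsGSubmodule {n : ℕ} {q : ℤ} {s : ℂ} (W : Submodule ℂ (compactPicture n q s)) : Prop :=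
  ∀ Z : JacobiAlgebra n, ∀ F ∈ W, ⁅Z, F⁆ ∈ W

/-- A `(𝔤, O(n))`-submodule: a complex subspace that is stable under `𝔤` and `O(n)`. -/
def IsGOSubmodule {n : ℕ} {q : ℤ} {s : ℂ} (W : Submodule ℂ (compactPicture n q s)) : Prop :=
  IsGSubmodule W ∧ ∀ u : Matrix.orthogonalGroup (Fin n) ℝ, ∀ F ∈ W, rotate u F ∈ W

/-- `W` is irreducible for the notion `P` of submodule: a non-zero submodule without
submodules other than `0` and itself. -/
def IsIrreducibleFor {V : Type*} [AddCommGroup V] [Module ℂ V] (P : Submodule ℂ V → Prop)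
    (W : Submodule ℂ V) : Prop :=
  P W ∧ W ≠ ⊥ ∧ ∀ U, P U → U ≤ W → U = ⊥ ∨ U = W

/-- `W 0 ⊂ W 1 ⊂ ⋯ ⊂ W r` is a composition series of `M` for the notion `P` of submodule: it leads
strictly from `0` to `M` through submodules, and no submodule lies strictly between two consecutive
terms, i.e. the successive quotients are irreducible. -/
structure IsCompositionSeriesFor {V : Type*} [AddCommGroup V] [Module ℂ V]
    (P : Submodule ℂ V → Prop) (M : Submodule ℂ V) {r : ℕ} (W : Fin (r + 1) → Submodule ℂ V) :
    Prop where
  bot : W 0 = ⊥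
  top : W (Fin.last r) = M
  submodule : ∀ i, P (W i)
  lt : ∀ i : Fin r, W i.castSucc < W i.succ
  irreducible : ∀ (i : Fin r) (U : Submodule ℂ V), P U → W i.castSucc ≤ U → U ≤ W i.succ →
    U = W i.castSucc ∨ U = W i.succ

end

/-! Put β = 4l + 2k + n. The complexification of 𝔤 acts on the functions F_{m,l,k}^h by a few
explicit shifts. The compact generator of 𝔰𝔩(2) is the scalar im/2. The operators `slOp ε` move m to
m + 4ε with coefficient -(β + εm)/2. The Heisenberg operators `ladderOp ε j` move m to m + 2ε and
give four terms: ∂_j h at (l, k-1) and (l+1, k-1), and the harmonic part of y_j h at (l-1, k+1) and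
(l, k+1). These formulas are contiguous relations of ₁F₁ (`slOp_kFiniteVector`,
`ladderOp_kFiniteVector`). Only the zeros of the coefficients matter afterwards (`ladderOp_kVec`):
the two terms that raise β carry the factor β + εm, and the one that raises l also carries the
factor l.

The factor l makes the vectors with l = 0 a submodule. Since m ≡ 2k + q mod 4, one has β - m ≡ n - q
and β + m ≡ n + q mod 4. So a wall m = β occurs only for q ≡ n, a wall m = -β only for q ≡ -n, and
the vectors on or beyond a wall form a submodule. All members of the composition series come from
these index sets by unions and intersections (`isGSubmodule_indexSpan`).

Irreducibility of the quotients has two ingredients. First, the compact generator, the Casimir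
operator of 𝔰𝔬(n) and `slOp 1 ∘ slOp (-1)` have joint eigenvalues that determine (m, l, k), so a
submodule contains every component of each of its finite sums of weight vectors (`component_mem`).
This also gives directness of the sum. Second, the indices of a layer are connected by non-zero
coefficients (`IsRegion`). Starting from one vector, derivatives lead down to k = 0, where the
harmonic polynomials are constants, and the identity `sum_harmonicMul_pderiv` leads back to all of
𝓗_k (`full_of_mem`); for l ≥ 1 one also moves between neighbouring l (`full_of_mem_of_pos`). Thus
irreducibility of 𝓗_k under 𝔰𝔬(n) is never needed.

The descent to k = 0 fails in one place: if n = 2 and q ≡ 2 mod 4, the layer l = 0, |m| < β has no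
vector with k = 0. It starts at 𝓗_1, which is reducible under 𝔰𝔬(2) but irreducible under O(2)
(`full_one_of_mem`). -/

/-! ### Convergence, derivative and contiguous relations of ₁F₁ -/

section ConfluentHypergeometric

/-- The coefficient `(a)_j / (b)_j` of the confluent hypergeometric series. -/
noncomputable def pochhammerRatio (a b : ℂ) (j : ℕ) : ℂ :=
  (ascPochhammer ℂ j).eval a / (ascPochhammer ℂ j).eval b

theorem add_natCast_ne_zero_of_re_pos {b : ℂ} (hb : 0 < b.re) (j : ℕ) : b + j ≠ 0 := by
  intro h
  have := congrArg Complex.re h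
  simp at this
  have : (0 : ℝ) ≤ j := Nat.cast_nonneg j
  linarith

theorem ascPochhammer_eval_ne_zero_of_re_pos {b : ℂ} (hb : 0 < b.re) (j : ℕ) :
    (ascPochhammer ℂ j).eval b ≠ 0 := by
  induction j with
  | zero => simp
  | succ j ih =>
    rw [ascPochhammer_succ_eval]
    exact mul_ne_zero ih (add_natCast_ne_zero_of_re_pos hb j)

theorem ascPochhammer_eval_mul_add (a : ℂ) (j : ℕ) :
    a * (ascPochhammer ℂ j).eval (a + 1) = (ascPochhammer ℂ j).eval a * (a + j) := by
  rw [← ascPochhammer_succ_eval, ascPochhammer_succ_left]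
  simp [Polynomial.eval_mul, Polynomial.eval_comp]

theorem pochhammerRatio_zero (a b : ℂ) : pochhammerRatio a b 0 = 1 := by
  simp [pochhammerRatio]

theorem pochhammerRatio_succ (a b : ℂ) (j : ℕ) :
    pochhammerRatio a b (j + 1) = pochhammerRatio a b j * ((a + j) / (b + j)) := by
  simp only [pochhammerRatio, ascPochhammer_succ_eval]
  rw [mul_div_mul_comm]

theorem pochhammerRatio_succ_left {a b : ℂ} (hb : 0 < b.re) (j : ℕ) :
    pochhammerRatio a b (j + 1) = a / b * pochhammerRatio (a + 1) (b + 1) j := by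
  have hb0 : b ≠ 0 := by simpa using add_natCast_ne_zero_of_re_pos hb 0
  have h1 := ascPochhammer_eval_ne_zero_of_re_pos hb (j + 1)
  have h2 : (ascPochhammer ℂ j).eval (b + 1) ≠ 0 :=
    ascPochhammer_eval_ne_zero_of_re_pos (by simp; linarith) j
  simp only [pochhammerRatio]
  rw [div_mul_div_comm, ascPochhammer_succ_eval, ascPochhammer_succ_eval,
    ← ascPochhammer_eval_mul_add, ← ascPochhammer_eval_mul_add]

/-- Each new factor (a + j)/(b + j) = 1 + (a - b)/(b + j) is bounded independently of j, because |b
+ j| ≥ Re b. Geometric growth suffices for comparison with the exponential series. -/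
theorem exists_norm_pochhammerRatio_le (a : ℂ) {b : ℂ} (hb : 0 < b.re) :
    ∃ M : ℝ, 0 ≤ M ∧ ∀ j, ‖pochhammerRatio a b j‖ ≤ M ^ j := by
  refine ⟨1 + ‖a - b‖ / b.re, by positivity, fun j => ?_⟩
  induction j with
  | zero => simp [pochhammerRatio_zero]
  | succ j ih =>
    rw [pochhammerRatio_succ, norm_mul, pow_succ]
    refine mul_le_mul ih ?_ (norm_nonneg _) (by positivity)
    have hne := add_natCast_ne_zero_of_re_pos hb j
    have hle : b.re ≤ ‖b + j‖ := by
      refine le_trans ?_ (Complex.re_le_norm _)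
      simp
    have : (a + j) / (b + j) = 1 + (a - b) / (b + j) := by
      field_simp
      ring
    rw [this]
    refine (norm_add_le _ _).trans ?_
    rw [norm_one, norm_div]
    gcongr

theorem summable_pochhammerRatio (a : ℂ) {b : ℂ} (hb : 0 < b.re) (z : ℂ) :
    Summable fun j : ℕ => pochhammerRatio a b j * (z ^ j / (j.factorial : ℂ)) := by
  obtain ⟨M, hM, h⟩ := exists_norm_pochhammerRatio_le a hb
  refine Summable.of_norm_bounded (Real.summable_pow_div_factorial (M * ‖z‖)) fun j => ?_
  rw [norm_mul, norm_div, norm_pow, mul_pow, mul_div_assoc, Complex.norm_natCast]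
  gcongr
  exact h j

theorem confluentHypergeometric_eq_tsum (a b z : ℂ) :
    confluentHypergeometric a b z =
      ∑' j : ℕ, pochhammerRatio a b j * (z ^ j / (j.factorial : ℂ)) := rfl

theorem confluentHypergeometric_zero (a b : ℂ) : confluentHypergeometric a b 0 = 1 := by
  rw [confluentHypergeometric_eq_tsum, tsum_eq_single 0]
  · simp [pochhammerRatio_zero]
  · intro j hj
    simp [hj]

/-- Termwise differentiation on the disc of radius ‖z‖ + 1, where the differentiated series has a
summable uniform bound. Shifting the index turns (a)_{j+1}/(b)_{j+1} into (a/b) (a+1)_j/(b+1)_j. -/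
theorem hasDerivAt_confluentHypergeometric (a : ℂ) {b : ℂ} (hb : 0 < b.re) (z : ℂ) :
    HasDerivAt (confluentHypergeometric a b)
      (a / b * confluentHypergeometric (a + 1) (b + 1) z) z := by
  obtain ⟨M, hM, h⟩ := exists_norm_pochhammerRatio_le a hb
  set R : ℝ := ‖z‖ + 1
  have hR : 0 ≤ R := by positivity
  have hd : ∀ (j : ℕ) (w : ℂ), HasDerivAt
      (fun w => pochhammerRatio a b j * (w ^ j / (j.factorial : ℂ)))
      (pochhammerRatio a b j * (j * w ^ (j - 1) / (j.factorial : ℂ))) w := fun j w =>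
    ((hasDerivAt_pow j w).div_const _).const_mul _
  have hsucc : ∀ (j : ℕ) (w : ℂ),
      pochhammerRatio a b (j + 1) * (((j + 1 : ℕ) : ℂ) * w ^ j / ((j + 1).factorial : ℂ)) =
        pochhammerRatio a b (j + 1) * (w ^ j / (j.factorial : ℂ)) := by
    intro j w
    have : ((j + 1 : ℕ) : ℂ) ≠ 0 := Nat.cast_ne_zero.2 (by omega)
    rw [Nat.factorial_succ, Nat.cast_mul, mul_div_mul_left _ _ this]
  have hu : Summable fun j : ℕ => M ^ j * (j * R ^ (j - 1) / (j.factorial : ℝ)) := by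
    rw [← summable_nat_add_iff 1]
    refine ((Real.summable_pow_div_factorial (M * R)).mul_left M).congr fun j => ?_
    have : ((j + 1 : ℕ) : ℝ) ≠ 0 := Nat.cast_ne_zero.2 (by omega)
    rw [Nat.factorial_succ, Nat.cast_mul, mul_div_mul_left _ _ this, add_tsub_cancel_right]
    ring_nf
  have key := hasDerivAt_tsum_of_isPreconnected (t := Metric.ball (0 : ℂ) R) hu
    Metric.isOpen_ball (convex_ball (0 : ℂ) R).isPreconnected (fun j w _ => hd j w)
    (fun j w hw => by
      rw [norm_mul, norm_div, norm_mul, norm_pow, Complex.norm_natCast, Complex.norm_natCast]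
      have : ‖w‖ ≤ R := by simpa using (mem_ball_zero_iff.1 hw).le
      gcongr
      exact h j)
    (y₀ := z) (y := z) (by simp [R]) (summable_pochhammerRatio a hb z) (by simp [R])
  refine key.congr_deriv ?_
  have hs : Summable fun j : ℕ =>
      pochhammerRatio a b j * (j * z ^ (j - 1) / (j.factorial : ℂ)) := by
    rw [← summable_nat_add_iff 1]
    refine ((summable_pochhammerRatio (a + 1) (b := b + 1)
      (by simp; linarith) z).mul_left (a / b)).congr fun j => ?_
    rw [add_tsub_cancel_right, hsucc, pochhammerRatio_succ_left hb]
    ring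
  rw [hs.tsum_eq_zero_add, confluentHypergeometric_eq_tsum, ← tsum_mul_left]
  simp only [Nat.cast_zero, zero_mul, zero_div, mul_zero, zero_add]
  refine tsum_congr fun j => ?_
  rw [add_tsub_cancel_right, hsucc, pochhammerRatio_succ_left hb]
  ring

theorem differentiable_confluentHypergeometric (a : ℂ) {b : ℂ} (hb : 0 < b.re) :
    Differentiable ℂ (confluentHypergeometric a b) := fun z =>
  (hasDerivAt_confluentHypergeometric a hb z).differentiableAt

/-- `₁F₁(a+1, b) = ₁F₁(a, b) + (z/b) ₁F₁(a+1, b+1)`. -/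
theorem confluentHypergeometric_add_one_left (a : ℂ) {b : ℂ} (hb : 0 < b.re) (z : ℂ) :
    confluentHypergeometric (a + 1) b z =
      confluentHypergeometric a b z + z / b * confluentHypergeometric (a + 1) (b + 1) z := by
  have hb1 : 0 < (b + 1).re := by simp; linarith
  have hb0 : b ≠ 0 := by simpa using add_natCast_ne_zero_of_re_pos hb 0
  simp only [confluentHypergeometric_eq_tsum]
  rw [(summable_pochhammerRatio (a + 1) hb z).tsum_eq_zero_add,
    (summable_pochhammerRatio a hb z).tsum_eq_zero_add, pochhammerRatio_zero,
    pochhammerRatio_zero, add_assoc, ← tsum_mul_left, ← Summable.tsum_add]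
  · congr 1
    refine tsum_congr fun j => ?_
    have hj : ((j : ℂ) + 1) ≠ 0 := by exact_mod_cast Nat.succ_ne_zero j
    have hf : (j.factorial : ℂ) ≠ 0 := by exact_mod_cast j.factorial_ne_zero
    have hbj := add_natCast_ne_zero_of_re_pos hb1 j
    have hbj' : b + (j : ℂ) ≠ 0 := add_natCast_ne_zero_of_re_pos hb j
    -- Once the constant terms are split off, all three coefficients are multiples of
    -- `pochhammerRatio (a + 1) (b + 1) j`, and the identity reduces to a + 1 + j = a + (j + 1).
    have key : pochhammerRatio (a + 1) b (j + 1) =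
        (a + 1 + j) / b * pochhammerRatio (a + 1) (b + 1) j := by
      have h2 : (ascPochhammer ℂ j).eval (b + 1) ≠ 0 :=
        ascPochhammer_eval_ne_zero_of_re_pos hb1 j
      simp only [pochhammerRatio]
      rw [ascPochhammer_succ_eval, ascPochhammer_succ_eval, ← ascPochhammer_eval_mul_add b]
      field_simp
    rw [key, pochhammerRatio_succ_left hb, Nat.factorial_succ, pow_succ]
    push_cast
    field_simp
    ring
  · exact (summable_nat_add_iff (f := fun j : ℕ =>
      pochhammerRatio a b j * (z ^ j / (j.factorial : ℂ))) 1).2 (summable_pochhammerRatio a hb z)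
  · exact (summable_pochhammerRatio (a + 1) hb1 z).mul_left _

/-- `a ₁F₁(a+1, b+1) - b ₁F₁(a, b) = (a - b) ₁F₁(a, b+1)`. -/
theorem confluentHypergeometric_sub (a : ℂ) {b : ℂ} (hb : 0 < b.re) (z : ℂ) :
    a * confluentHypergeometric (a + 1) (b + 1) z - b * confluentHypergeometric a b z =
      (a - b) * confluentHypergeometric a (b + 1) z := by
  have hb1 : 0 < (b + 1).re := by simp; linarith
  have hb0 : b ≠ 0 := by simpa using add_natCast_ne_zero_of_re_pos hb 0
  simp only [confluentHypergeometric_eq_tsum]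
  rw [← tsum_mul_left, ← tsum_mul_left, ← tsum_mul_left, ← Summable.tsum_sub]
  · refine tsum_congr fun j => ?_
    have hbj : b + (j : ℂ) ≠ 0 := add_natCast_ne_zero_of_re_pos hb j
    have h1 := ascPochhammer_eval_ne_zero_of_re_pos hb j
    have h2 : (ascPochhammer ℂ j).eval (b + 1) ≠ 0 := ascPochhammer_eval_ne_zero_of_re_pos hb1 j
    have e1 := ascPochhammer_eval_mul_add a j
    have e2 := ascPochhammer_eval_mul_add b j
    have e3 : pochhammerRatio a b j = (b + j) / b * pochhammerRatio a (b + 1) j := by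
      simp only [pochhammerRatio]
      field_simp
      linear_combination (ascPochhammer ℂ j).eval a * e2
    have e4 : a * pochhammerRatio (a + 1) (b + 1) j = (a + j) * pochhammerRatio a (b + 1) j := by
      simp only [pochhammerRatio]
      field_simp
      linear_combination e1
    have : b * ((b + j) / b) = b + j := by field_simp
    rw [e3]
    linear_combination (z ^ j / (j.factorial : ℂ)) * e4
      - pochhammerRatio a (b + 1) j * (z ^ j / (j.factorial : ℂ)) * this
  · exact (summable_pochhammerRatio (a + 1) hb1 z).mul_left _
  · exact (summable_pochhammerRatio a hb z).mul_left _

end ConfluentHypergeometric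

/-! ### Harmonic polynomials: derivatives, harmonic multiplication, rotations -/

section HarmonicPolynomials
open MvPolynomial

variable {n : ℕ}

/-- The commutator of two derivations is a derivation, so it is enough that it kills the variables.
-/
theorem pderiv_pderiv_comm (i j : Fin n) (h : MvPolynomial (Fin n) ℂ) :
    pderiv i (pderiv j h) = pderiv j (pderiv i h) := by
  have : ⁅pderiv (R := ℂ) i, pderiv (R := ℂ) j⁆ =
      (0 : Derivation ℂ (MvPolynomial (Fin n) ℂ) (MvPolynomial (Fin n) ℂ)) := by
    refine MvPolynomial.derivation_ext fun k => ?_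
    rw [Derivation.commutator_apply, pderiv_X, pderiv_X]
    simp only [Pi.single_apply]
    split_ifs <;> simp
  have h2 := congrArg (fun D => D h) this
  simp only [Derivation.commutator_apply, Derivation.coe_zero, Pi.zero_apply] at h2
  exact sub_eq_zero.1 h2

/-- The Laplace operator on polynomials. -/
noncomputable def polyLaplacian (h : MvPolynomial (Fin n) ℂ) : MvPolynomial (Fin n) ℂ :=
  ∑ j, pderiv j (pderiv j h)

theorem mem_harmonicPolynomials {k : ℕ} {h : MvPolynomial (Fin n) ℂ} :
    h ∈ harmonicPolynomials n k ↔ h.IsHomogeneous k ∧ polyLaplacian h = 0 := by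
  simp [harmonicPolynomials, polyLaplacian, Submodule.mem_inf]

theorem polyLaplacian_sub (g h : MvPolynomial (Fin n) ℂ) :
    polyLaplacian (g - h) = polyLaplacian g - polyLaplacian h := by
  simp [polyLaplacian, Finset.sum_sub_distrib]

theorem polyLaplacian_sum {ι : Type*} (t : Finset ι) (f : ι → MvPolynomial (Fin n) ℂ) :
    polyLaplacian (∑ i ∈ t, f i) = ∑ i ∈ t, polyLaplacian (f i) := by
  simp only [polyLaplacian, map_sum]
  exact Finset.sum_comm

theorem polyLaplacian_C_mul (c : ℂ) (h : MvPolynomial (Fin n) ℂ) :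
    polyLaplacian (C c * h) = C c * polyLaplacian h := by
  simp [polyLaplacian, Finset.mul_sum]

theorem polyLaplacian_pderiv (j : Fin n) (h : MvPolynomial (Fin n) ℂ) :
    polyLaplacian (pderiv j h) = pderiv j (polyLaplacian h) := by
  simp only [polyLaplacian, map_sum]
  refine Finset.sum_congr rfl fun i _ => ?_
  rw [pderiv_pderiv_comm i j, pderiv_pderiv_comm i j]

theorem polyLaplacian_X_mul (j : Fin n) (h : MvPolynomial (Fin n) ℂ) :
    polyLaplacian (X j * h) = 2 * pderiv j h + X j * polyLaplacian h := by
  have key : ∀ i : Fin n, pderiv i (pderiv i (X j * h)) =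
      2 * (Pi.single (M := fun _ => MvPolynomial (Fin n) ℂ) i 1 j * pderiv i h) +
        X j * pderiv i (pderiv i h) := by
    intro i
    by_cases hij : i = j
    · subst hij
      simp only [pderiv_mul, pderiv_X_self, map_add, Pi.single_eq_same, one_mul]
      ring
    · simp [pderiv_X_of_ne (Ne.symm hij), Pi.single_eq_of_ne (Ne.symm hij)]
  simp only [polyLaplacian, key, Finset.sum_add_distrib, ← Finset.mul_sum]
  congr 2
  rw [Finset.sum_eq_single j]
  · simp
  · intro i _ hij
    rw [Pi.single_eq_of_ne (Ne.symm hij), zero_mul]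
  · simp

/-- The polynomial `‖y‖²`. -/
noncomputable def normSqPoly (n : ℕ) : MvPolynomial (Fin n) ℂ := ∑ j, X j * X j

theorem polyLaplacian_normSqPoly_mul (g : MvPolynomial (Fin n) ℂ) :
    polyLaplacian (normSqPoly n * g) =
      2 * (n : MvPolynomial (Fin n) ℂ) * g + 4 * ∑ j, X j * pderiv j g
        + normSqPoly n * polyLaplacian g := by
  have key : ∀ j : Fin n, polyLaplacian (X j * X j * g) =
      2 * g + 4 * (X j * pderiv j g) + X j * X j * polyLaplacian g := by
    intro j
    rw [mul_assoc, polyLaplacian_X_mul, polyLaplacian_X_mul, pderiv_mul, pderiv_X_self]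
    ring
  rw [normSqPoly, Finset.sum_mul, polyLaplacian_sum]
  simp only [key, Finset.sum_add_distrib, ← Finset.mul_sum, ← Finset.sum_mul]
  simp
  ring

theorem pderiv_mem_harmonicPolynomials {k : ℕ} {h : MvPolynomial (Fin n) ℂ}
    (hh : h ∈ harmonicPolynomials n (k + 1)) (j : Fin n) :
    pderiv j h ∈ harmonicPolynomials n k := by
  rw [mem_harmonicPolynomials] at hh ⊢
  refine ⟨by simpa using hh.1.pderiv (i := j), ?_⟩
  rw [polyLaplacian_pderiv, hh.2, map_zero]

theorem pderiv_eq_zero_of_mem_harmonicPolynomials_zero {h : MvPolynomial (Fin n) ℂ}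
    (hh : h ∈ harmonicPolynomials n 0) (j : Fin n) : pderiv j h = 0 := by
  have h1 := (mem_harmonicPolynomials.1 hh).1
  rw [← totalDegree_zero_iff_isHomogeneous, totalDegree_eq_zero_iff_eq_C] at h1
  rw [h1, pderiv_C]

theorem pderiv_mem_harmonicPolynomials_sub_one {k : ℕ} {h : MvPolynomial (Fin n) ℂ}
    (hh : h ∈ harmonicPolynomials n k) (j : Fin n) :
    pderiv j h ∈ harmonicPolynomials n (k - 1) := by
  cases k with
  | zero =>
    rw [pderiv_eq_zero_of_mem_harmonicPolynomials_zero hh]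
    exact Submodule.zero_mem _
  | succ k => exact pderiv_mem_harmonicPolynomials hh j

theorem sum_X_mul_pderiv_of_mem {k : ℕ} {h : MvPolynomial (Fin n) ℂ}
    (hh : h ∈ harmonicPolynomials n k) : ∑ j, X j * pderiv j h = (k : MvPolynomial (Fin n) ℂ) * h := by
  rw [(mem_harmonicPolynomials.1 hh).1.sum_X_mul_pderiv, nsmul_eq_mul]

/-- The harmonic projection of `y_j h` for a harmonic polynomial `h` of degree `k`. -/
noncomputable def harmonicMul (k : ℕ) (j : Fin n) (h : MvPolynomial (Fin n) ℂ) :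
    MvPolynomial (Fin n) ℂ :=
  X j * h - C (1 / (2 * k + n - 2 : ℂ)) * (normSqPoly n * pderiv j h)

theorem isHomogeneous_normSqPoly : (normSqPoly n).IsHomogeneous 2 :=
  IsHomogeneous.sum _ _ _ fun j _ => (isHomogeneous_X ℂ j).mul (isHomogeneous_X ℂ j)

theorem two_mul_add_sub_two_ne_zero (hn : 1 ≤ n) (k : ℕ) : (2 * (k + 1 : ℕ) + n - 2 : ℂ) ≠ 0 := by
  have : (2 * (k + 1 : ℕ) + n - 2 : ℂ) = ((2 * k + n : ℕ) : ℂ) := by push_cast; ring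
  rw [this]
  exact Nat.cast_ne_zero.2 (by omega)

/-- Δ(y_j h) = 2 ∂_j h, while Δ(‖y‖² ∂_j h) = (2n + 4(k - 1)) ∂_j h by Euler's identity in degree k
- 1. The constant 1/(2k + n - 2) makes the two cancel. -/
theorem harmonicMul_mem_harmonicPolynomials (hn : 1 ≤ n) {k : ℕ} {h : MvPolynomial (Fin n) ℂ}
    (hh : h ∈ harmonicPolynomials n k) (j : Fin n) :
    harmonicMul k j h ∈ harmonicPolynomials n (k + 1) := by
  have h1 := mem_harmonicPolynomials.1 hh
  have hX : (X j * h).IsHomogeneous (k + 1) := by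
    rw [add_comm]
    exact (isHomogeneous_X ℂ j).mul h1.1
  rw [mem_harmonicPolynomials]
  cases k with
  -- In degree 0 the denominator is n - 2, which may vanish; the correction is absent because ∂_j h
  -- = 0.
  | zero =>
    have h0 := pderiv_eq_zero_of_mem_harmonicPolynomials_zero hh j
    have : harmonicMul 0 j h = X j * h := by simp [harmonicMul, h0]
    rw [this, polyLaplacian_X_mul, h0, h1.2]
    exact ⟨hX, by simp⟩
  | succ k =>
    have hd := pderiv_mem_harmonicPolynomials hh j
    refine ⟨hX.sub (IsHomogeneous.C_mul ?_ _), ?_⟩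
    · have := isHomogeneous_normSqPoly.mul (mem_harmonicPolynomials.1 hd).1
      rwa [show 2 + k = k + 1 + 1 by ring] at this
    · rw [harmonicMul, polyLaplacian_sub, polyLaplacian_X_mul, polyLaplacian_C_mul,
        polyLaplacian_normSqPoly_mul, sum_X_mul_pderiv_of_mem hd, (mem_harmonicPolynomials.1 hd).2,
        h1.2]
      have hc : C (1 / (2 * (k + 1 : ℕ) + n - 2 : ℂ)) *
          (2 * (n : MvPolynomial (Fin n) ℂ) + 4 * (k : MvPolynomial (Fin n) ℂ)) = 2 := by
        have e : (2 * (n : MvPolynomial (Fin n) ℂ) + 4 * (k : MvPolynomial (Fin n) ℂ)) = C (2 * n + 4 * k : ℂ) := by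
          simp [map_ofNat (C : ℂ →+* MvPolynomial (Fin n) ℂ)]
        rw [e, ← C_mul, ← map_ofNat (C : ℂ →+* MvPolynomial (Fin n) ℂ) 2]
        congr 1
        have := two_mul_add_sub_two_ne_zero hn k
        rw [one_div, inv_mul_eq_iff_eq_mul₀ this]
        push_cast
        ring
      linear_combination -(pderiv j h) * hc

/-- The main terms add up by Euler's identity and the corrections to a multiple of ‖y‖² Δh = 0. This
recovers any h of degree k + 1 from harmonic polynomials of degree k, and takes the place of an
irreducibility argument for 𝓗_{k+1}. -/
theorem sum_harmonicMul_pderiv {k : ℕ} {h : MvPolynomial (Fin n) ℂ}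
    (hh : h ∈ harmonicPolynomials n (k + 1)) :
    ∑ j, harmonicMul k j (pderiv j h) = C (k + 1 : ℂ) * h := by
  simp only [harmonicMul, Finset.sum_sub_distrib, ← Finset.mul_sum]
  have h0 : ∑ j, pderiv j (pderiv j h) = 0 := (mem_harmonicPolynomials.1 hh).2
  rw [sum_X_mul_pderiv_of_mem hh, h0]
  simp

theorem exists_pderiv_ne_zero {k : ℕ} {h : MvPolynomial (Fin n) ℂ}
    (hh : h ∈ harmonicPolynomials n (k + 1)) (h0 : h ≠ 0) : ∃ j, pderiv j h ≠ 0 := by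
  by_contra! hc
  have := sum_X_mul_pderiv_of_mem hh
  simp only [hc, mul_zero, Finset.sum_const_zero] at this
  rcases mul_eq_zero.1 this.symm with h1 | h1
  · exact Nat.succ_ne_zero k (by exact_mod_cast h1)
  · exact h0 h1

theorem one_mem_harmonicPolynomials : (1 : MvPolynomial (Fin n) ℂ) ∈ harmonicPolynomials n 0 :=
  mem_harmonicPolynomials.2 ⟨isHomogeneous_one _ _, by simp [polyLaplacian]⟩

theorem X_mem_harmonicPolynomials (j : Fin n) :
    (X j : MvPolynomial (Fin n) ℂ) ∈ harmonicPolynomials n 1 :=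
  mem_harmonicPolynomials.2 ⟨isHomogeneous_X _ _, by
    have := polyLaplacian_X_mul j (1 : MvPolynomial (Fin n) ℂ)
    rw [mul_one] at this
    rw [this]
    simp [polyLaplacian]⟩

theorem eq_C_of_mem_harmonicPolynomials_zero {h : MvPolynomial (Fin n) ℂ}
    (hh : h ∈ harmonicPolynomials n 0) : ∃ c : ℂ, h = C c := by
  have h1 := (mem_harmonicPolynomials.1 hh).1
  rw [← totalDegree_zero_iff_isHomogeneous, totalDegree_eq_zero_iff_eq_C] at h1
  exact ⟨_, h1⟩

/-- The operator `-(A y) ⬝ ∂_y` on polynomials. -/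
noncomputable def rotationDerivation (A : Matrix (Fin n) (Fin n) ℝ)
    (h : MvPolynomial (Fin n) ℂ) : MvPolynomial (Fin n) ℂ :=
  -∑ i, ∑ j, C (A i j : ℂ) * (X j * pderiv i h)

/-- The Laplacian of the image is, up to sign, the contraction of the antisymmetric A with the
symmetric Hessian of h, apart from terms containing Δh. It therefore equals its own negative. -/
theorem rotationDerivation_mem_harmonicPolynomials {A : Matrix (Fin n) (Fin n) ℝ}
    (hA : Aᵀ = -A) {k : ℕ} {h : MvPolynomial (Fin n) ℂ} (hh : h ∈ harmonicPolynomials n k) :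
    rotationDerivation A h ∈ harmonicPolynomials n k := by
  refine Submodule.neg_mem _ (mem_harmonicPolynomials.2 ⟨?_, ?_⟩)
  · refine IsHomogeneous.sum _ _ _ fun i _ => IsHomogeneous.sum _ _ _ fun j _ =>
      IsHomogeneous.C_mul ?_ _
    cases k with
    | zero =>
      rw [pderiv_eq_zero_of_mem_harmonicPolynomials_zero hh, mul_zero]
      exact isHomogeneous_zero _ _ _
    | succ k =>
      rw [add_comm]
      exact (isHomogeneous_X _ _).mul
        (mem_harmonicPolynomials.1 (pderiv_mem_harmonicPolynomials hh i)).1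
  · have hΔ : ∀ i, polyLaplacian (pderiv i h) = 0 := fun i => by
      rw [polyLaplacian_pderiv, (mem_harmonicPolynomials.1 hh).2, map_zero]
    simp only [polyLaplacian_sum, polyLaplacian_C_mul, polyLaplacian_X_mul, hΔ, mul_zero, add_zero]
    have hswap : ∑ i, ∑ j, C (A i j : ℂ) * (2 * pderiv j (pderiv i h)) =
        -∑ i, ∑ j, C (A i j : ℂ) * (2 * pderiv j (pderiv i h)) := by
      conv_lhs => rw [Finset.sum_comm]
      rw [← Finset.sum_neg_distrib]
      refine Finset.sum_congr rfl fun i _ => ?_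
      rw [← Finset.sum_neg_distrib]
      refine Finset.sum_congr rfl fun j _ => ?_
      have : A j i = -A i j := by
        have := congrFun (congrFun hA i) j
        simpa using this
      rw [this, pderiv_pderiv_comm i j]
      push_cast
      rw [C_neg]
      ring
    exact self_eq_neg.1 hswap

/-- The Casimir operator of 𝔰𝔬(n) is, up to normalisation, ‖y‖² Δ - E(E + n - 2) with E the Euler
operator. The sum runs over ordered pairs, hence the factor 2. -/
theorem sum_rotation_sq {k : ℕ} {h : MvPolynomial (Fin n) ℂ} (hh : h ∈ harmonicPolynomials n k) :
    ∑ i, ∑ j, (X i * pderiv j (X i * pderiv j h - X j * pderiv i h)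
        - X j * pderiv i (X i * pderiv j h - X j * pderiv i h)) =
      C (-2 * k * (k + n - 2) : ℂ) * h := by
  have hΔ : ∑ j, pderiv j (pderiv j h) = 0 := (mem_harmonicPolynomials.1 hh).2
  have hE := sum_X_mul_pderiv_of_mem hh
  have hEE : ∑ i, ∑ j, X i * (X j * pderiv j (pderiv i h)) = C (k * (k - 1) : ℂ) * h := by
    cases k with
    | zero => simp [pderiv_eq_zero_of_mem_harmonicPolynomials_zero hh]
    | succ k =>
      have : ∀ i, ∑ j, X i * (X j * pderiv j (pderiv i h)) = (k : MvPolynomial (Fin n) ℂ) *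
          (X i * pderiv i h) := fun i => by
        rw [← Finset.mul_sum, sum_X_mul_pderiv_of_mem (pderiv_mem_harmonicPolynomials hh i)]
        ring
      simp only [this, ← Finset.mul_sum, hE]
      simp
      ring
  -- The left side is zero for i = j. The conditional term corrects the off-diagonal expansion
  -- there, and contributes 2k h to the total.
  have hcross : ∀ i j : Fin n, X i * pderiv j (X i * pderiv j h - X j * pderiv i h)
      - X j * pderiv i (X i * pderiv j h - X j * pderiv i h) =
      (if i = j then X i * pderiv i h + X j * pderiv j h else 0)
        + X i * X i * pderiv j (pderiv j h) + X j * X j * pderiv i (pderiv i h)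
        - X i * pderiv i h - X j * pderiv j h
        - 2 * (X i * (X j * pderiv j (pderiv i h))) := by
    intro i j
    rcases eq_or_ne i j with rfl | hij
    · simp
      ring
    · rw [if_neg hij]
      simp only [map_sub, pderiv_mul, pderiv_X_self, pderiv_X_of_ne hij,
        pderiv_X_of_ne (Ne.symm hij), pderiv_pderiv_comm i j]
      ring
  have hconst : ∑ i, ∑ _j : Fin n, X i * pderiv i h =
      (n : MvPolynomial (Fin n) ℂ) * ((k : MvPolynomial (Fin n) ℂ) * h) := by
    rw [Finset.sum_comm]
    simp [hE]
  simp only [hcross, Finset.sum_add_distrib, Finset.sum_sub_distrib, hconst]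
  simp only [Finset.sum_add_distrib, Finset.sum_ite_eq,
    Finset.mem_univ, if_true, ← Finset.mul_sum, ← Finset.sum_mul, hΔ, hE, Finset.sum_const,
    Finset.card_univ, Fintype.card_fin, nsmul_eq_mul]
  simp only [← Finset.mul_sum] at hEE
  simp only [hEE]
  simp [map_ofNat (C : ℂ →+* MvPolynomial (Fin n) ℂ)]
  ring

end HarmonicPolynomials

/-! ### Smoothness, equivariance and derivatives of the functions F_{m,l,k}^h -/

section KFiniteVector
open MvPolynomial
open scoped ContDiff

variable {n : ℕ}

theorem hasDerivAt_eval_line (h : MvPolynomial (Fin n) ℂ) (y η : Fin n → ℝ) :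
    HasDerivAt (fun t : ℝ => eval (fun j => (((y + t • η) j : ℝ) : ℂ)) h)
      (∑ j, (η j : ℂ) * eval (fun j => (y j : ℂ)) (pderiv j h)) 0 := by
  induction h using MvPolynomial.induction_on with
  | C a => simpa using hasDerivAt_const (0 : ℝ) a
  | add p q hp hq =>
    simp only [map_add, mul_add, Finset.sum_add_distrib]
    exact hp.add hq
  | mul_X p i hp =>
    have hi : HasDerivAt (fun t : ℝ => (((y + t • η) i : ℝ) : ℂ)) (η i : ℂ) 0 := by
      have : HasDerivAt (fun t : ℝ => y i + t * η i) (η i) 0 := by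
        simpa using ((hasDerivAt_id (0 : ℝ)).mul_const (η i)).const_add (y i)
      simpa using this.ofReal_comp
    have := hp.mul hi
    simp only [map_mul, eval_X]
    refine this.congr_deriv ?_
    have hX : ∀ j, eval (fun j => (y j : ℂ)) (pderiv j (X i : MvPolynomial (Fin n) ℂ)) =
        if i = j then 1 else 0 := by
      intro j
      rcases eq_or_ne i j with rfl | hij
      · simp
      · simp [hij, pderiv_X_of_ne hij]
    simp only [pderiv_mul, map_add, map_mul, eval_X, hX, mul_add, Finset.sum_add_distrib]
    rw [Finset.sum_mul]
    congr 1
    · refine Finset.sum_congr rfl fun j _ => ?_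
      simp only [zero_smul, add_zero]
      ring
    · simp [mul_comm]

theorem eval_smul_of_isHomogeneous {k : ℕ} {h : MvPolynomial (Fin n) ℂ} (hh : h.IsHomogeneous k)
    (c : ℂ) (x : Fin n → ℂ) : eval (c • x) h = c ^ k * eval x h := by
  rw [eval_eq', eval_eq', Finset.mul_sum]
  refine Finset.sum_congr rfl fun d hd => ?_
  have hdeg : ∑ i, d i = k := by
    rw [hh.degree_eq_sum_deg_support hd]
    refine (Finset.sum_subset (Finset.subset_univ _) fun i _ hi => ?_).symm
    simpa using hi
  simp only [Pi.smul_apply, smul_eq_mul, mul_pow, Finset.prod_mul_distrib]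
  rw [Finset.prod_pow_eq_pow_sum, hdeg]
  ring

theorem contDiff_eval_snd (h : MvPolynomial (Fin n) ℂ) :
    ContDiff ℝ ∞ (fun p : ℝ × (Fin n → ℝ) => eval (fun j => (p.2 j : ℂ)) h) := by
  induction h using MvPolynomial.induction_on with
  | C a => simpa using contDiff_const
  | add p q hp hq => simpa using hp.add hq
  | mul_X p i hp =>
    simp only [map_mul, eval_X]
    refine hp.mul ?_
    have h0 : ContDiff ℝ ∞ (fun x : ℝ => (x : ℂ)) := Complex.ofRealCLM.contDiff
    exact h0.comp (by fun_prop)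

/-- The half-integer `2 l + k + n/2` has positive real part. -/
theorem re_pos_of_one_le (hn : 1 ≤ n) (l k : ℕ) : 0 < (2 * l + k + n / 2 : ℂ).re := by
  have : (2 * l + k + n / 2 : ℂ) = ((2 * l + k + n / 2 : ℝ) : ℂ) := by push_cast; rfl
  rw [this, Complex.ofReal_re]
  have : (1 : ℝ) ≤ n := by exact_mod_cast hn
  positivity

theorem contDiff_normSq_snd :
    ContDiff ℝ ∞ (fun p : ℝ × (Fin n → ℝ) => ((p.2 ⬝ᵥ p.2 : ℝ) : ℂ)) := by
  have h0 : ContDiff ℝ ∞ (fun x : ℝ => (x : ℂ)) := Complex.ofRealCLM.contDiff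
  refine h0.comp ?_
  simp only [dotProduct]
  fun_prop

theorem contDiff_kFiniteVector (hn : 1 ≤ n) (s : ℂ) (m : ℤ) (l k : ℕ)
    (h : MvPolynomial (Fin n) ℂ) : ContDiff ℝ ∞ (kFiniteVector n s m l k h) := by
  have h0 : ContDiff ℝ ∞ (fun x : ℝ => (x : ℂ)) := Complex.ofRealCLM.contDiff
  have hσ := contDiff_normSq_snd (n := n)
  have hθ : ContDiff ℝ ∞ (fun p : ℝ × (Fin n → ℝ) => (p.1 : ℂ)) := h0.comp contDiff_fst
  have hΦ : ContDiff ℝ ∞ (confluentHypergeometric ((m + 4 * l + 2 * k + n) / 4)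
      (2 * l + k + n / 2)) :=
    ((differentiable_confluentHypergeometric _ (re_pos_of_one_le hn l k)).contDiff).restrict_scalars
      ℝ
  unfold kFiniteVector
  exact ((((((contDiff_const.mul hθ).div_const 2).cexp).mul
    ((contDiff_const.mul hσ).cexp)).mul (hσ.pow l)).mul (contDiff_eval_snd h)).mul
    (hΦ.comp (contDiff_const.mul hσ))

theorem exp_add_int_mul_pi (m j : ℤ) (θ : ℝ) :
    Complex.exp (-Complex.I * m * ((θ + j * Real.pi : ℝ) : ℂ) / 2) =
      Complex.I ^ (-j * m) * Complex.exp (-Complex.I * m * θ / 2) := by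
  have hI : Complex.I = Complex.exp (Real.pi / 2 * Complex.I) := by
    rw [Complex.exp_pi_div_two_mul_I]
  conv_rhs => rw [hI]
  rw [← Complex.exp_int_mul, ← Complex.exp_add, ← hI]
  congr 1
  push_cast
  ring

/-- The shift of θ contributes i^{-jm} and the homogeneity of h contributes (-1)^{jk} = i^{2kj}.
Their product is i^{-jq} because i⁴ = 1 and m ≡ 2k + q mod 4. -/
theorem kFiniteVector_mem_compactPicture (hn : 1 ≤ n) {q : ℤ} (s : ℂ) {m : ℤ} (l : ℕ) {k : ℕ}
    {h : MvPolynomial (Fin n) ℂ} (hh : h ∈ harmonicPolynomials n k)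
    (hm : m ≡ 2 * k + q [ZMOD 4]) : kFiniteVector n s m l k h ∈ compactPicture n q s := by
  refine ⟨contDiff_kFiniteVector hn s m l k h, fun j θ y => ?_⟩
  have h2 : (-1 : ℝ) ^ j * (-1 : ℝ) ^ j = 1 := by
    rw [← sq, ← zpow_natCast, ← zpow_mul, mul_comm, zpow_mul]; simp
  have hσ : ((-1 : ℝ) ^ j • y) ⬝ᵥ ((-1 : ℝ) ^ j • y) = y ⬝ᵥ y := by
    rw [smul_dotProduct, dotProduct_smul, smul_smul, h2, one_smul]
  have hev : eval (fun i => ((((-1 : ℝ) ^ j • y) i : ℝ) : ℂ)) h =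
      Complex.I ^ (2 * k * j) * eval (fun i => (y i : ℂ)) h := by
    have e1 : (fun i => ((((-1 : ℝ) ^ j • y) i : ℝ) : ℂ)) =
        (Complex.I ^ (2 * j)) • (fun i => (y i : ℂ)) := by
      funext i
      rw [zpow_mul]
      simp
    rw [e1, eval_smul_of_isHomogeneous (mem_harmonicPolynomials.1 hh).1, ← zpow_natCast, ← zpow_mul]
    congr 2
    ring
  have hI : Complex.I ^ (-j * q) = Complex.I ^ (-j * m) * Complex.I ^ (2 * k * j) := by
    rw [← zpow_add₀ Complex.I_ne_zero]
    obtain ⟨c, hc⟩ := hm.dvd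
    have : -j * q = -j * m + 2 * k * j + 4 * (-j * c) := by linear_combination -j * hc
    rw [this, zpow_add₀ Complex.I_ne_zero _ (4 * (-j * c)), zpow_mul Complex.I 4]
    have : Complex.I ^ (4 : ℤ) = 1 := by
      have := Complex.I_pow_four
      exact_mod_cast this
    rw [this]
    simp
  simp only [kFiniteVector, hσ, hev, hI]
  rw [exp_add_int_mul_pi]
  ring

theorem fderiv_kFiniteVector (hn : 1 ≤ n) (s : ℂ) (m : ℤ) (l k : ℕ)
    (h : MvPolynomial (Fin n) ℂ) (p d : ℝ × (Fin n → ℝ)) :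
    fderiv ℝ (kFiniteVector n s m l k h) p d =
      Complex.exp (-Complex.I * m * p.1 / 2) * Complex.exp (-Complex.I * s * (p.2 ⬝ᵥ p.2 : ℝ)) *
      ((-Complex.I * m / 2 * d.1 - 2 * Complex.I * s * (p.2 ⬝ᵥ d.2 : ℝ)) *
          ((p.2 ⬝ᵥ p.2 : ℝ) : ℂ) ^ l * eval (fun j => (p.2 j : ℂ)) h *
          confluentHypergeometric ((m + 4 * l + 2 * k + n) / 4) (2 * l + k + n / 2)
            (2 * Complex.I * s * (p.2 ⬝ᵥ p.2 : ℝ))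
        + 2 * l * ((p.2 ⬝ᵥ p.2 : ℝ) : ℂ) ^ (l - 1) * (p.2 ⬝ᵥ d.2 : ℝ) *
          eval (fun j => (p.2 j : ℂ)) h *
          confluentHypergeometric ((m + 4 * l + 2 * k + n) / 4) (2 * l + k + n / 2)
            (2 * Complex.I * s * (p.2 ⬝ᵥ p.2 : ℝ))
        + ((p.2 ⬝ᵥ p.2 : ℝ) : ℂ) ^ l *
          (∑ j, (d.2 j : ℂ) * eval (fun j => (p.2 j : ℂ)) (pderiv j h)) *
          confluentHypergeometric ((m + 4 * l + 2 * k + n) / 4) (2 * l + k + n / 2)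
            (2 * Complex.I * s * (p.2 ⬝ᵥ p.2 : ℝ))
        + ((p.2 ⬝ᵥ p.2 : ℝ) : ℂ) ^ l * eval (fun j => (p.2 j : ℂ)) h *
          (4 * Complex.I * s * (p.2 ⬝ᵥ d.2 : ℝ)) *
          (((m + 4 * l + 2 * k + n) / 4 : ℂ) / (2 * l + k + n / 2) *
            confluentHypergeometric ((m + 4 * l + 2 * k + n) / 4 + 1) (2 * l + k + n / 2 + 1)
            (2 * Complex.I * s * (p.2 ⬝ᵥ p.2 : ℝ)))) := by
  apply fderiv_eq_of_hasDerivAt_line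
    ((contDiff_kFiniteVector hn s m l k h).differentiable (by simp) p)
  obtain ⟨θ, y⟩ := p
  obtain ⟨τ, η⟩ := d
  have hθ : HasDerivAt (fun t : ℝ => ((θ + t * τ : ℝ) : ℂ)) (τ : ℂ) 0 := by
    have : HasDerivAt (fun t : ℝ => θ + t * τ) τ 0 := by
      simpa using ((hasDerivAt_id (0 : ℝ)).mul_const τ).const_add θ
    exact this.ofReal_comp
  have hσ : HasDerivAt (fun t : ℝ => (((y + t • η) ⬝ᵥ (y + t • η) : ℝ) : ℂ))
      ((2 * (y ⬝ᵥ η) : ℝ) : ℂ) 0 := by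
    have h1 : HasDerivAt (fun t : ℝ => (y ⬝ᵥ y) + t * (2 * (y ⬝ᵥ η)) + t ^ 2 * (η ⬝ᵥ η))
        (2 * (y ⬝ᵥ η)) 0 := by
      have := (((hasDerivAt_id (0 : ℝ)).mul_const (2 * (y ⬝ᵥ η))).const_add (y ⬝ᵥ y)).add
        (((hasDerivAt_id (0 : ℝ)).pow 2).mul_const (η ⬝ᵥ η))
      refine (this.congr_of_eventuallyEq
        (Filter.Eventually.of_forall fun t => ?_)).congr_deriv ?_
      · simp
      · simp
    refine HasDerivAt.ofReal_comp (h1.congr_of_eventuallyEq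
      (Filter.Eventually.of_forall fun t => ?_))
    simp only [add_dotProduct, dotProduct_add, smul_dotProduct, dotProduct_smul, smul_eq_mul,
      dotProduct_comm η y]
    ring
  have e0 : (y + (0 : ℝ) • η) = y := by simp
  have hΦ : HasDerivAt (fun t : ℝ => confluentHypergeometric ((m + 4 * l + 2 * k + n) / 4)
      (2 * l + k + n / 2) (2 * Complex.I * s * (((y + t • η) ⬝ᵥ (y + t • η) : ℝ) : ℂ))) _ 0 :=
    HasDerivAt.comp (0 : ℝ) (hasDerivAt_confluentHypergeometric _ (re_pos_of_one_le hn l k) _)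
      (hσ.const_mul (2 * Complex.I * s))
  have hfin := (((((hθ.const_mul (-Complex.I * m)).div_const 2).cexp.mul
    (hσ.const_mul (-Complex.I * s)).cexp).mul (hσ.pow l)).mul (hasDerivAt_eval_line h y η)).mul hΦ
  refine (hfin.congr_of_eventuallyEq (Filter.Eventually.of_forall fun t => ?_)).congr_deriv ?_
  · rfl
  · simp only [e0, zero_mul, add_zero, Pi.mul_apply, Pi.pow_apply]
    push_cast
    ring

end KFiniteVector

/-! ### The action of 𝔰𝔩(2), 𝔰𝔬(n) and the centre on F_{m,l,k}^h -/

section Action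
open MvPolynomial
open scoped ContDiff

variable {n : ℕ}

/-- The element `(a b; c -a)` of `𝔰𝔩(2, ℝ)`, as an element of `𝔤`. -/
def slElement (n : ℕ) (a b c : ℝ) : JacobiAlgebra n :=
  ⟨0, (⟨!![a, b; c, -a], by
    change Matrix.trace !![a, b; c, -a] = 0
    simp [Matrix.trace_fin_two]⟩, 0)⟩

/-- An element of `𝔰𝔬(n)`, as an element of `𝔤`. -/
def soElement (A : LieAlgebra.Orthogonal.so (Fin n) ℝ) : JacobiAlgebra n := ⟨0, (0, A)⟩

/-- An element of the Heisenberg algebra, as an element of `𝔤`. -/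
def heisenbergElement (x : HeisenbergAlgebra n) : JacobiAlgebra n := ⟨x, 0⟩

/-- The operator by which an element of `𝔤` acts. -/
noncomputable def lieOp {q : ℤ} {s : ℂ} (Z : JacobiAlgebra n) :
    compactPicture n q s →ₗ[ℂ] compactPicture n q s where
  toFun F := ⁅Z, F⁆
  map_add' F G := lie_add Z F G
  map_smul' c F := lie_smul_compactPicture Z c F

theorem lieOp_apply_coe {q : ℤ} {s : ℂ} (Z : JacobiAlgebra n) (F : compactPicture n q s)
    (p : ℝ × (Fin n → ℝ)) : (lieOp Z F).1 p =
      fderiv ℝ F.1 p (actionField Z p) + actionMultiplier s Z p * F.1 p := rfl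

/-- The operators `X_ε = ρ(1 0; 0 -1) + i ε ρ(0 1; 1 0)`. -/
noncomputable def slOp {q : ℤ} {s : ℂ} (ε : ℤ) :
    compactPicture n q s →ₗ[ℂ] compactPicture n q s :=
  lieOp (slElement n 1 0 0) + (Complex.I * ε) • lieOp (slElement n 0 1 1)

/-- The operators `e^{-iεθ} (∂_j + 2 i s ε y_j)` in the complexified Heisenberg algebra. -/
noncomputable def ladderOp {q : ℤ} {s : ℂ} (ε : ℤ) (j : Fin n) :
    compactPicture n q s →ₗ[ℂ] compactPicture n q s :=
  -(lieOp (heisenbergElement (.mk (Pi.single j 1) 0 0)) +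
    (Complex.I * ε) • lieOp (heisenbergElement (.mk 0 (Pi.single j 1) 0)))

theorem exp_neg_I_mul_shift (m ε : ℤ) (θ : ℝ) :
    Complex.exp (-Complex.I * ((m + 2 * ε : ℤ) : ℂ) * θ / 2) =
      Complex.exp (-Complex.I * m * θ / 2) *
        Complex.exp (-Complex.I * ε * θ) := by
  rw [← Complex.exp_add]
  congr 1
  push_cast
  ring

theorem exp_neg_I_mul {ε : ℤ} (hε : ε = 1 ∨ ε = -1) (θ : ℝ) :
    Complex.exp (-Complex.I * ε * θ) = Real.cos θ - Complex.I * ε * Real.sin θ := by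
  have : -Complex.I * ε * θ = ((-ε * θ : ℝ) : ℂ) * Complex.I := by push_cast; ring
  rw [this, Complex.exp_mul_I, ← Complex.ofReal_cos, ← Complex.ofReal_sin]
  rcases hε with rfl | rfl
  · simp
    ring
  · simp
    ring

theorem kFiniteVector_eq (s : ℂ) {m : ℤ} {l k : ℕ} (h : MvPolynomial (Fin n) ℂ) {a b : ℂ}
    (ha : ((m + 4 * l + 2 * k + n) / 4 : ℂ) = a) (hb : (2 * l + k + n / 2 : ℂ) = b)
    (p : ℝ × (Fin n → ℝ)) : kFiniteVector n s m l k h p =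
      Complex.exp (-Complex.I * m * p.1 / 2) * Complex.exp (-Complex.I * s * (p.2 ⬝ᵥ p.2 : ℝ)) *
        ((p.2 ⬝ᵥ p.2 : ℝ) : ℂ) ^ l * eval (fun j => (p.2 j : ℂ)) h *
        confluentHypergeometric a b (2 * Complex.I * s * (p.2 ⬝ᵥ p.2 : ℝ)) := by
  rw [← ha, ← hb]
  rfl

theorem sum_eval_mul_pderiv {k : ℕ} {h : MvPolynomial (Fin n) ℂ}
    (hh : h ∈ harmonicPolynomials n k) (x : Fin n → ℂ) :
    ∑ j, x j * eval x (pderiv j h) = k * eval x h := by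
  have := congrArg (eval x) (sum_X_mul_pderiv_of_mem hh)
  simpa using this

theorem eval_normSqPoly (y : Fin n → ℝ) :
    eval (fun j => (y j : ℂ)) (normSqPoly n) = ((y ⬝ᵥ y : ℝ) : ℂ) := by
  simp [normSqPoly, dotProduct]

/-- With a = (m + β)/4 and b = β/2, where β = 4l + 2k + n, the operator brings out e^{-2iεθ} and
changes the first parameter a by ε while b stays fixed. The identity is then a contiguous relation
in a. -/
theorem slOp_kFiniteVector (hn : 1 ≤ n) {q : ℤ} {s : ℂ} {ε : ℤ} (hε : ε = 1 ∨ ε = -1) {m : ℤ}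
    {l k : ℕ} {h : MvPolynomial (Fin n) ℂ} (hh : h ∈ harmonicPolynomials n k)
    {F : compactPicture n q s} (hF : F.1 = kFiniteVector n s m l k h) (p : ℝ × (Fin n → ℝ)) :
    (slOp ε F).1 p =
      -((4 * l + 2 * k + n : ℂ) + ε * m) / 2 * kFiniteVector n s (m + 4 * ε) l k h p := by
  obtain ⟨θ, y⟩ := p
  have hb := re_pos_of_one_le hn l k
  have e1 : (slOp ε F).1 (θ, y) = (lieOp (slElement n 1 0 0) F).1 (θ, y)
      + Complex.I * ε * (lieOp (slElement n 0 1 1) F).1 (θ, y) := rfl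
  have hexp : Complex.exp (-Complex.I * ((m + 4 * ε : ℤ) : ℂ) * θ / 2) =
      Complex.exp (-Complex.I * m * θ / 2) *
        (Real.cos (2 * θ) - Complex.I * ε * Real.sin (2 * θ)) := by
    rw [← exp_neg_I_mul hε, ← Complex.exp_add]
    congr 1
    push_cast
    ring
  have hE : ∀ c : ℝ, ∑ j, (((c • y) j : ℝ) : ℂ) * eval (fun j => (y j : ℂ)) (pderiv j h) =
      c * (k * eval (fun j => (y j : ℂ)) h) := by
    intro c
    rw [← sum_eval_mul_pderiv hh, Finset.mul_sum]
    refine Finset.sum_congr rfl fun j _ => ?_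
    simp only [Pi.smul_apply, smul_eq_mul]
    push_cast
    ring
  have f1 : actionField (slElement n 1 0 0) (θ, y) =
      (-Real.sin (2 * θ), (-Real.cos (2 * θ)) • y) := by
    simp [actionField, slElement, slTime, slEuler]
  have f2 : actionField (slElement n 0 1 1) (θ, y) =
      (-Real.cos (2 * θ), Real.sin (2 * θ) • y) := by
    simp [actionField, slElement, slTime, slEuler, Real.cos_two_mul']
    ring
  have g1 : actionMultiplier s (slElement n 1 0 0) (θ, y) =
      -(n / 2) * Real.cos (2 * θ) - 2 * s * Real.sin (2 * θ) * (y ⬝ᵥ y : ℝ) := by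
    simp [actionMultiplier, actionPotential, slElement, slPotential, slEuler]
    ring
  have g2 : actionMultiplier s (slElement n 0 1 1) (θ, y) =
      n / 2 * Real.sin (2 * θ) - 2 * s * Real.cos (2 * θ) * (y ⬝ᵥ y : ℝ) := by
    simp [actionMultiplier, actionPotential, slElement, slPotential, slEuler]
    ring
  rw [e1, lieOp_apply_coe, lieOp_apply_coe, f1, f2, g1, g2, hF, fderiv_kFiniteVector hn,
    fderiv_kFiniteVector hn, hE, hE]
  simp only [dotProduct_smul, smul_eq_mul]
  set a : ℂ := (m + 4 * l + 2 * k + n) / 4 with ha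
  set b : ℂ := 2 * l + k + n / 2 with hbdef
  have hb0 : b ≠ 0 := by simpa using add_natCast_ne_zero_of_re_pos hb 0
  -- The truncated exponent at l = 0 is harmless because of the factor l.
  have hpow : (l : ℂ) * ((y ⬝ᵥ y : ℝ) : ℂ) ^ (l - 1) * ((y ⬝ᵥ y : ℝ) : ℂ) =
      l * ((y ⬝ᵥ y : ℝ) : ℂ) ^ l := by
    cases l with
    | zero => simp
    | succ l => rw [add_tsub_cancel_right, pow_succ]; ring
  rw [kFiniteVector_eq s h ha.symm hbdef.symm (θ, y)]
  have hI := Complex.I_sq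
  have hna : (4 * l + 2 * k + n : ℂ) = 2 * b := by rw [hbdef]; ring
  have hma : (m : ℂ) = 4 * a - 2 * b := by rw [hbdef, ha]; ring
  have hnb : (n : ℂ) = 2 * b - 4 * l - 2 * k := by rw [hbdef]; ring
  set φ := confluentHypergeometric a b (2 * Complex.I * s * (y ⬝ᵥ y : ℝ)) with hφ
  set ψ := confluentHypergeometric (a + 1) (b + 1) (2 * Complex.I * s * (y ⬝ᵥ y : ℝ)) with hψ
  rcases hε with rfl | rfl
  · rw [kFiniteVector_eq s h (a := a + 1) (b := b) (by rw [ha]; push_cast; ring) hbdef.symm (θ, y)]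
    simp only [hexp]
    rw [hna]
    have R1 := confluentHypergeometric_add_one_left a hb (2 * Complex.I * s * (y ⬝ᵥ y : ℝ))
    rw [R1, ← hφ, ← hψ]
    push_cast
    simp only [hma, hnb]
    generalize Complex.exp (-Complex.I * (4 * a - 2 * b) * θ / 2) = X
    generalize Complex.exp (-Complex.I * s * ((y ⬝ᵥ y : ℝ) : ℂ)) = G
    generalize Complex.cos (2 * θ) = c
    generalize Complex.sin (2 * θ) = d
    generalize eval (fun j => (y j : ℂ)) h = H
    linear_combination 2 * X * G * H * φ * (-c + Complex.I * d) * hpow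
      + X * G * ((y ⬝ᵥ y : ℝ) : ℂ) ^ l * H * φ *
        ((2 * a - b) * c - 2 * s * d * (y ⬝ᵥ y : ℝ)) * hI
  · rw [kFiniteVector_eq s h (a := a - 1) (b := b) (by rw [ha]; push_cast; ring) hbdef.symm (θ, y)]
    simp only [hexp]
    rw [hna]
    have R1 := confluentHypergeometric_add_one_left (a - 1) hb (2 * Complex.I * s * (y ⬝ᵥ y : ℝ))
    have R3 := confluentHypergeometric_sub a hb (2 * Complex.I * s * (y ⬝ᵥ y : ℝ))
    rw [sub_add_cancel, ← hφ] at R1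
    rw [← hφ, ← hψ] at R3
    -- The contiguous relation (b - a) ₁F₁(a-1, b) = (b - a) ₁F₁ + z(₁F₁' - ₁F₁), with unmarked
    -- functions at (a, b), obtained by eliminating ₁F₁(a, b+1) between `R1` and `R3`.
    have hX : (b - a) * confluentHypergeometric (a - 1) b (2 * Complex.I * s * (y ⬝ᵥ y : ℝ)) =
        (b - a) * φ + 2 * Complex.I * s * (y ⬝ᵥ y : ℝ) * (a / b * ψ - φ) := by
      have : 2 * Complex.I * s * ((y ⬝ᵥ y : ℝ) : ℂ) * (a / b * ψ - φ) =
          2 * Complex.I * s * ((y ⬝ᵥ y : ℝ) : ℂ) / b * (a * ψ - b * φ) := by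
        field_simp
      rw [this, R3]
      linear_combination -(b - a) * R1
    push_cast
    simp only [hma, hnb]
    generalize Complex.exp (-Complex.I * (4 * a - 2 * b) * θ / 2) = X
    generalize Complex.exp (-Complex.I * s * ((y ⬝ᵥ y : ℝ) : ℂ)) = G
    generalize Complex.cos (2 * θ) = c
    generalize Complex.sin (2 * θ) = d
    generalize eval (fun j => (y j : ℂ)) h = H
    linear_combination 2 * X * G * H * φ * (-c - Complex.I * d) * hpow
      + X * G * ((y ⬝ᵥ y : ℝ) : ℂ) ^ l * H * φ *
        (-(2 * a - b) * c - 2 * s * d * (y ⬝ᵥ y : ℝ)) * hI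
      + 2 * (c + Complex.I * d) * X * G * ((y ⬝ᵥ y : ℝ) : ℂ) ^ l * H * hX

theorem lieOp_compact_kFiniteVector (hn : 1 ≤ n) {q : ℤ} {s : ℂ} {m : ℤ}
    {l k : ℕ} {h : MvPolynomial (Fin n) ℂ}
    {F : compactPicture n q s} (hF : F.1 = kFiniteVector n s m l k h) (p : ℝ × (Fin n → ℝ)) :
    (lieOp (slElement n 0 1 (-1)) F).1 p = Complex.I * m / 2 * kFiniteVector n s m l k h p := by
  obtain ⟨θ, y⟩ := p
  have f1 : actionField (slElement n 0 1 (-1)) (θ, y) = (-1, 0) := by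
    simp [actionField, slElement, slTime, slEuler]
    linarith [Real.sin_sq_add_cos_sq θ]
  have g1 : actionMultiplier s (slElement n 0 1 (-1)) (θ, y) = 0 := by
    simp [actionMultiplier, actionPotential, slElement, slPotential, slEuler]
  rw [lieOp_apply_coe, f1, g1, hF, fderiv_kFiniteVector hn]
  simp only [kFiniteVector]
  simp
  ring

theorem so_transpose (A : LieAlgebra.Orthogonal.so (Fin n) ℝ) : A.1ᵀ = -A.1 :=
  (LieAlgebra.Orthogonal.mem_so (Fin n) ℝ A.1).1 A.2

theorem dotProduct_so_mulVec_self (A : LieAlgebra.Orthogonal.so (Fin n) ℝ) (y : Fin n → ℝ) :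
    y ⬝ᵥ A.1 *ᵥ y = 0 := by
  have := so_dotProduct A y y
  rw [dotProduct_comm] at this
  linarith

theorem lieOp_soElement_kFiniteVector (hn : 1 ≤ n) {q : ℤ} {s : ℂ} {m : ℤ}
    {l k : ℕ} {h : MvPolynomial (Fin n) ℂ} (A : LieAlgebra.Orthogonal.so (Fin n) ℝ)
    {F : compactPicture n q s} (hF : F.1 = kFiniteVector n s m l k h) (p : ℝ × (Fin n → ℝ)) :
    (lieOp (soElement A) F).1 p = kFiniteVector n s m l k (rotationDerivation A.1 h) p := by
  obtain ⟨θ, y⟩ := p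
  have f1 : actionField (soElement A) (θ, y) = (0, -(A.1 *ᵥ y)) := by
    simp [actionField, soElement, slTime, slEuler]
  have g1 : actionMultiplier s (soElement A) (θ, y) = 0 := by
    simp [actionMultiplier, actionPotential, soElement, slPotential, slEuler]
  have hev : ∑ j, (((-(A.1 *ᵥ y)) j : ℝ) : ℂ) * eval (fun j => (y j : ℂ)) (pderiv j h) =
      eval (fun j => (y j : ℂ)) (rotationDerivation A.1 h) := by
    simp only [rotationDerivation, map_neg, map_sum, map_mul, eval_C, eval_X, Pi.neg_apply,
      Matrix.mulVec, dotProduct]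
    rw [← Finset.sum_neg_distrib]
    refine Finset.sum_congr rfl fun i _ => ?_
    push_cast
    rw [neg_mul, Finset.sum_mul]
    congr 1
    refine Finset.sum_congr rfl fun j _ => ?_
    ring
  rw [lieOp_apply_coe, f1, g1, hF, fderiv_kFiniteVector hn, hev]
  simp only [kFiniteVector, dotProduct_neg, dotProduct_so_mulVec_self]
  simp
  ring

theorem lieOp_central {q : ℤ} {s : ℂ} (w : ℝ) (F : compactPicture n q s) :
    lieOp (heisenbergElement (.mk 0 0 w)) F = (s * w) • F := by
  apply Subtype.ext
  funext p
  have f1 : actionField (heisenbergElement (.mk 0 0 w)) p = (0 : ℝ × (Fin n → ℝ)) := by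
    simp [actionField, heisenbergElement, slTime, slEuler]
  have g1 : actionMultiplier s (heisenbergElement (n := n) (.mk 0 0 w)) p = s * w := by
    simp [actionMultiplier, actionPotential, heisenbergElement, slPotential, slEuler]
  rw [lieOp_apply_coe, f1, g1]
  simp

/-- The algebra behind the four-term formula: σ stands for ‖y‖², H, D, P for the values of h, ∂_j h
and the harmonic part of y_j h, κ = 2k + n - 2 and B = b - 1. The functions φ, ψ, χ are ₁F₁ with
second parameters b, b + 1, b - 1. The alternatives in the hypotheses cover vanishing denominators,
where D = 0 and division by zero does no harm. -/
theorem ladder_identity (l : ℕ) {κ B σ t r φ ψ χ y H D P : ℂ} (hB : 2 * B = 4 * l + κ)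
    (hP : y * H = P + 1 / κ * (σ * D)) (hκ : κ ≠ 0 ∨ D = 0)
    (hχ : B ≠ 0 ∧ B * φ + t * σ * r * ψ = B * χ ∨ l = 0 ∧ D = 0) :
    2 * l * σ ^ (l - 1) * y * H * φ + σ ^ l * D * φ + σ ^ l * H * (2 * t * y) * (r * ψ) =
      (2 * l + κ) / κ * (σ ^ l * D * χ) + 1 / κ * (2 * l / B) * (t * r) * (σ ^ (l + 1) * D * ψ)
      + 2 * l * (σ ^ (l - 1) * P * χ) + (2 - 2 * l / B) * (t * r) * (σ ^ l * P * ψ) := by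
  have e : 2 * l * σ ^ (l - 1) * y * H * φ + σ ^ l * D * φ + σ ^ l * H * (2 * t * y) * (r * ψ) =
      2 * l * σ ^ (l - 1) * (P + 1 / κ * (σ * D)) * φ + σ ^ l * D * φ
        + σ ^ l * (2 * t) * (P + 1 / κ * (σ * D)) * (r * ψ) := by
    rw [← hP]
    ring
  rw [e]
  rcases hχ with ⟨hB0, hχ⟩ | ⟨rfl, rfl⟩
  · have hχ' : χ = φ + t * σ * r * ψ / B := by
      field_simp
      linear_combination -hχ
    have hκB : κ = 2 * B - 4 * l := by linear_combination -hB
    rw [hχ']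
    rcases hκ with hκ | rfl
    · cases l with
      | zero =>
        simp only [Nat.cast_zero, mul_zero, zero_mul, zero_add, sub_zero, add_zero, zero_div] at *
        subst hκB
        field_simp
        ring
      | succ l =>
        rw [add_tsub_cancel_right]
        have hl : (l + 1 : ℕ) = (2 * B - κ) / 4 := by linear_combination -hB / 4
        rw [hl]
        field_simp
        ring
    · cases l with
      | zero => simp; ring
      | succ l =>
        rw [add_tsub_cancel_right]
        field_simp
        ring
  · simp
    ring

end Action

/-! ### The four-term formula for the Heisenberg operators -/

section Ladder
open MvPolynomial

variable {n : ℕ}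

theorem ladderOp_apply_coe {q : ℤ} {s : ℂ} {ε : ℤ} (hε : ε = 1 ∨ ε = -1) (j : Fin n)
    (F : compactPicture n q s) (p : ℝ × (Fin n → ℝ)) :
    (ladderOp ε j F).1 p = Complex.exp (-Complex.I * ε * p.1) *
      (fderiv ℝ F.1 p (0, Pi.single j 1) + 2 * Complex.I * s * ε * p.2 j * F.1 p) := by
  obtain ⟨θ, y⟩ := p
  have e1 : (ladderOp ε j F).1 (θ, y) =
      -((lieOp (heisenbergElement (.mk (Pi.single j 1) 0 0)) F).1 (θ, y)
      + Complex.I * ε * (lieOp (heisenbergElement (.mk 0 (Pi.single j 1) 0)) F).1 (θ, y)) := rfl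
  have f1 : actionField (heisenbergElement (.mk (Pi.single j 1) 0 0)) (θ, y) =
      (-Real.cos θ) • ((0 : ℝ), (Pi.single j 1 : Fin n → ℝ)) := by
    simp [actionField, heisenbergElement, slTime, slEuler]
  have f2 : actionField (heisenbergElement (.mk 0 (Pi.single j 1) 0)) (θ, y) =
      (Real.sin θ) • ((0 : ℝ), (Pi.single j 1 : Fin n → ℝ)) := by
    simp [actionField, heisenbergElement, slTime, slEuler]
  have g1 : actionMultiplier s (heisenbergElement (.mk (Pi.single j 1) 0 0)) (θ, y) =
      -2 * s * Real.sin θ * y j := by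
    simp [actionMultiplier, actionPotential, heisenbergElement, slPotential, slEuler]
    ring
  have g2 : actionMultiplier s (heisenbergElement (.mk 0 (Pi.single j 1) 0)) (θ, y) =
      -2 * s * Real.cos θ * y j := by
    simp [actionMultiplier, actionPotential, heisenbergElement, slPotential, slEuler]
    ring
  rw [e1, lieOp_apply_coe, lieOp_apply_coe, f1, f2, g1, g2, map_smul, map_smul,
    exp_neg_I_mul hε, Complex.real_smul, Complex.real_smul]
  have hε2 : (ε : ℂ) ^ 2 = 1 := by rcases hε with rfl | rfl <;> simp
  push_cast
  linear_combination
    -2 * s * Complex.sin θ * (y j : ℂ) * F.1 (θ, y) * (-(ε : ℂ) ^ 2 * Complex.I_sq + hε2)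

/-- Two decompositions are combined: y_j h splits into its harmonic part and a multiple of ‖y‖² ∂_j
h, and ₁F₁(a, b) is rewritten through functions with second parameter b + 1 or b - 1, as the
neighbouring (l, k) demand. -/
theorem ladderOp_kFiniteVector (hn : 1 ≤ n) {q : ℤ} {s : ℂ} {ε : ℤ} (hε : ε = 1 ∨ ε = -1) {m : ℤ}
    {l k : ℕ} {h : MvPolynomial (Fin n) ℂ} (hh : h ∈ harmonicPolynomials n k) (j : Fin n)
    {F : compactPicture n q s} (hF : F.1 = kFiniteVector n s m l k h) (p : ℝ × (Fin n → ℝ)) :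
    (ladderOp ε j F).1 p =
      (2 * l + (2 * k + n - 2)) / (2 * k + n - 2) *
        kFiniteVector n s (m + 2 * ε) l (k - 1) (pderiv j h) p
      + 1 / (2 * k + n - 2) * (2 * l / (2 * l + k + n / 2 - 1)) *
        (2 * Complex.I * s * (ε * ((4 * l + 2 * k + n) + ε * m) / (2 * (4 * l + 2 * k + n)))) *
        kFiniteVector n s (m + 2 * ε) (l + 1) (k - 1) (pderiv j h) p
      + 2 * l * kFiniteVector n s (m + 2 * ε) (l - 1) (k + 1) (harmonicMul k j h) p
      + (2 - 2 * l / (2 * l + k + n / 2 - 1)) *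
        (2 * Complex.I * s * (ε * ((4 * l + 2 * k + n) + ε * m) / (2 * (4 * l + 2 * k + n)))) *
        kFiniteVector n s (m + 2 * ε) l (k + 1) (harmonicMul k j h) p := by
  obtain ⟨θ, y⟩ := p
  have hb := re_pos_of_one_le hn l k
  have hsum : ∑ i, (((Pi.single j 1 : Fin n → ℝ) i : ℝ) : ℂ) *
      eval (fun j => (y j : ℂ)) (pderiv i h) = eval (fun j => (y j : ℂ)) (pderiv j h) := by
    rw [Finset.sum_eq_single j] <;> simp +contextual
  rw [ladderOp_apply_coe hε, hF, fderiv_kFiniteVector hn, hsum]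
  simp only [dotProduct_single, mul_one, Complex.ofReal_zero, mul_zero, zero_sub]
  set a : ℂ := (m + 4 * l + 2 * k + n) / 4 with ha
  set b : ℂ := 2 * l + k + n / 2 with hbdef
  set κ : ℂ := 2 * k + n - 2 with hκ
  have hb0 : b ≠ 0 := by simpa using add_natCast_ne_zero_of_re_pos hb 0
  set z : ℂ := 2 * Complex.I * s * (y ⬝ᵥ y : ℝ) with hz
  set φ := confluentHypergeometric a b z with hφ
  -- Differentiating e^{-isρ²} cancels 2isε y_j for ε = 1 and doubles it for ε = -1. With α = a or a
  -- - 1 respectively, the same `r`, `ψ` and `χ` serve both signs.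
  set α : ℂ := a + (ε - 1) / 2 with hα
  have h4 : (4 * l + 2 * k + n : ℂ) = 2 * b := by rw [hbdef]; ring
  have hm : (m : ℂ) = 4 * a - 2 * b := by rw [hbdef, ha]; ring
  set r : ℂ := ε * ((4 * l + 2 * k + n) + ε * m) / (2 * (4 * l + 2 * k + n)) with hr
  set ψ := confluentHypergeometric (α + 1) (b + 1) z with hψ
  set χ := confluentHypergeometric α (b - 1) z with hχ
  have hrψ : a / b * confluentHypergeometric (a + 1) (b + 1) z - (1 - ε) / 2 * φ = r * ψ := by
    rw [hr, h4, hm, hψ, hα]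
    rcases hε with rfl | rfl
    · simp
      field_simp
      ring_nf
      simp
    · have R3 := confluentHypergeometric_sub a hb z
      rw [← hφ] at R3
      simp
      ring_nf at R3 ⊢
      field_simp
      linear_combination R3
  -- For both signs this comes from the two contiguous relations at (α, b) and (α, b - 1); the
  -- latter needs b - 1 to have positive real part.
  have hχφ : 0 < (b - 1).re → (b - 1) * φ + 2 * Complex.I * s * ((y ⬝ᵥ y : ℝ) : ℂ) * r * ψ =
      (b - 1) * χ := by
    intro hb1
    rw [← hz]
    have R1 := confluentHypergeometric_add_one_left α hb z
    have R3 := confluentHypergeometric_sub α hb1 z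
    rw [sub_add_cancel] at R3
    rw [← hψ] at R1
    rw [← hχ] at R3
    rcases hε with rfl | rfl
    · have hαa : α = a := by rw [hα]; simp
      have hra : r = a / b := by
        rw [hr, h4, hm]
        push_cast
        field_simp
        ring
      rw [hαa] at R1 R3
      rw [← hφ] at R1 R3
      rw [hra]
      linear_combination R3 - a * R1
    · have hαa : α = a - 1 := by rw [hα]; push_cast; ring
      have hra : r = (a - b) / b := by
        rw [hr, h4, hm]
        push_cast
        field_simp
        ring
      rw [hαa] at R1 R3
      rw [sub_add_cancel] at R1 R3
      rw [← hφ] at R1 R3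
      rw [hra]
      linear_combination R3 - (a - b) * R1
  have t1 : kFiniteVector n s (m + 2 * ε) l (k - 1) (pderiv j h) (θ, y) =
      Complex.exp (-Complex.I * m * θ / 2) * Complex.exp (-Complex.I * ε * θ) *
        Complex.exp (-Complex.I * s * (y ⬝ᵥ y : ℝ)) * (((y ⬝ᵥ y : ℝ) : ℂ) ^ l *
        eval (fun j => (y j : ℂ)) (pderiv j h) * χ) := by
    cases k with
    | zero =>
      rw [pderiv_eq_zero_of_mem_harmonicPolynomials_zero hh]
      simp [kFiniteVector]
    | succ k =>
      rw [kFiniteVector_eq s _ (a := α) (b := b - 1)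
        (by rw [hα, ha, add_tsub_cancel_right]; push_cast; ring)
        (by rw [hbdef, add_tsub_cancel_right]; push_cast; ring), exp_neg_I_mul_shift]
      ring
  have t2 : kFiniteVector n s (m + 2 * ε) (l + 1) (k - 1) (pderiv j h) (θ, y) =
      Complex.exp (-Complex.I * m * θ / 2) * Complex.exp (-Complex.I * ε * θ) *
        Complex.exp (-Complex.I * s * (y ⬝ᵥ y : ℝ)) * (((y ⬝ᵥ y : ℝ) : ℂ) ^ (l + 1) *
        eval (fun j => (y j : ℂ)) (pderiv j h) * ψ) := by
    cases k with
    | zero =>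
      rw [pderiv_eq_zero_of_mem_harmonicPolynomials_zero hh]
      simp [kFiniteVector]
    | succ k =>
      rw [kFiniteVector_eq s _ (a := α + 1) (b := b + 1)
        (by rw [hα, ha, add_tsub_cancel_right]; push_cast; ring)
        (by rw [hbdef, add_tsub_cancel_right]; push_cast; ring), exp_neg_I_mul_shift]
      ring
  have t3 : 2 * l * kFiniteVector n s (m + 2 * ε) (l - 1) (k + 1) (harmonicMul k j h) (θ, y) =
      Complex.exp (-Complex.I * m * θ / 2) * Complex.exp (-Complex.I * ε * θ) *
        Complex.exp (-Complex.I * s * (y ⬝ᵥ y : ℝ)) * (2 * l * (((y ⬝ᵥ y : ℝ) : ℂ) ^ (l - 1) *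
        eval (fun j => (y j : ℂ)) (harmonicMul k j h) * χ)) := by
    cases l with
    | zero => simp
    | succ l =>
      rw [kFiniteVector_eq s _ (a := α) (b := b - 1)
        (by rw [hα, ha, add_tsub_cancel_right]; push_cast; ring)
        (by rw [hbdef, add_tsub_cancel_right]; push_cast; ring), exp_neg_I_mul_shift]
      ring
  have t4 : kFiniteVector n s (m + 2 * ε) l (k + 1) (harmonicMul k j h) (θ, y) =
      Complex.exp (-Complex.I * m * θ / 2) * Complex.exp (-Complex.I * ε * θ) *
        Complex.exp (-Complex.I * s * (y ⬝ᵥ y : ℝ)) * (((y ⬝ᵥ y : ℝ) : ℂ) ^ l *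
        eval (fun j => (y j : ℂ)) (harmonicMul k j h) * ψ) := by
    rw [kFiniteVector_eq s _ (a := α + 1) (b := b + 1)
      (by rw [hα, ha]; push_cast; ring)
      (by rw [hbdef]; push_cast; ring), exp_neg_I_mul_shift]
    ring
  have hP : (y j : ℂ) * eval (fun j => (y j : ℂ)) h =
      eval (fun j => (y j : ℂ)) (harmonicMul k j h) + 1 / κ * (((y ⬝ᵥ y : ℝ) : ℂ) *
        eval (fun j => (y j : ℂ)) (pderiv j h)) := by
    simp only [harmonicMul, map_sub, map_mul, eval_X, eval_C, eval_normSqPoly]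
    ring
  have hD : k = 0 → eval (fun j => (y j : ℂ)) (pderiv j h) = 0 := by
    rintro rfl
    rw [pderiv_eq_zero_of_mem_harmonicPolynomials_zero hh, map_zero]
  have key := ladder_identity l (κ := κ) (B := b - 1) (σ := ((y ⬝ᵥ y : ℝ) : ℂ))
    (t := 2 * Complex.I * s) (r := r) (φ := φ) (ψ := ψ) (χ := χ)
    (by rw [hbdef, hκ]; ring) hP
    (by
      rcases Nat.eq_zero_or_pos k with hk | hk
      · exact Or.inr (hD hk)
      · left
        obtain ⟨k, rfl⟩ := Nat.exists_eq_succ_of_ne_zero hk.ne'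
        exact two_mul_add_sub_two_ne_zero hn k)
    (by
      by_cases h0 : l = 0 ∧ k = 0
      · exact Or.inr ⟨h0.1, hD h0.2⟩
      · left
        -- Here b - 1 = 2l + k - 1 + n/2 is positive as soon as 2l + k ≥ 1. In the excluded case l =
        -- k = 0 it vanishes for n = 2.
        have hb1 : 0 < (b - 1).re := by
          have e : b - 1 = ((2 * l + k + n / 2 - 1 : ℝ) : ℂ) := by rw [hbdef]; push_cast; ring
          rw [e, Complex.ofReal_re]
          have h1 : (1 : ℝ) ≤ n := by exact_mod_cast hn
          have h2 : (1 : ℝ) ≤ 2 * l + k := by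
            have : 1 ≤ 2 * l + k := by omega
            exact_mod_cast this
          linarith
        exact ⟨by simpa using add_natCast_ne_zero_of_re_pos hb1 0, hχφ hb1⟩)
  rw [t1, t2, t3, t4]
  have hFp : kFiniteVector n s m l k h (θ, y) =
      Complex.exp (-Complex.I * m * θ / 2) * Complex.exp (-Complex.I * s * (y ⬝ᵥ y : ℝ)) *
        ((y ⬝ᵥ y : ℝ) : ℂ) ^ l * eval (fun j => (y j : ℂ)) h * φ := rfl
  rw [hFp]
  generalize Complex.exp (-Complex.I * m * θ / 2) = X at *
  generalize Complex.exp (-Complex.I * ε * θ) = Y at *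
  generalize Complex.exp (-Complex.I * s * ((y ⬝ᵥ y : ℝ) : ℂ)) = G at *
  linear_combination X * Y * G * key + X * Y * G * ((y ⬝ᵥ y : ℝ) : ℂ) ^ l *
    eval (fun j => (y j : ℂ)) h * (4 * Complex.I * s * y j) * hrψ

end Ladder

/-! ### The functions as module elements, and the zeros of the coefficients -/

section Vectors
open MvPolynomial

variable {n : ℕ} {q : ℤ} {s : ℂ}

open Classical in
/-- The function `F_{m,l,k}^h` as an element of the compact picture, or `0` if it is not one. -/
noncomputable def kVec (n : ℕ) (q : ℤ) (s : ℂ) (m : ℤ) (l k : ℕ) (h : MvPolynomial (Fin n) ℂ) :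
    compactPicture n q s :=
  if H : kFiniteVector n s m l k h ∈ compactPicture n q s then ⟨_, H⟩ else 0

theorem coe_kVec (hn : 1 ≤ n) {m : ℤ} {l k : ℕ} {h : MvPolynomial (Fin n) ℂ}
    (hm : m ≡ 2 * k + q [ZMOD 4]) (hh : h ∈ harmonicPolynomials n k) :
    (kVec n q s m l k h).1 = kFiniteVector n s m l k h := by
  rw [kVec, dif_pos (kFiniteVector_mem_compactPicture hn s l hh hm)]

theorem kVec_smul (hn : 1 ≤ n) {m : ℤ} {l k : ℕ} {h : MvPolynomial (Fin n) ℂ}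
    (hm : m ≡ 2 * k + q [ZMOD 4]) (hh : h ∈ harmonicPolynomials n k) (c : ℂ) :
    kVec n q s m l k (c • h) = c • kVec n q s m l k h := by
  apply Subtype.ext
  funext p
  have e : (c • kVec n q s m l k h).1 p = c * (kVec n q s m l k h).1 p := rfl
  rw [e, coe_kVec hn hm hh, coe_kVec hn hm (Submodule.smul_mem _ c hh)]
  simp only [kFiniteVector, smul_eval]
  ring

theorem kVec_add (hn : 1 ≤ n) {m : ℤ} {l k : ℕ} {h h' : MvPolynomial (Fin n) ℂ}
    (hm : m ≡ 2 * k + q [ZMOD 4]) (hh : h ∈ harmonicPolynomials n k)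
    (hh' : h' ∈ harmonicPolynomials n k) :
    kVec n q s m l k (h + h') = kVec n q s m l k h + kVec n q s m l k h' := by
  apply Subtype.ext
  funext p
  have e : (kVec n q s m l k h + kVec n q s m l k h').1 p =
    (kVec n q s m l k h).1 p + (kVec n q s m l k h').1 p := rfl
  rw [e, coe_kVec hn hm hh, coe_kVec hn hm hh', coe_kVec hn hm (Submodule.add_mem _ hh hh')]
  simp only [kFiniteVector, map_add]
  ring

theorem kVec_zero (hn : 1 ≤ n) {m : ℤ} {l k : ℕ} (hm : m ≡ 2 * k + q [ZMOD 4]) :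
    kVec n q s m l k 0 = 0 := by
  have := kVec_smul (s := s) (l := l) hn hm (Submodule.zero_mem (harmonicPolynomials n k)) 0
  rwa [zero_smul, zero_smul] at this

theorem kVec_sum (hn : 1 ≤ n) {m : ℤ} {l k : ℕ} (hm : m ≡ 2 * k + q [ZMOD 4]) {ι : Type*}
    (t : Finset ι) {f : ι → MvPolynomial (Fin n) ℂ}
    (hf : ∀ i ∈ t, f i ∈ harmonicPolynomials n k) :
    kVec n q s m l k (∑ i ∈ t, f i) = ∑ i ∈ t, kVec n q s m l k (f i) := by
  classical
  induction t using Finset.induction_on with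
  | empty => simpa using kVec_zero hn hm
  | insert i t hi ih =>
    rw [Finset.sum_insert hi, Finset.sum_insert hi,
      kVec_add hn hm (hf i (Finset.mem_insert_self i t))
        (Submodule.sum_mem _ fun j hj => hf j (Finset.mem_insert_of_mem hj)),
      ih fun j hj => hf j (Finset.mem_insert_of_mem hj)]

/-- The factor ₁F₁ equals 1 at y = 0, hence is non-zero near 0, and ρ^{2l} is non-zero where all
coordinates are positive. So h vanishes on a product of infinite sets. -/
theorem eq_zero_of_kVec_eq_zero (hn : 1 ≤ n) {m : ℤ} {l k : ℕ} {h : MvPolynomial (Fin n) ℂ}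
    (hm : m ≡ 2 * k + q [ZMOD 4]) (hh : h ∈ harmonicPolynomials n k)
    (h0 : kVec n q s m l k h = 0) : h = 0 := by
  have hF : ∀ y : Fin n → ℝ, kFiniteVector n s m l k h (0, y) = 0 := fun y => by
    rw [← coe_kVec hn hm hh, h0]
    rfl
  set Φ := confluentHypergeometric ((m + 4 * l + 2 * k + n) / 4) (2 * l + k + n / 2)
  have hΦ : Continuous Φ :=
    (differentiable_confluentHypergeometric _ (re_pos_of_one_le hn l k)).continuous
  have hcont : Continuous fun y : Fin n → ℝ => Φ (2 * Complex.I * s * (y ⬝ᵥ y : ℝ)) := by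
    refine hΦ.comp (continuous_const.mul (Complex.continuous_ofReal.comp ?_))
    simp only [dotProduct]
    fun_prop
  have hev : ∀ᶠ y : Fin n → ℝ in nhds 0, Φ (2 * Complex.I * s * (y ⬝ᵥ y : ℝ)) ≠ 0 := by
    refine hcont.continuousAt.eventually_ne ?_
    simp [Φ, confluentHypergeometric_zero]
  obtain ⟨δ, hδ, hball⟩ := Metric.eventually_nhds_iff.1 hev
  have hinf : ((fun x : ℝ => (x : ℂ)) '' Set.Ioo 0 δ).Infinite :=
    (Set.Ioo_infinite hδ).image Complex.ofReal_injective.injOn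
  refine MvPolynomial.funext_set (fun _ => (fun x : ℝ => (x : ℂ)) '' Set.Ioo 0 δ)
    (fun _ => hinf) fun x hx => ?_
  choose y hy using fun i => hx i (Set.mem_univ i)
  have hxy : x = fun i => (y i : ℂ) := funext fun i => (hy i).2.symm
  have hyδ : dist y 0 < δ := by
    rw [dist_pi_lt_iff hδ]
    intro i
    have := (hy i).1
    rw [Pi.zero_apply, Real.dist_eq, sub_zero, abs_of_pos this.1]
    exact this.2
  have hne : ((y ⬝ᵥ y : ℝ) : ℂ) ^ l ≠ 0 := by
    refine pow_ne_zero _ (Complex.ofReal_ne_zero.2 fun h1 => ?_)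
    rw [dotProduct_self_eq_zero] at h1
    have := (hy ⟨0, hn⟩).1.1
    rw [h1] at this
    exact lt_irrefl _ this
  have := hF y
  simp only [kFiniteVector, mul_eq_zero, Complex.exp_ne_zero, hne, false_or] at this
  rw [map_zero, hxy]
  rcases this with h1 | h1
  · exact h1
  · exact absurd h1 (hball hyδ)

theorem slOp_kVec (hn : 1 ≤ n) {ε : ℤ} (hε : ε = 1 ∨ ε = -1) {m : ℤ} {l k : ℕ}
    {h : MvPolynomial (Fin n) ℂ} (hm : m ≡ 2 * k + q [ZMOD 4])
    (hh : h ∈ harmonicPolynomials n k) :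
    slOp ε (kVec n q s m l k h) =
      (-(((4 * l + 2 * k + n + ε * m : ℤ) : ℂ)) / 2) • kVec n q s (m + 4 * ε) l k h := by
  have hm' : m + 4 * ε ≡ 2 * k + q [ZMOD 4] := by
    unfold Int.ModEq at hm ⊢
    omega
  apply Subtype.ext
  funext p
  rw [slOp_kFiniteVector hn hε hh (coe_kVec hn hm hh)]
  have e : ∀ c : ℂ, (c • kVec n q s (m + 4 * ε) l k h).1 p =
    c * (kVec n q s (m + 4 * ε) l k h).1 p := fun _ => rfl
  rw [e, coe_kVec hn hm' hh]
  push_cast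
  ring

theorem lieOp_compact_kVec (hn : 1 ≤ n) {m : ℤ} {l k : ℕ}
    {h : MvPolynomial (Fin n) ℂ} (hm : m ≡ 2 * k + q [ZMOD 4])
    (hh : h ∈ harmonicPolynomials n k) :
    lieOp (slElement n 0 1 (-1)) (kVec n q s m l k h) =
      (Complex.I * m / 2) • kVec n q s m l k h := by
  apply Subtype.ext
  funext p
  rw [lieOp_compact_kFiniteVector hn (coe_kVec hn hm hh), ← coe_kVec hn hm hh]
  rfl

theorem lieOp_soElement_kVec (hn : 1 ≤ n) {m : ℤ} {l k : ℕ}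
    {h : MvPolynomial (Fin n) ℂ} (hm : m ≡ 2 * k + q [ZMOD 4])
    (hh : h ∈ harmonicPolynomials n k) (A : LieAlgebra.Orthogonal.so (Fin n) ℝ) :
    lieOp (soElement A) (kVec n q s m l k h) =
      kVec n q s m l k (rotationDerivation A.1 h) := by
  apply Subtype.ext
  funext p
  rw [lieOp_soElement_kFiniteVector hn A (coe_kVec hn hm hh),
    coe_kVec hn hm (rotationDerivation_mem_harmonicPolynomials (so_transpose A) hh)]

/-- The generator `E_{ij} - E_{ji}` of `𝔰𝔬(n)`. -/
def soGenerator (i j : Fin n) : LieAlgebra.Orthogonal.so (Fin n) ℝ :=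
  ⟨Matrix.single i j 1 - Matrix.single j i 1, by
    rw [LieAlgebra.Orthogonal.mem_so]
    simp [Matrix.transpose_sub]⟩

theorem rotationDerivation_soGenerator (i j : Fin n) (h : MvPolynomial (Fin n) ℂ) :
    rotationDerivation (soGenerator i j).1 h = X i * pderiv j h - X j * pderiv i h := by
  have key : ∀ a b : Fin n, ∑ i' : Fin n, ∑ j' : Fin n,
      C (((Matrix.single a b (1 : ℝ)) i' j' : ℝ) : ℂ) * (X j' * pderiv i' h) = X b * pderiv a h := by
    intro a b
    rw [Finset.sum_eq_single a, Finset.sum_eq_single b]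
    · simp
    · intro j' _ hj
      simp [Ne.symm hj]
    · simp
    · intro i' _ hi
      simp [Ne.symm hi]
    · simp
  have e : ∀ i' j', (((soGenerator i j).1 i' j' : ℝ) : ℂ) =
      (((Matrix.single i j (1 : ℝ)) i' j' : ℝ) : ℂ) - (((Matrix.single j i (1 : ℝ)) i' j' : ℝ) : ℂ) :=
    fun i' j' => by simp [soGenerator]
  simp only [rotationDerivation, e, map_sub, sub_mul, Finset.sum_sub_distrib, key]
  ring

/-- A multiple of the Casimir operator of `𝔰𝔬(n)`. -/
noncomputable def soCasimir : compactPicture n q s →ₗ[ℂ] compactPicture n q s :=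
  ∑ i : Fin n, ∑ j : Fin n, lieOp (soElement (soGenerator i j)) ∘ₗ
    lieOp (soElement (soGenerator i j))

theorem soCasimir_kVec (hn : 1 ≤ n) {m : ℤ} {l k : ℕ}
    {h : MvPolynomial (Fin n) ℂ} (hm : m ≡ 2 * k + q [ZMOD 4])
    (hh : h ∈ harmonicPolynomials n k) :
    soCasimir (kVec n q s m l k h) = (-2 * k * (k + n - 2) : ℂ) • kVec n q s m l k h := by
  have hR : ∀ i j : Fin n, ∀ g ∈ harmonicPolynomials n k,
      X i * pderiv j g - X j * pderiv i g ∈ harmonicPolynomials n k := fun i j g hg => by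
    rw [← rotationDerivation_soGenerator]
    exact rotationDerivation_mem_harmonicPolynomials (so_transpose _) hg
  rw [← kVec_smul hn hm hh, ← C_mul', ← sum_rotation_sq hh,
    kVec_sum hn hm _ fun i _ => Submodule.sum_mem _ fun j _ => hR _ _ _ (hR _ _ _ hh)]
  simp only [soCasimir, LinearMap.sum_apply, LinearMap.comp_apply]
  refine Finset.sum_congr rfl fun i _ => ?_
  rw [kVec_sum hn hm _ fun j _ => hR _ _ _ (hR _ _ _ hh)]
  refine Finset.sum_congr rfl fun j _ => ?_
  rw [lieOp_soElement_kVec hn hm hh, rotationDerivation_soGenerator,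
    lieOp_soElement_kVec hn hm (hR _ _ _ hh), rotationDerivation_soGenerator]

/-- All that the structure theory needs from the explicit formula. The hypothesis s ≠ 0 enters here:
without it the two terms that raise β = 4l + 2k + n would disappear. -/
theorem ladderOp_kVec (hn : 1 ≤ n) (hs : s ≠ 0) {ε : ℤ} (hε : ε = 1 ∨ ε = -1) {m : ℤ} {l k : ℕ}
    {h : MvPolynomial (Fin n) ℂ} (hm : m ≡ 2 * k + q [ZMOD 4])
    (hh : h ∈ harmonicPolynomials n k) (j : Fin n) :
    ∃ c₁ c₂ c₃ c₄ : ℂ,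
      ladderOp ε j (kVec n q s m l k h) =
        c₁ • kVec n q s (m + 2 * ε) l (k - 1) (pderiv j h)
        + c₂ • kVec n q s (m + 2 * ε) (l + 1) (k - 1) (pderiv j h)
        + c₃ • kVec n q s (m + 2 * ε) (l - 1) (k + 1) (harmonicMul k j h)
        + c₄ • kVec n q s (m + 2 * ε) l (k + 1) (harmonicMul k j h) ∧
      (c₁ = 0 ↔ k = 0) ∧ (c₂ = 0 ↔ k = 0 ∨ l = 0 ∨ 4 * l + 2 * k + n + ε * m = 0) ∧
      (c₃ = 0 ↔ l = 0) ∧ (c₄ = 0 ↔ 4 * l + 2 * k + n + ε * m = 0) := by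
  set κ : ℂ := 2 * k + n - 2 with hκ
  set B : ℂ := 2 * l + k + n / 2 - 1 with hB
  set r : ℂ := 2 * Complex.I * s *
    (ε * ((4 * l + 2 * k + n) + ε * m) / (2 * (4 * l + 2 * k + n))) with hr
  have hε0 : (ε : ℂ) ≠ 0 := by rcases hε with rfl | rfl <;> simp
  have hβ : (4 * l + 2 * k + n : ℂ) ≠ 0 := by
    have : ((4 * l + 2 * k + n : ℕ) : ℂ) ≠ 0 := Nat.cast_ne_zero.2 (by omega)
    exact_mod_cast this
  have hr0 : r = 0 ↔ 4 * l + 2 * k + n + ε * m = 0 := by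
    have e : ((4 * l + 2 * k + n : ℂ) + ε * m) = ((4 * l + 2 * k + n + ε * m : ℤ) : ℂ) := by
      push_cast; rfl
    rw [hr, e]
    simp [hs, hε0, hβ]
    norm_cast
  have hm₁ : m + 2 * ε ≡ 2 * (k + 1 : ℕ) + q [ZMOD 4] := by
    unfold Int.ModEq at hm ⊢
    omega
  have hQ := harmonicMul_mem_harmonicPolynomials hn hh j
  -- Vanishing would force B = l, that is 2l + 2k + n = 2, so l = k = 0 and n = 2. But then B = 0,
  -- the quotient is 0 by convention, and the factor is 2.
  have hfac : 2 - 2 * l / B ≠ 0 := by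
    intro h0
    by_cases hB0 : B = 0
    · simp [hB0] at h0
    · have h1 : ((2 * l + 2 * k + n : ℕ) : ℂ) = (2 : ℕ) := by
        field_simp at h0
        push_cast
        rw [hB] at h0
        linear_combination h0
      have h2 : 2 * l + 2 * k + n = 2 := by exact_mod_cast h1
      refine hB0 ?_
      have : l = 0 ∧ k = 0 ∧ n = 2 := by omega
      rw [hB, this.1, this.2.1, this.2.2]
      norm_num
  have hform := ladderOp_kFiniteVector hn hε hh j (F := kVec n q s m l k h) (coe_kVec hn hm hh)
  have hc : ∀ (c : ℂ) (G : compactPicture n q s) (p : ℝ × (Fin n → ℝ)),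
    (c • G).1 p = c * G.1 p := fun _ _ _ => rfl
  have ha : ∀ (F G : compactPicture n q s) (p : ℝ × (Fin n → ℝ)),
    (F + G).1 p = F.1 p + G.1 p := fun _ _ _ => rfl
  have h3 : (2 * l : ℂ) = 0 ↔ l = 0 := by simp
  have h4 : (2 - 2 * l / B) * r = 0 ↔ 4 * l + 2 * k + n + ε * m = 0 := by
    rw [mul_eq_zero, hr0]
    simp [hfac]
  cases k with
  | zero =>
    -- For k = 0 both derivative terms vanish, so zero may be chosen for their coefficients, as the
    -- stated equivalences require.
    refine ⟨0, 0, 2 * l, (2 - 2 * l / B) * r, ?_, by simp, by simp, h3, h4⟩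
    apply Subtype.ext
    funext p
    rw [hform p, pderiv_eq_zero_of_mem_harmonicPolynomials_zero hh]
    simp only [ha, hc, coe_kVec hn hm₁ hQ]
    simp [kFiniteVector, hB, hr]
  | succ k =>
    have hκ0 : κ ≠ 0 := two_mul_add_sub_two_ne_zero hn k
    have hB0 : B ≠ 0 := by
      have e : B = ((4 * l + 2 * k + n : ℕ) : ℂ) / 2 := by rw [hB]; push_cast; ring
      rw [e]
      exact div_ne_zero (Nat.cast_ne_zero.2 (by omega)) two_ne_zero
    have hm₂ : m + 2 * ε ≡ 2 * k + q [ZMOD 4] := by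
      unfold Int.ModEq at hm ⊢
      omega
    have hD := pderiv_mem_harmonicPolynomials hh j
    refine ⟨(2 * l + κ) / κ, 1 / κ * (2 * l / B) * r, 2 * l, (2 - 2 * l / B) * r,
      ?_, ?_, ?_, h3, h4⟩
    · apply Subtype.ext
      funext p
      rw [hform p]
      simp only [ha, hc, coe_kVec hn hm₁ hQ, add_tsub_cancel_right, coe_kVec hn hm₂ hD]
      rfl
    · have e : (2 * l + κ : ℂ) = ((2 * l + 2 * k + n : ℕ) : ℂ) := by rw [hκ]; push_cast; ring
      rw [e, div_eq_zero_iff, or_iff_left hκ0, Nat.cast_eq_zero]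
      omega
    · rw [mul_eq_zero, hr0, mul_eq_zero, div_eq_zero_iff, div_eq_zero_iff, or_iff_left hκ0,
        or_iff_left hB0, h3]
      simp

end Vectors

/-! ### Generators of the action and separation of weights -/

section Submodules
open MvPolynomial

variable {n : ℕ} {q : ℤ} {s : ℂ}

theorem real_smul_compactPicture (c : ℝ) (F : compactPicture n q s) : c • F = (c : ℂ) • F := by
  apply Subtype.ext
  funext p
  exact (Complex.real_smul (x := c) (z := F.1 p))

theorem IsGSubmodule.lieOp_mem {U : Submodule ℂ (compactPicture n q s)} (hU : IsGSubmodule U)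
    (Z : JacobiAlgebra n) {F : compactPicture n q s} (hF : F ∈ U) : lieOp Z F ∈ U := hU Z F hF

theorem IsGSubmodule.slOp_mem {U : Submodule ℂ (compactPicture n q s)} (hU : IsGSubmodule U)
    (ε : ℤ) {F : compactPicture n q s} (hF : F ∈ U) : slOp ε F ∈ U :=
  U.add_mem (hU _ F hF) (U.smul_mem _ (hU _ F hF))

theorem IsGSubmodule.ladderOp_mem {U : Submodule ℂ (compactPicture n q s)} (hU : IsGSubmodule U)
    (ε : ℤ) (j : Fin n) {F : compactPicture n q s} (hF : F ∈ U) : ladderOp ε j F ∈ U :=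
  U.neg_mem (U.add_mem (hU _ F hF) (U.smul_mem _ (hU _ F hF)))

theorem IsGSubmodule.soCasimir_mem {U : Submodule ℂ (compactPicture n q s)} (hU : IsGSubmodule U)
    {F : compactPicture n q s} (hF : F ∈ U) : soCasimir F ∈ U := by
  simp only [soCasimir, LinearMap.sum_apply, LinearMap.comp_apply]
  exact U.sum_mem fun i _ => U.sum_mem fun j _ => hU _ _ (hU _ _ hF)

/-- The action on a fixed vector, as a linear map on `𝔤`. -/
noncomputable def orbitMap (F : compactPicture n q s) :
    JacobiAlgebra n →ₗ[ℝ] compactPicture n q s where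
  toFun Z := ⁅Z, F⁆
  map_add' Z W := add_lie Z W F
  map_smul' c Z := smul_lie c Z F

theorem orbitMap_apply (F : compactPicture n q s) (Z : JacobiAlgebra n) :
    orbitMap F Z = lieOp Z F := rfl

theorem slElement_eq (a b c : ℝ) : slElement n a b c =
    a • slElement n 1 0 0 + ((b + c) / 2) • slElement n 0 1 1
      + ((b - c) / 2) • slElement n 0 1 (-1) := by
  refine LieAlgebra.SemiDirectSum.ext ?_ (Prod.ext (Subtype.ext ?_) ?_)
  · simp [slElement]
  · ext i j
    fin_cases i <;> fin_cases j <;> simp [slElement] <;> ring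
  · simp [slElement]

theorem jacobi_decomposition (Z : JacobiAlgebra n) :
    Z = slElement n (Z.right.1.1 0 0) (Z.right.1.1 0 1) (Z.right.1.1 1 0) + soElement Z.right.2
      + (heisenbergElement (.mk Z.left.u 0 0) + heisenbergElement (.mk 0 Z.left.v 0)
        + heisenbergElement (.mk 0 0 Z.left.w)) := by
  refine LieAlgebra.SemiDirectSum.ext ?_ (Prod.ext (Subtype.ext ?_) ?_)
  · apply HeisenbergAlgebra.ext' <;> simp [slElement, soElement, heisenbergElement]
  · ext i j
    have := sl_one_one Z.right.1
    fin_cases i <;> fin_cases j <;> simp [slElement, soElement, heisenbergElement, this]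
  · simp [slElement, soElement, heisenbergElement]

/-- The linear map `u ↦ (u, 0, 0)` into the Heisenberg algebra. -/
def heisenbergLeft (n : ℕ) : (Fin n → ℝ) →ₗ[ℝ] JacobiAlgebra n where
  toFun u := heisenbergElement (.mk u 0 0)
  map_add' u v := by
    refine LieAlgebra.SemiDirectSum.ext ?_ (by simp [heisenbergElement])
    apply HeisenbergAlgebra.ext' <;> simp [heisenbergElement]
  map_smul' c u := by
    refine LieAlgebra.SemiDirectSum.ext ?_ (by simp [heisenbergElement])
    apply HeisenbergAlgebra.ext' <;> simp [heisenbergElement]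

/-- The linear map `v ↦ (0, v, 0)` into the Heisenberg algebra. -/
def heisenbergRight (n : ℕ) : (Fin n → ℝ) →ₗ[ℝ] JacobiAlgebra n where
  toFun u := heisenbergElement (.mk 0 u 0)
  map_add' u v := by
    refine LieAlgebra.SemiDirectSum.ext ?_ (by simp [heisenbergElement])
    apply HeisenbergAlgebra.ext' <;> simp [heisenbergElement]
  map_smul' c u := by
    refine LieAlgebra.SemiDirectSum.ext ?_ (by simp [heisenbergElement])
    apply HeisenbergAlgebra.ext' <;> simp [heisenbergElement]

theorem map_mem_of_forall_single {U : Submodule ℂ (compactPicture n q s)}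
    (f : (Fin n → ℝ) →ₗ[ℝ] compactPicture n q s) (hf : ∀ j, f (Pi.single j 1) ∈ U)
    (u : Fin n → ℝ) : f u ∈ U := by
  have hu : u = ∑ j, u j • (Pi.single j 1 : Fin n → ℝ) := by
    ext i
    simp [Finset.sum_apply, Pi.single_apply]
  rw [hu, map_sum]
  refine U.sum_mem fun j _ => ?_
  rw [map_smul, real_smul_compactPicture]
  exact U.smul_mem _ (hf j)

/-- These operators, 𝔰𝔬(n) and the centre span the complexification of 𝔤, and the centre acts by
scalars. -/
theorem lieOp_mem_of_operators {U : Submodule ℂ (compactPicture n q s)}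
    {F : compactPicture n q s} (hF : F ∈ U)
    (hK : lieOp (slElement n 0 1 (-1)) F ∈ U)
    (hX : ∀ ε : ℤ, ε = 1 ∨ ε = -1 → slOp ε F ∈ U)
    (hD : ∀ ε : ℤ, ε = 1 ∨ ε = -1 → ∀ j, ladderOp ε j F ∈ U)
    (hA : ∀ A, lieOp (soElement A) F ∈ U) (Z : JacobiAlgebra n) : ⁅Z, F⁆ ∈ U := by
  have hI := Complex.I_ne_zero
  have hII := Complex.I_mul_I
  have h1 : lieOp (slElement n 1 0 0) F ∈ U := by
    have e : lieOp (slElement n 1 0 0) F =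
        (1 / 2 : ℂ) • slOp 1 F + (1 / 2 : ℂ) • slOp (-1) F := by
      simp only [slOp, LinearMap.add_apply, LinearMap.smul_apply]
      module
    rw [e]
    exact U.add_mem (U.smul_mem _ (hX 1 (Or.inl rfl))) (U.smul_mem _ (hX (-1) (Or.inr rfl)))
  have h2 : lieOp (slElement n 0 1 1) F ∈ U := by
    have e : lieOp (slElement n 0 1 1) F =
        (1 / (2 * Complex.I)) • (slOp 1 F - slOp (-1) F) := by
      simp only [slOp, LinearMap.add_apply, LinearMap.smul_apply]
      match_scalars <;> field_simp <;> ring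
    rw [e]
    exact U.smul_mem _ (U.sub_mem (hX 1 (Or.inl rfl)) (hX (-1) (Or.inr rfl)))
  have h3 : ∀ j, lieOp (heisenbergElement (.mk (Pi.single j 1) 0 0)) F ∈ U := by
    intro j
    have e : lieOp (heisenbergElement (.mk (Pi.single j 1) 0 0)) F =
        (-(1 / 2) : ℂ) • ladderOp 1 j F + (-(1 / 2) : ℂ) • ladderOp (-1) j F := by
      simp only [ladderOp, LinearMap.add_apply, LinearMap.smul_apply, LinearMap.neg_apply]
      match_scalars <;> ring
    rw [e]
    exact U.add_mem (U.smul_mem _ (hD 1 (Or.inl rfl) j)) (U.smul_mem _ (hD (-1) (Or.inr rfl) j))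
  have h4 : ∀ j, lieOp (heisenbergElement (.mk 0 (Pi.single j 1) 0)) F ∈ U := by
    intro j
    have e : lieOp (heisenbergElement (.mk 0 (Pi.single j 1) 0)) F =
        (-(1 / (2 * Complex.I))) • (ladderOp 1 j F - ladderOp (-1) j F) := by
      simp only [ladderOp, LinearMap.add_apply, LinearMap.smul_apply, LinearMap.neg_apply]
      match_scalars <;> field_simp <;> ring
    rw [e]
    exact U.smul_mem _ (U.sub_mem (hD 1 (Or.inl rfl) j) (hD (-1) (Or.inr rfl) j))
  have hZ : orbitMap F Z ∈ U := by
    rw [jacobi_decomposition Z, map_add, map_add, map_add, map_add, slElement_eq, map_add, map_add,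
      map_smul, map_smul, map_smul, real_smul_compactPicture, real_smul_compactPicture,
      real_smul_compactPicture]
    refine U.add_mem (U.add_mem (U.add_mem (U.add_mem (U.smul_mem _ h1) (U.smul_mem _ h2))
      (U.smul_mem _ hK)) (hA _)) (U.add_mem (U.add_mem ?_ ?_) ?_)
    · exact map_mem_of_forall_single (orbitMap F ∘ₗ heisenbergLeft n) h3 _
    · exact map_mem_of_forall_single (orbitMap F ∘ₗ heisenbergRight n) h4 _
    · rw [orbitMap_apply, lieOp_central]
      exact U.smul_mem _ hF
  exact hZ

/-- If a sum of joint eigenvectors lies in a subspace and a summand can be separated from each of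
the other ones by an operator that preserves the subspace, then the summand is in the subspace. -/
theorem mem_of_add_sum_mem {V ι : Type*} [AddCommGroup V] [Module ℂ V] [DecidableEq ι]
    (U : Submodule ℂ V) (i₀ : ι) (t : Finset ι) (x : ι → V)
    (hsep : ∀ j ∈ t, x j = 0 ∨ ∃ (T : V →ₗ[ℂ] V) (μ : ι → ℂ), (∀ v ∈ U, T v ∈ U) ∧
      (∀ i, T (x i) = μ i • x i) ∧ μ i₀ ≠ μ j)
    (hsum : x i₀ + ∑ i ∈ t, x i ∈ U) : x i₀ ∈ U := by
  induction t using Finset.induction_on generalizing x with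
  | empty => simpa using hsum
  | insert j t hj ih =>
    rcases hsep j (Finset.mem_insert_self j t) with h0 | ⟨T, μ, hT, hμ, hne⟩
    · refine ih x (fun i hi => hsep i (Finset.mem_insert_of_mem hi)) ?_
      rwa [Finset.sum_insert hj, h0, zero_add] at hsum
    -- Applying T - μ_j removes the j-th summand and rescales the others, so the induction
    -- hypothesis applies to the rescaled family. Its distinguished member is a non-zero multiple of
    -- the original one.
    · have h1 : (μ i₀ - μ j) • x i₀ ∈ U := by
        refine ih (fun i => (μ i - μ j) • x i) (fun i hi => ?_) ?_
        · rcases hsep i (Finset.mem_insert_of_mem hi) with h0 | ⟨T', μ', hT', hμ', hne'⟩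
          · left
            simp [h0]
          · refine Or.inr ⟨T', μ', hT', fun i' => ?_, hne'⟩
            rw [map_smul, hμ', smul_comm]
        · have h2 := U.sub_mem (hT _ hsum) (U.smul_mem (μ j) hsum)
          rw [Finset.sum_insert hj] at h2
          convert h2 using 1
          simp only [map_add, map_sum, hμ, smul_add, Finset.smul_sum, sub_smul,
            Finset.sum_sub_distrib]
          abel
      have h2 := U.smul_mem (μ i₀ - μ j)⁻¹ h1
      rwa [smul_smul, inv_mul_cancel₀ (sub_ne_zero.2 hne), one_smul] at h2

/-- The span of the `F_{m,l,k}^h` with fixed `t = (m, l, k)`. -/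
def weightSpace (n : ℕ) (q : ℤ) (s : ℂ) (t : ℤ × ℕ × ℕ) : Submodule ℂ (compactPicture n q s) :=
  kFiniteSpan n q s {t.1} t.2.1 t.2.2

theorem mem_weightSpace (hn : 1 ≤ n) {t : ℤ × ℕ × ℕ} (ht : t.1 ≡ 2 * t.2.2 + q [ZMOD 4])
    {F : compactPicture n q s} : F ∈ weightSpace n q s t ↔
      ∃ h ∈ harmonicPolynomials n t.2.2, F = kVec n q s t.1 t.2.1 t.2.2 h := by
  constructor
  · intro hF
    refine Submodule.span_induction ?_ ?_ ?_ ?_ hF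
    · rintro G ⟨m, hm, h, hh, -, hG⟩
      rw [Set.mem_singleton_iff] at hm
      subst hm
      exact ⟨h, hh, Subtype.ext (by rw [coe_kVec hn ht hh, hG])⟩
    · exact ⟨0, Submodule.zero_mem _, (kVec_zero hn ht).symm⟩
    · rintro _ _ _ _ ⟨h, hh, rfl⟩ ⟨h', hh', rfl⟩
      exact ⟨h + h', Submodule.add_mem _ hh hh', (kVec_add hn ht hh hh').symm⟩
    · rintro c _ _ ⟨h, hh, rfl⟩
      exact ⟨c • h, Submodule.smul_mem _ c hh, (kVec_smul hn ht hh c).symm⟩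
  · rintro ⟨h, hh, rfl⟩
    exact Submodule.subset_span ⟨t.1, rfl, h, hh, ht, coe_kVec hn ht hh⟩

theorem weightSpace_eq_bot {t : ℤ × ℕ × ℕ} (ht : ¬ t.1 ≡ 2 * t.2.2 + q [ZMOD 4]) :
    weightSpace n q s t = ⊥ := by
  rw [weightSpace, kFiniteSpan, Submodule.span_eq_bot]
  rintro F ⟨m, hm, h, -, hmod, -⟩
  rw [Set.mem_singleton_iff] at hm
  subst hm
  exact absurd hmod ht

theorem compact_weightSpace (hn : 1 ≤ n) {t : ℤ × ℕ × ℕ} {F : compactPicture n q s}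
    (hF : F ∈ weightSpace n q s t) :
    lieOp (slElement n 0 1 (-1)) F = (Complex.I * t.1 / 2) • F := by
  by_cases ht : t.1 ≡ 2 * t.2.2 + q [ZMOD 4]
  · obtain ⟨h, hh, rfl⟩ := (mem_weightSpace hn ht).1 hF
    exact lieOp_compact_kVec hn ht hh
  · rw [weightSpace_eq_bot ht, Submodule.mem_bot] at hF
    simp [hF]

theorem soCasimir_weightSpace (hn : 1 ≤ n) {t : ℤ × ℕ × ℕ} {F : compactPicture n q s}
    (hF : F ∈ weightSpace n q s t) :
    soCasimir F = (-2 * t.2.2 * (t.2.2 + n - 2) : ℂ) • F := by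
  by_cases ht : t.1 ≡ 2 * t.2.2 + q [ZMOD 4]
  · obtain ⟨h, hh, rfl⟩ := (mem_weightSpace hn ht).1 hF
    exact soCasimir_kVec hn ht hh
  · rw [weightSpace_eq_bot ht, Submodule.mem_bot] at hF
    simp [hF]

/-- The coefficients multiply to (β - m)(β + m - 4)/4 with β = 4l + 2k + n; in the form of a
difference of squares, β can be read off once m is known. -/
theorem slOp_slOp_weightSpace (hn : 1 ≤ n) {t : ℤ × ℕ × ℕ} {F : compactPicture n q s}
    (hF : F ∈ weightSpace n q s t) :
    slOp 1 (slOp (-1) F) = ((((4 * t.2.1 + 2 * t.2.2 + n - 2) ^ 2 - (t.1 - 2) ^ 2 : ℤ) : ℂ) / 4) •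
      F := by
  by_cases ht : t.1 ≡ 2 * t.2.2 + q [ZMOD 4]
  · obtain ⟨h, hh, rfl⟩ := (mem_weightSpace hn ht).1 hF
    rw [slOp_kVec hn (Or.inr rfl) ht hh, map_smul, slOp_kVec hn (Or.inl rfl) _ hh, smul_smul]
    · have e : t.1 + 4 * (-1) + 4 * 1 = t.1 := by ring
      rw [e]
      congr 1
      push_cast
      ring
    · unfold Int.ModEq at ht ⊢
      omega
  · rw [weightSpace_eq_bot ht, Submodule.mem_bot] at hF
    simp [hF]

/-- Each quadratic relation factors, and the spurious factor is excluded by size or, for small n, by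
parity. -/
theorem weight_separation (hn : 1 ≤ n) {t t' : ℤ × ℕ × ℕ} (ht : t.1 ≡ 2 * t.2.2 + q [ZMOD 4])
    (ht' : t'.1 ≡ 2 * t'.2.2 + q [ZMOD 4]) (h1 : t.1 = t'.1)
    (h2 : (t.2.2 : ℤ) * (t.2.2 + n - 2) = t'.2.2 * (t'.2.2 + n - 2))
    (h3 : (4 * t.2.1 + 2 * t.2.2 + n - 2 : ℤ) ^ 2 = (4 * t'.2.1 + 2 * t'.2.2 + n - 2) ^ 2) :
    t = t' := by
  obtain ⟨m, l, k⟩ := t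
  obtain ⟨m', l', k'⟩ := t'
  simp only at *
  unfold Int.ModEq at ht ht'
  -- The second factor vanishes for distinct k, k' only if n = 1 and {k, k'} = {0, 1}. With equal m,
  -- the congruences force k ≡ k' mod 2 and rule this out.
  have hk : k = k' := by
    have : ((k : ℤ) - k') * (k + k' + n - 2) = 0 := by linear_combination h2
    rcases mul_eq_zero.1 this with h | h
    · omega
    · omega
  subst hk
  have hl : l = l' := by
    have : (4 * (l : ℤ) - 4 * l') * (4 * l + 4 * l' + 4 * k + 2 * n - 4) = 0 := by
      linear_combination h3
    rcases mul_eq_zero.1 this with h | h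
    · omega
    · omega
  rw [h1, hl]

/-- Weight vectors are joint eigenvectors of three operators that preserve every 𝔤-submodule, and
distinct indices of non-zero components are separated by at least one of them. -/
theorem component_mem (hn : 1 ≤ n) {U : Submodule ℂ (compactPicture n q s)} (hU : IsGSubmodule U)
    (f : ℤ × ℕ × ℕ →₀ compactPicture n q s) (hf : ∀ t, f t ∈ weightSpace n q s t)
    (hsum : (f.sum fun _ F => F) ∈ U) (t : ℤ × ℕ × ℕ) : f t ∈ U := by
  by_cases h0 : f t = 0
  · rw [h0]
    exact U.zero_mem
  have hts : t ∈ f.support := Finsupp.mem_support_iff.2 h0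
  rw [Finsupp.sum, ← Finset.add_sum_erase _ _ hts] at hsum
  have hmod : ∀ t, f t ≠ 0 → t.1 ≡ 2 * t.2.2 + q [ZMOD 4] := by
    intro t h0
    by_contra hc
    have := hf t
    rw [weightSpace_eq_bot hc, Submodule.mem_bot] at this
    exact h0 this
  refine mem_of_add_sum_mem U t (f.support.erase t) f (fun t' ht' => ?_) hsum
  rw [Finset.mem_erase, Finsupp.mem_support_iff] at ht'
  refine Or.inr ?_
  -- If no operator separates the two indices, all three eigenvalues agree and the indices coincide.
  by_contra! hc
  refine ht'.1 (weight_separation (q := q) hn (hmod _ ht'.2) (hmod _ h0) ?_ ?_ ?_)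
  · have := hc _ _ (fun v hv => hU.lieOp_mem _ hv) fun i => compact_weightSpace hn (hf i)
    have h2 := Complex.I_ne_zero
    field_simp at this
    exact_mod_cast this.symm
  · have := hc _ _ (fun v hv => hU.soCasimir_mem hv) fun i => soCasimir_weightSpace hn (hf i)
    have h2 : ((t'.2.2 : ℤ) * (t'.2.2 + n - 2) : ℂ) = ((t.2.2 : ℤ) * (t.2.2 + n - 2) : ℂ) := by
      push_cast
      linear_combination this / 2
    exact_mod_cast h2
  · have h1 := hc _ _ (fun v hv => hU.lieOp_mem _ hv) fun i => compact_weightSpace hn (hf i)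
    have h2 := Complex.I_ne_zero
    field_simp at h1
    have h1' : t.1 = t'.1 := by exact_mod_cast h1
    have := hc (slOp 1 ∘ₗ slOp (-1)) _ (fun v hv => hU.slOp_mem 1 (hU.slOp_mem (-1) hv))
      fun i => slOp_slOp_weightSpace hn (hf i)
    field_simp at this
    have h3 : ((4 * t.2.1 + 2 * t.2.2 + n - 2) ^ 2 - (t.1 - 2) ^ 2 : ℤ) =
        (4 * t'.2.1 + 2 * t'.2.2 + n - 2) ^ 2 - (t'.1 - 2) ^ 2 := by exact_mod_cast this
    rw [h1'] at h3
    linarith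

end Submodules

/-! ### Subspaces attached to sets of indices, and their stability -/

section IndexSets
open MvPolynomial

variable {n : ℕ} {q : ℤ} {s : ℂ}

/-- The sum of the spaces spanned by the `F_{m,l,k}^h` with `(m, l, k) ∈ S`. -/
def indexSpan (n : ℕ) (q : ℤ) (s : ℂ) (S : Set (ℤ × ℕ × ℕ)) :
    Submodule ℂ (compactPicture n q s) :=
  ⨆ t ∈ S, weightSpace n q s t

theorem weightSpace_le_indexSpan {S : Set (ℤ × ℕ × ℕ)} {t : ℤ × ℕ × ℕ} (ht : t ∈ S) :
    weightSpace n q s t ≤ indexSpan n q s S := le_biSup (weightSpace n q s) ht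

theorem indexSpan_mono {S T : Set (ℤ × ℕ × ℕ)} (h : S ⊆ T) :
    indexSpan n q s S ≤ indexSpan n q s T := biSup_mono fun _ ht => h ht

theorem indexSpan_union (S T : Set (ℤ × ℕ × ℕ)) :
    indexSpan n q s (S ∪ T) = indexSpan n q s S ⊔ indexSpan n q s T := iSup_union

theorem indexSpan_empty : indexSpan n q s ∅ = ⊥ := by simp [indexSpan]

theorem kVec_mem_indexSpan (hn : 1 ≤ n) {S : Set (ℤ × ℕ × ℕ)} {m : ℤ} {l k : ℕ}
    {h : MvPolynomial (Fin n) ℂ} (hm : m ≡ 2 * k + q [ZMOD 4]) (hh : h ∈ harmonicPolynomials n k)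
    (hS : (m, l, k) ∈ S) : kVec n q s m l k h ∈ indexSpan n q s S :=
  weightSpace_le_indexSpan hS ((mem_weightSpace hn (t := (m, l, k)) hm).2 ⟨h, hh, rfl⟩)

theorem exists_finsupp_of_mem_indexSpan {S : Set (ℤ × ℕ × ℕ)} {F : compactPicture n q s}
    (hF : F ∈ indexSpan n q s S) : ∃ f : ℤ × ℕ × ℕ →₀ compactPicture n q s,
      (∀ t, f t ∈ weightSpace n q s t) ∧ (∀ t ∉ S, f t = 0) ∧ (f.sum fun _ G => G) = F := by
  obtain ⟨f, hf, hsum⟩ := (Submodule.mem_iSup_iff_exists_finsupp _ _).1 hF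
  refine ⟨f, fun t => ?_, fun t ht => ?_, hsum⟩
  · have := hf t
    exact (iSup_le fun _ => le_rfl : (⨆ _ : t ∈ S, weightSpace n q s t) ≤ _) this
  · have := hf t
    simpa [ht] using this

theorem indexSpan_le (hn : 1 ≤ n) {S : Set (ℤ × ℕ × ℕ)} {U : Submodule ℂ (compactPicture n q s)}
    (h : ∀ (m : ℤ) (l k : ℕ), (m, l, k) ∈ S → m ≡ 2 * k + q [ZMOD 4] →
      ∀ h ∈ harmonicPolynomials n k, kVec n q s m l k h ∈ U) : indexSpan n q s S ≤ U := by
  refine iSup₂_le fun t ht => ?_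
  by_cases hm : t.1 ≡ 2 * t.2.2 + q [ZMOD 4]
  · intro F hF
    obtain ⟨g, hg, rfl⟩ := (mem_weightSpace hn hm).1 hF
    exact h _ _ _ ht hm g hg
  · rw [weightSpace_eq_bot hm]
    exact bot_le

theorem isGSubmodule_bot : IsGSubmodule (⊥ : Submodule ℂ (compactPicture n q s)) := by
  intro Z F hF
  rw [Submodule.mem_bot] at hF
  rw [hF, lie_zero]
  exact Submodule.zero_mem _

/-- Independence is the separation of components applied to the zero submodule. -/
theorem iSupIndep_weightSpace (hn : 1 ≤ n) : iSupIndep (weightSpace n q s) := by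
  classical
  intro t
  rw [Submodule.disjoint_def]
  intro F hF hF'
  obtain ⟨f, hf, hf0, hsum⟩ := exists_finsupp_of_mem_indexSpan (S := {t' | t' ≠ t}) hF'
  have key := component_mem hn (isGSubmodule_bot (q := q) (s := s)) (f - Finsupp.single t F)
    (fun t' => ?_) ?_ t
  · have h0 : f t = 0 := hf0 t (by simp)
    simpa [h0] using key
  · rw [Finsupp.sub_apply]
    refine Submodule.sub_mem _ (hf t') ?_
    rcases eq_or_ne t t' with rfl | hne
    · simpa using hF
    · rw [Finsupp.single_eq_of_ne (Ne.symm hne)]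
      exact Submodule.zero_mem _
  · rw [Finsupp.sum_sub_index (fun _ _ _ => rfl), hsum]
    simp

theorem disjoint_indexSpan (hn : 1 ≤ n) {S T : Set (ℤ × ℕ × ℕ)} (h : Disjoint S T) :
    Disjoint (indexSpan n q s S) (indexSpan n q s T) :=
  (iSupIndep_weightSpace hn).disjoint_biSup_biSup h

theorem kFiniteSpan_eq_indexSpan (hn : 1 ≤ n) (M : Set ℤ) (l k : ℕ) :
    kFiniteSpan n q s M l k = indexSpan n q s {t | t.1 ∈ M ∧ t.2 = (l, k)} := by
  apply le_antisymm
  · refine Submodule.span_le.2 ?_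
    rintro F ⟨m, hm, h, hh, hmod, hF⟩
    have : F = kVec n q s m l k h := Subtype.ext (by rw [coe_kVec hn hmod hh, hF])
    rw [this]
    exact kVec_mem_indexSpan hn hmod hh ⟨hm, rfl⟩
  · refine indexSpan_le hn ?_
    rintro m l' k' ⟨hm, heq⟩ hmod h hh
    simp only [Prod.mk.injEq] at heq
    obtain ⟨rfl, rfl⟩ := heq
    exact Submodule.subset_span ⟨m, hm, h, hh, hmod, coe_kVec hn hmod hh⟩

theorem iSup_indexSpan {ι : Sort*} (S : ι → Set (ℤ × ℕ × ℕ)) :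
    ⨆ i, indexSpan n q s (S i) = indexSpan n q s (⋃ i, S i) := by
  simp only [indexSpan, Set.mem_iUnion, iSup_exists]
  rw [iSup_comm]

theorem Hlk_eq_indexSpan (hn : 1 ≤ n) (l k : ℕ) :
    Hlk n q s l k = indexSpan n q s {t | t.2 = (l, k)} := by
  rw [Hlk, kFiniteSpan_eq_indexSpan hn]
  simp

theorem iSupIndep_Hlk (hn : 1 ≤ n) : iSupIndep (fun p : ℕ × ℕ => Hlk n q s p.1 p.2) := by
  intro p
  simp only [Hlk_eq_indexSpan hn, iSup_indexSpan]
  refine disjoint_indexSpan hn (Set.disjoint_left.2 ?_)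
  rintro t ht ht'
  simp only [Set.mem_iUnion, Set.mem_ofPred_eq] at ht ht'
  obtain ⟨p', hne, h⟩ := ht'
  exact hne (h.symm.trans ht)

/-- The indices with `l = 0`. -/
def zeroSet : Set (ℤ × ℕ × ℕ) := {t | t.2.1 = 0}

/-- The indices with `m ≥ 2 k + 4 l + n`. -/
def plusSet (n : ℕ) : Set (ℤ × ℕ × ℕ) := {t | (2 * t.2.2 + 4 * t.2.1 + n : ℤ) ≤ t.1}

/-- The indices with `m ≤ -(2 k + 4 l + n)`. -/
def minusSet (n : ℕ) : Set (ℤ × ℕ × ℕ) := {t | t.1 ≤ -(2 * t.2.2 + 4 * t.2.1 + n : ℤ)}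

theorem HZero_eq (hn : 1 ≤ n) : HZero n q s = indexSpan n q s zeroSet := by
  simp only [HZero, Hlk_eq_indexSpan hn, iSup_indexSpan]
  congr 1
  ext ⟨m, l, k⟩
  simp [zeroSet]

theorem HZeroPlus_eq (hn : 1 ≤ n) :
    HZeroPlus n q s = indexSpan n q s (zeroSet ∩ plusSet n) := by
  simp only [HZeroPlus, HlkPlus, kFiniteSpan_eq_indexSpan hn, iSup_indexSpan]
  congr 1
  ext ⟨m, l, k⟩
  simp only [zeroSet, plusSet, Set.mem_iUnion, Set.mem_ofPred_eq, Set.mem_inter_iff, Prod.mk.injEq]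
  constructor
  · rintro ⟨k, h, rfl, rfl⟩
    exact ⟨rfl, h⟩
  · rintro ⟨rfl, h⟩
    exact ⟨k, h, rfl, rfl⟩

theorem HZeroMinus_eq (hn : 1 ≤ n) :
    HZeroMinus n q s = indexSpan n q s (zeroSet ∩ minusSet n) := by
  simp only [HZeroMinus, HlkMinus, kFiniteSpan_eq_indexSpan hn, iSup_indexSpan]
  congr 1
  ext ⟨m, l, k⟩
  simp only [zeroSet, minusSet, Set.mem_iUnion, Set.mem_ofPred_eq, Set.mem_inter_iff, Prod.mk.injEq]
  constructor
  · rintro ⟨k, h, rfl, rfl⟩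
    exact ⟨rfl, h⟩
  · rintro ⟨rfl, h⟩
    exact ⟨k, h, rfl, rfl⟩

theorem HPlus_eq (hn : 1 ≤ n) : HPlus n q s = indexSpan n q s (plusSet n \ zeroSet) := by
  simp only [HPlus, HlkPlus, kFiniteSpan_eq_indexSpan hn, iSup_indexSpan]
  congr 1
  ext ⟨m, l, k⟩
  simp only [zeroSet, plusSet, Set.mem_iUnion, Set.mem_ofPred_eq, Set.mem_sdiff, Prod.mk.injEq]
  constructor
  · rintro ⟨l, hl, k, h, rfl, rfl⟩
    exact ⟨h, by omega⟩
  · rintro ⟨h, hl⟩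
    exact ⟨l, by omega, k, h, rfl, rfl⟩

theorem HMinus_eq (hn : 1 ≤ n) : HMinus n q s = indexSpan n q s (minusSet n \ zeroSet) := by
  simp only [HMinus, HlkMinus, kFiniteSpan_eq_indexSpan hn, iSup_indexSpan]
  congr 1
  ext ⟨m, l, k⟩
  simp only [zeroSet, minusSet, Set.mem_iUnion, Set.mem_ofPred_eq, Set.mem_sdiff, Prod.mk.injEq]
  constructor
  · rintro ⟨l, hl, k, h, rfl, rfl⟩
    exact ⟨h, by omega⟩
  · rintro ⟨h, hl⟩
    exact ⟨l, by omega, k, h, rfl, rfl⟩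

theorem HTotal_eq (hn : 1 ≤ n) : HTotal n q s = indexSpan n q s Set.univ := by
  simp only [HTotal, HZero_eq hn, Hlk_eq_indexSpan hn, iSup_indexSpan, ← indexSpan_union]
  congr 1
  ext ⟨m, l, k⟩
  simp only [zeroSet, Set.mem_union, Set.mem_iUnion, Set.mem_ofPred_eq, Set.mem_univ, iff_true,
    Prod.mk.injEq]
  rcases Nat.eq_zero_or_pos l with h | h
  · exact Or.inl h
  · exact Or.inr ⟨l, h, k, rfl, rfl⟩

/-- A set of indices is stable if it is closed under all transitions that occur in the action. -/
structure IsStableSet (n : ℕ) (q : ℤ) (S : Set (ℤ × ℕ × ℕ)) : Prop where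
  sl : ∀ ε : ℤ, ε = 1 ∨ ε = -1 → ∀ (m : ℤ) (l k : ℕ), (m, l, k) ∈ S → m ≡ 2 * k + q [ZMOD 4] →
    4 * l + 2 * k + n + ε * m ≠ 0 → (m + 4 * ε, l, k) ∈ S
  down : ∀ ε : ℤ, ε = 1 ∨ ε = -1 → ∀ (m : ℤ) (l k : ℕ), (m, l, k + 1) ∈ S →
    m ≡ 2 * (k + 1) + q [ZMOD 4] →
    (m + 2 * ε, l, k) ∈ S
  shift : ∀ ε : ℤ, ε = 1 ∨ ε = -1 → ∀ (m : ℤ) (l k : ℕ), (m, l, k + 1) ∈ S →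
    m ≡ 2 * (k + 1) + q [ZMOD 4] →
    l ≠ 0 → 4 * l + 2 * (k + 1) + n + ε * m ≠ 0 → (m + 2 * ε, l + 1, k) ∈ S
  unshift : ∀ ε : ℤ, ε = 1 ∨ ε = -1 → ∀ (m : ℤ) (l k : ℕ), (m, l + 1, k) ∈ S →
    m ≡ 2 * k + q [ZMOD 4] →
    (m + 2 * ε, l, k + 1) ∈ S
  up : ∀ ε : ℤ, ε = 1 ∨ ε = -1 → ∀ (m : ℤ) (l k : ℕ), (m, l, k) ∈ S → m ≡ 2 * k + q [ZMOD 4] →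
    4 * l + 2 * k + n + ε * m ≠ 0 → (m + 2 * ε, l, k + 1) ∈ S

theorem IsStableSet.union {S T : Set (ℤ × ℕ × ℕ)} (hS : IsStableSet n q S)
    (hT : IsStableSet n q T) : IsStableSet n q (S ∪ T) where
  sl ε hε m l k h hm h0 := h.imp (hS.sl ε hε m l k · hm h0) (hT.sl ε hε m l k · hm h0)
  down ε hε m l k h hm := h.imp (hS.down ε hε m l k · hm) (hT.down ε hε m l k · hm)
  shift ε hε m l k h hm h1 h0 :=
    h.imp (hS.shift ε hε m l k · hm h1 h0) (hT.shift ε hε m l k · hm h1 h0)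
  unshift ε hε m l k h hm := h.imp (hS.unshift ε hε m l k · hm) (hT.unshift ε hε m l k · hm)
  up ε hε m l k h hm h0 := h.imp (hS.up ε hε m l k · hm h0) (hT.up ε hε m l k · hm h0)

theorem IsStableSet.inter {S T : Set (ℤ × ℕ × ℕ)} (hS : IsStableSet n q S)
    (hT : IsStableSet n q T) : IsStableSet n q (S ∩ T) where
  sl ε hε m l k h hm h0 := ⟨hS.sl ε hε m l k h.1 hm h0, hT.sl ε hε m l k h.2 hm h0⟩
  down ε hε m l k h hm := ⟨hS.down ε hε m l k h.1 hm, hT.down ε hε m l k h.2 hm⟩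
  shift ε hε m l k h hm h1 h0 :=
    ⟨hS.shift ε hε m l k h.1 hm h1 h0, hT.shift ε hε m l k h.2 hm h1 h0⟩
  unshift ε hε m l k h hm := ⟨hS.unshift ε hε m l k h.1 hm, hT.unshift ε hε m l k h.2 hm⟩
  up ε hε m l k h hm h0 := ⟨hS.up ε hε m l k h.1 hm h0, hT.up ε hε m l k h.2 hm h0⟩

theorem isStableSet_empty : IsStableSet n q ∅ := by
  constructor <;> simp

theorem isStableSet_univ : IsStableSet n q Set.univ := by
  constructor <;> simp

/-- The only transition that raises l has a coefficient divisible by l. -/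
theorem isStableSet_zeroSet : IsStableSet n q zeroSet := by
  constructor <;> simp +contextual [zeroSet]

/-- With β = 4l + 2k + n, the congruence gives β ≡ m mod 4, so either m = β or m ≥ β + 4. A
transition could leave the set only from the wall m = β, with ε = -1 and β not decreasing, and there
its coefficient β - m is zero. The negative side is the mirror image. -/
theorem isStableSet_plusSet (hq : q ≡ n [ZMOD 4]) : IsStableSet n q (plusSet n) := by
  unfold Int.ModEq at hq
  constructor <;> rintro ε (rfl | rfl) m l k h <;>
    simp only [plusSet, Set.mem_ofPred_eq, Int.ModEq] at h ⊢ <;> push_cast at * <;> intros <;> omega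

theorem isStableSet_minusSet (hq : q ≡ -n [ZMOD 4]) : IsStableSet n q (minusSet n) := by
  unfold Int.ModEq at hq
  constructor <;> rintro ε (rfl | rfl) m l k h <;>
    simp only [minusSet, Set.mem_ofPred_eq, Int.ModEq] at h ⊢ <;> push_cast at * <;> intros <;> omega

theorem isGSubmodule_indexSpan (hn : 1 ≤ n) (hs : s ≠ 0) {S : Set (ℤ × ℕ × ℕ)}
    (hS : IsStableSet n q S) : IsGSubmodule (indexSpan n q s S) := by
  intro Z
  suffices h : indexSpan n q s S ≤ (indexSpan n q s S).comap (lieOp Z) from fun F hF => h hF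
  refine indexSpan_le hn fun m l k hmem hm h hh => ?_
  refine lieOp_mem_of_operators (kVec_mem_indexSpan hn hm hh hmem) ?_ (fun ε hε => ?_)
    (fun ε hε j => ?_) (fun A => ?_) Z
  · rw [lieOp_compact_kVec hn hm hh]
    exact Submodule.smul_mem _ _ (kVec_mem_indexSpan hn hm hh hmem)
  · rw [slOp_kVec hn hε hm hh]
    by_cases h0 : (4 * l + 2 * k + n + ε * m : ℤ) = 0
    · rw [h0]
      simp
    · refine Submodule.smul_mem _ _ (kVec_mem_indexSpan hn ?_ hh (hS.sl ε hε m l k hmem hm h0))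
      unfold Int.ModEq at hm ⊢
      omega
  · obtain ⟨c₁, c₂, c₃, c₄, heq, h₁, h₂, h₃, h₄⟩ := ladderOp_kVec (l := l) hn hs hε hm hh j
    have hQ := harmonicMul_mem_harmonicPolynomials hn hh j
    have hmu : m + 2 * ε ≡ 2 * (k + 1 : ℕ) + q [ZMOD 4] := by
      unfold Int.ModEq at hm ⊢
      omega
    rw [heq]
    refine Submodule.add_mem _ (Submodule.add_mem _ (Submodule.add_mem _ ?_ ?_) ?_) ?_
    · by_cases h0 : c₁ = 0
      · simp [h0]
      · rw [h₁] at h0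
        obtain ⟨k, rfl⟩ := Nat.exists_eq_succ_of_ne_zero h0
        refine Submodule.smul_mem _ _ (kVec_mem_indexSpan hn ?_
          (pderiv_mem_harmonicPolynomials hh j) (hS.down ε hε m l k hmem (by simpa using hm)))
        unfold Int.ModEq at hm ⊢
        simp only [Nat.succ_eq_add_one, add_tsub_cancel_right]
        omega
    · by_cases h0 : c₂ = 0
      · simp [h0]
      · rw [h₂] at h0
        push Not at h0
        obtain ⟨k, rfl⟩ := Nat.exists_eq_succ_of_ne_zero h0.1
        refine Submodule.smul_mem _ _ (kVec_mem_indexSpan hn ?_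
          (pderiv_mem_harmonicPolynomials hh j)
          (hS.shift ε hε m l k hmem (by simpa using hm) h0.2.1 (by simpa using h0.2.2)))
        unfold Int.ModEq at hm ⊢
        simp only [Nat.succ_eq_add_one, add_tsub_cancel_right]
        omega
    · by_cases h0 : c₃ = 0
      · simp [h0]
      · rw [h₃] at h0
        obtain ⟨l, rfl⟩ := Nat.exists_eq_succ_of_ne_zero h0
        exact Submodule.smul_mem _ _ (kVec_mem_indexSpan hn hmu hQ (hS.unshift ε hε m l k hmem hm))
    · by_cases h0 : c₄ = 0
      · simp [h0]
      · rw [h₄] at h0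
        exact Submodule.smul_mem _ _ (kVec_mem_indexSpan hn hmu hQ (hS.up ε hε m l k hmem hm h0))
  · rw [lieOp_soElement_kVec hn hm hh]
    exact kVec_mem_indexSpan hn hm (rotationDerivation_mem_harmonicPolynomials (so_transpose A) hh)
      hmem

end IndexSets

/-! ### Connecting all vectors of a region -/

section Connectivity
open MvPolynomial

variable {n : ℕ} {q : ℤ} {s : ℂ} {U : Submodule ℂ (compactPicture n q s)}

/-- Separates the four terms of a ladder operator. The alternative in the last hypothesis is for l =
0, where truncated subtraction makes the third and fourth indices equal while the third term is
zero. -/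
theorem mem_of_four_add_mem (hn : 1 ≤ n) (hU : IsGSubmodule U) {t₁ t₂ t₃ t₄ : ℤ × ℕ × ℕ}
    {F₁ F₂ F₃ F₄ : compactPicture n q s} (h₁ : F₁ ∈ weightSpace n q s t₁)
    (h₂ : F₂ ∈ weightSpace n q s t₂) (h₃ : F₃ ∈ weightSpace n q s t₃)
    (h₄ : F₄ ∈ weightSpace n q s t₄) (hsum : F₁ + F₂ + F₃ + F₄ ∈ U)
    (h12 : t₁ ≠ t₂) (h13 : t₁ ≠ t₃) (h14 : t₁ ≠ t₄) (h23 : t₂ ≠ t₃) (h24 : t₂ ≠ t₄)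
    (h34 : t₃ ≠ t₄ ∨ F₃ = 0) : F₁ ∈ U ∧ F₂ ∈ U ∧ F₃ ∈ U ∧ F₄ ∈ U := by
  classical
  set f : ℤ × ℕ × ℕ →₀ compactPicture n q s := Finsupp.single t₁ F₁ + Finsupp.single t₂ F₂
    + Finsupp.single t₃ F₃ + Finsupp.single t₄ F₄ with hf
  have hsingle : ∀ (t t' : ℤ × ℕ × ℕ) (F : compactPicture n q s), F ∈ weightSpace n q s t →
      Finsupp.single t F t' ∈ weightSpace n q s t' := by
    intro t t' F hF
    rcases eq_or_ne t t' with rfl | hne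
    · simpa using hF
    · rw [Finsupp.single_eq_of_ne (Ne.symm hne)]
      exact Submodule.zero_mem _
  have key := component_mem hn hU f
    (fun t => Submodule.add_mem _ (Submodule.add_mem _ (Submodule.add_mem _ (hsingle _ _ _ h₁)
      (hsingle _ _ _ h₂)) (hsingle _ _ _ h₃)) (hsingle _ _ _ h₄))
    (by
      rw [hf, Finsupp.sum_add_index', Finsupp.sum_add_index', Finsupp.sum_add_index']
      · simpa using hsum
      all_goals simp)
  have k₁ := key t₁
  have k₂ := key t₂
  have k₃ := key t₃
  have k₄ := key t₄
  simp only [hf, Finsupp.add_apply, Finsupp.single_apply, h12, h13, h14, h23, h24, h12.symm,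
    h13.symm, h14.symm, h23.symm, h24.symm, if_true, if_false, zero_add, add_zero] at k₁ k₂ k₃ k₄
  rcases h34 with h34 | h0
  · simp only [h34, h34.symm, if_false, zero_add, add_zero] at k₃ k₄
    exact ⟨k₁, k₂, k₃, k₄⟩
  · simp only [h0, ite_self, zero_add] at k₄
    exact ⟨k₁, k₂, by rw [h0]; exact U.zero_mem, k₄⟩

theorem ladder_components (hn : 1 ≤ n) (hs : s ≠ 0) (hU : IsGSubmodule U) {ε : ℤ}
    (hε : ε = 1 ∨ ε = -1) {m : ℤ} {l k : ℕ} {h : MvPolynomial (Fin n) ℂ}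
    (hm : m ≡ 2 * k + q [ZMOD 4]) (hh : h ∈ harmonicPolynomials n k)
    (hF : kVec n q s m l k h ∈ U) (j : Fin n) :
    (k ≠ 0 → kVec n q s (m + 2 * ε) l (k - 1) (pderiv j h) ∈ U) ∧
    (k ≠ 0 → l ≠ 0 → 4 * l + 2 * k + n + ε * m ≠ 0 →
      kVec n q s (m + 2 * ε) (l + 1) (k - 1) (pderiv j h) ∈ U) ∧
    (l ≠ 0 → kVec n q s (m + 2 * ε) (l - 1) (k + 1) (harmonicMul k j h) ∈ U) ∧
    (4 * l + 2 * k + n + ε * m ≠ 0 →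
      kVec n q s (m + 2 * ε) l (k + 1) (harmonicMul k j h) ∈ U) := by
  obtain ⟨c₁, c₂, c₃, c₄, heq, h₁, h₂, h₃, h₄⟩ := ladderOp_kVec (l := l) hn hs hε hm hh j
  have hmem := hU.ladderOp_mem ε j hF
  rw [heq] at hmem
  have hQ := harmonicMul_mem_harmonicPolynomials hn hh j
  have hmu : m + 2 * ε ≡ 2 * (k + 1 : ℕ) + q [ZMOD 4] := by
    unfold Int.ModEq at hm ⊢
    omega
  have hwQ : ∀ l', kVec n q s (m + 2 * ε) l' (k + 1) (harmonicMul k j h) ∈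
      weightSpace n q s (m + 2 * ε, l', k + 1) := fun l' =>
    (mem_weightSpace hn (t := (m + 2 * ε, l', k + 1)) hmu).2 ⟨_, hQ, rfl⟩
  have hwD : ∀ l', k ≠ 0 → kVec n q s (m + 2 * ε) l' (k - 1) (pderiv j h) ∈
      weightSpace n q s (m + 2 * ε, l', k - 1) := by
    intro l' hk
    refine (mem_weightSpace hn (t := (m + 2 * ε, l', k - 1)) ?_).2
      ⟨_, pderiv_mem_harmonicPolynomials_sub_one hh j, rfl⟩
    unfold Int.ModEq at hm ⊢
    simp only
    omega
  obtain ⟨m₁, m₂, m₃, m₄⟩ := mem_of_four_add_mem hn hU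
    (t₁ := (m + 2 * ε, l, k - 1)) (t₂ := (m + 2 * ε, l + 1, k - 1))
    (t₃ := (m + 2 * ε, l - 1, k + 1)) (t₄ := (m + 2 * ε, l, k + 1))
    (by
      by_cases h0 : c₁ = 0
      · simp [h0]
      · exact Submodule.smul_mem _ _ (hwD _ (fun hk => h0 (h₁.2 hk))))
    (by
      by_cases h0 : c₂ = 0
      · simp [h0]
      · exact Submodule.smul_mem _ _ (hwD _ (fun hk => h0 (h₂.2 (Or.inl hk)))))
    (Submodule.smul_mem _ _ (hwQ _)) (Submodule.smul_mem _ _ (hwQ _)) hmem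
    (by simp) (by simp) (by simp) (by simp) (by simp)
    (by
      by_cases h0 : l = 0
      · right
        rw [h₃.2 h0, zero_smul]
      · left
        simp
        omega)
  refine ⟨fun hk => (U.smul_mem_iff ?_).1 m₁, fun hk hl hβ => (U.smul_mem_iff ?_).1 m₂,
    fun hl => (U.smul_mem_iff ?_).1 m₃, fun hβ => (U.smul_mem_iff ?_).1 m₄⟩
  · rwa [Ne, h₁]
  · rw [Ne, h₂]
    tauto
  · rwa [Ne, h₃]
  · rwa [Ne, h₄]

theorem slOp_component (hn : 1 ≤ n) (hU : IsGSubmodule U) {ε : ℤ}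
    (hε : ε = 1 ∨ ε = -1) {m : ℤ} {l k : ℕ} {h : MvPolynomial (Fin n) ℂ}
    (hm : m ≡ 2 * k + q [ZMOD 4]) (hh : h ∈ harmonicPolynomials n k)
    (hF : kVec n q s m l k h ∈ U) (h0 : 4 * l + 2 * k + n + ε * m ≠ 0) :
    kVec n q s (m + 4 * ε) l k h ∈ U := by
  have hmem := hU.slOp_mem ε hF
  rw [slOp_kVec hn hε hm hh] at hmem
  refine (U.smul_mem_iff ?_).1 hmem
  refine div_ne_zero (neg_ne_zero.2 ?_) two_ne_zero
  exact_mod_cast h0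

/-- A region of weights `m`, depending on `β = 4 l + 2 k + n`, whose indices are connected by
transitions with non-zero coefficients. -/
structure IsRegion (n : ℕ) (q : ℤ) (R : ℤ → ℤ → Prop) : Prop where
  convex : ∀ β m x m' : ℤ, R β m → R β m' → m ≤ x → x ≤ m' → R β x
  step : ∀ β m : ℤ, 0 < β → β ≡ n [ZMOD 2] → m ≡ β + q - n [ZMOD 4] → R β m → R β (m + 4) →
    β + m ≠ 0 ∧ β - (m + 4) ≠ 0
  up : ∀ β m : ℤ, 0 < β → β ≡ n [ZMOD 2] → m ≡ β + q - n [ZMOD 4] → R β m →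
    ∃ ε : ℤ, (ε = 1 ∨ ε = -1) ∧ R (β + 2) (m + 2 * ε) ∧ β + ε * m ≠ 0

/-- `(m, l, k)` is the index of a vector in the region `R`. -/
def Admissible (n : ℕ) (q : ℤ) (R : ℤ → ℤ → Prop) (m : ℤ) (l k : ℕ) : Prop :=
  m ≡ 2 * k + q [ZMOD 4] ∧ R (4 * l + 2 * k + n) m

/-- All vectors of the region `R` with indices `l`, `k` are in `U`. -/
def Full (U : Submodule ℂ (compactPicture n q s)) (R : ℤ → ℤ → Prop) (l k : ℕ) : Prop :=
  ∀ m, Admissible n q R m l k → ∀ h ∈ harmonicPolynomials n k, kVec n q s m l k h ∈ U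

variable {R : ℤ → ℤ → Prop}

/-- A region sees l and k only through β = 4l + 2k + n, so the moves to (l, k+1) and to (l+1, k-1),
which both raise β by 2, are handled together. -/
theorem IsRegion.exists_up (hR : IsRegion n q R) (hn : 1 ≤ n) {m : ℤ} {l k l' k' : ℕ}
    (hm : Admissible n q R m l k) (hβ : 2 * l' + k' = 2 * l + k + 1) :
    ∃ ε : ℤ, (ε = 1 ∨ ε = -1) ∧ Admissible n q R (m + 2 * ε) l' k' ∧
      4 * l + 2 * k + n + ε * m ≠ 0 := by
  obtain ⟨hmod, hRm⟩ := hm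
  obtain ⟨ε, hε, h1, h2⟩ := hR.up (4 * l + 2 * k + n) m (by omega)
    (by unfold Int.ModEq; omega) (by unfold Int.ModEq at hmod ⊢; omega) hRm
  refine ⟨ε, hε, ⟨?_, ?_⟩, h2⟩
  · unfold Int.ModEq at hmod ⊢
    omega
  · have : (4 * l' + 2 * k' + n : ℤ) = 4 * l + 2 * k + n + 2 := by omega
    rwa [this]

theorem IsRegion.exists_admissible (hR : IsRegion n q R) (hn : 1 ≤ n) {l k l' k' d : ℕ}
    (hex : ∃ m, Admissible n q R m l k) (hd : 2 * l' + k' = 2 * l + k + d) :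
    ∃ m, Admissible n q R m l' k' := by
  induction d generalizing l k with
  | zero =>
    obtain ⟨m, hmod, hm⟩ := hex
    refine ⟨m, ?_, ?_⟩
    · unfold Int.ModEq at hmod ⊢
      omega
    · have : (4 * l' + 2 * k' + n : ℤ) = 4 * l + 2 * k + n := by omega
      rwa [this]
  | succ d ih =>
    obtain ⟨m, hm⟩ := hex
    obtain ⟨ε, -, h, -⟩ := hR.exists_up hn (l' := l) (k' := k + 1) hm (by omega)
    exact ih ⟨_, h⟩ (by omega)

/-- Convexity keeps the intermediate weights in the region, where both the raising and the lowering
coefficient of each step of length 4 are non-zero. -/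
theorem transport_up (hn : 1 ≤ n) (hU : IsGSubmodule U) (hR : IsRegion n q R) {l k : ℕ}
    {h : MvPolynomial (Fin n) ℂ} (hh : h ∈ harmonicPolynomials n k) (c : ℕ) {m : ℤ}
    (hm : Admissible n q R m l k) (hm' : Admissible n q R (m + 4 * c) l k) :
    kVec n q s m l k h ∈ U ↔ kVec n q s (m + 4 * c) l k h ∈ U := by
  induction c with
  | zero => simp
  | succ c ih =>
    have hx : Admissible n q R (m + 4 * c) l k := by
      refine ⟨?_, hR.convex _ _ _ _ hm.2 hm'.2 (by omega) (by push_cast; omega)⟩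
      have := hm.1
      unfold Int.ModEq at this ⊢
      omega
    have e : m + 4 * ((c + 1 : ℕ) : ℤ) = m + 4 * c + 4 := by push_cast; ring
    rw [ih hx]
    rw [e] at hm' ⊢
    obtain ⟨h1, h2⟩ := hR.step (4 * l + 2 * k + n) (m + 4 * c) (by omega)
      (by unfold Int.ModEq; omega)
      (by have := hx.1; unfold Int.ModEq at this ⊢; omega) hx.2 hm'.2
    constructor
    · intro hF
      have := slOp_component hn hU (Or.inl rfl) hx.1 hh hF (by rwa [one_mul])
      rwa [mul_one] at this
    · intro hF
      have := slOp_component hn hU (Or.inr rfl) hm'.1 hh hF (by intro h0; apply h2; linarith)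
      rwa [show m + 4 * (c : ℤ) + 4 + 4 * (-1) = m + 4 * c by ring] at this

theorem transport (hn : 1 ≤ n) (hU : IsGSubmodule U) (hR : IsRegion n q R) {l k : ℕ}
    {h : MvPolynomial (Fin n) ℂ} (hh : h ∈ harmonicPolynomials n k) {m m' : ℤ}
    (hm : Admissible n q R m l k) (hm' : Admissible n q R m' l k)
    (hF : kVec n q s m l k h ∈ U) : kVec n q s m' l k h ∈ U := by
  have hdvd := (hm.1.trans hm'.1.symm).dvd
  obtain ⟨c, hc⟩ := hdvd
  rcases le_total 0 c with h0 | h0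
  · lift c to ℕ using h0
    obtain rfl : m' = m + 4 * c := by linarith
    exact (transport_up hn hU hR hh c hm hm').1 hF
  · obtain ⟨c, rfl⟩ : ∃ d : ℕ, c = -d := ⟨(-c).toNat, by omega⟩
    obtain rfl : m = m' + 4 * c := by linarith
    exact (transport_up hn hU hR hh c hm' hm).2 hF

/-- The space 𝓗_0 consists of constants, so a single non-zero vector determines everything at k = 0.
-/
theorem full_zero_of_mem (hn : 1 ≤ n) (hU : IsGSubmodule U) (hR : IsRegion n q R) {l : ℕ}
    {h : MvPolynomial (Fin n) ℂ} (hh : h ∈ harmonicPolynomials n 0) (h0 : h ≠ 0) {m : ℤ}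
    (hm : Admissible n q R m l 0) (hF : kVec n q s m l 0 h ∈ U) : Full U R l 0 := by
  intro m' hm' g hg
  obtain ⟨c, rfl⟩ := eq_C_of_mem_harmonicPolynomials_zero hh
  obtain ⟨d, rfl⟩ := eq_C_of_mem_harmonicPolynomials_zero hg
  have hc : c ≠ 0 := fun hc => h0 (by rw [hc, map_zero])
  have e : (C d : MvPolynomial (Fin n) ℂ) = (d / c) • C c := by
    rw [smul_eq_C_mul, ← C_mul, div_mul_cancel₀ _ hc]
  rw [e, kVec_smul hn hm'.1 hh]
  exact U.smul_mem _ (transport hn hU hR hh hm hm' hF)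

/-- The term at (l, k+1) of the j-th ladder operator, applied to the vector of ∂_j g, gives the
harmonic part of y_j ∂_j g. The sum over j is (k + 1) g by `sum_harmonicMul_pderiv`. -/
theorem full_succ (hn : 1 ≤ n) (hs : s ≠ 0) (hU : IsGSubmodule U) (hR : IsRegion n q R) {l k : ℕ}
    (hfull : Full U R l k) (hex : ∃ m, Admissible n q R m l k) : Full U R l (k + 1) := by
  obtain ⟨m, hm⟩ := hex
  obtain ⟨ε, hε, hm₁, hne⟩ := hR.exists_up hn (l' := l) (k' := k + 1) hm (by omega)
  intro m' hm' g hg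
  refine transport hn hU hR hg hm₁ hm' ?_
  have hsum : kVec n q s (m + 2 * ε) l (k + 1) (∑ j, harmonicMul k j (pderiv j g)) ∈ U := by
    rw [kVec_sum hn hm₁.1 _ fun j _ =>
      harmonicMul_mem_harmonicPolynomials hn (pderiv_mem_harmonicPolynomials hg j) j]
    refine U.sum_mem fun j _ => ?_
    have hj := pderiv_mem_harmonicPolynomials hg j
    exact (ladder_components hn hs hU hε hm.1 hj (hfull m hm _ hj) j).2.2.2 hne
  rw [sum_harmonicMul_pderiv hg, C_mul', kVec_smul hn hm₁.1 hg] at hsum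
  refine (U.smul_mem_iff ?_).1 hsum
  exact_mod_cast Nat.succ_ne_zero k

theorem full_of_le (hn : 1 ≤ n) (hs : s ≠ 0) (hU : IsGSubmodule U) (hR : IsRegion n q R)
    {l k₀ : ℕ} (hfull : Full U R l k₀) (hex : ∃ m, Admissible n q R m l k₀) {k : ℕ}
    (hk : k₀ ≤ k) : Full U R l k := by
  induction k, hk using Nat.le_induction with
  | base => exact hfull
  | succ k hk ih =>
    exact full_succ hn hs hU hR ih (hR.exists_admissible hn hex (d := k - k₀) (by omega))

/-- The coefficient of the term at (l, k-1) never vanishes for k ≥ 1, and some derivative of a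
non-constant homogeneous polynomial is non-zero. Only the weight must be adjusted so that the
descent stays in the region. -/
theorem exists_descend (hn : 1 ≤ n) (hs : s ≠ 0) (hU : IsGSubmodule U) (hR : IsRegion n q R)
    {l k₀ : ℕ} (hex : ∃ m, Admissible n q R m l k₀) {k : ℕ} (hk : k₀ ≤ k) {m : ℤ}
    {h : MvPolynomial (Fin n) ℂ} (hh : h ∈ harmonicPolynomials n k) (h0 : h ≠ 0)
    (hm : Admissible n q R m l k) (hF : kVec n q s m l k h ∈ U) :
    ∃ m' g, g ∈ harmonicPolynomials n k₀ ∧ g ≠ 0 ∧ Admissible n q R m' l k₀ ∧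
      kVec n q s m' l k₀ g ∈ U := by
  induction k, hk using Nat.le_induction generalizing m h with
  | base => exact ⟨m, h, hh, h0, hm, hF⟩
  | succ k hk ih =>
    obtain ⟨m₀, hm₀⟩ := hR.exists_admissible hn (l' := l) (k' := k) hex (d := k - k₀) (by omega)
    obtain ⟨ε, hε, hm₁, -⟩ := hR.exists_up hn (l' := l) (k' := k + 1) hm₀ (by omega)
    obtain ⟨j, hj⟩ := exists_pderiv_ne_zero hh h0
    have hF₁ := transport hn hU hR hh hm hm₁ hF
    -- The weight m₀ + 2ε was chosen by an upward move from m₀, so the opposite sign returns to the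
    -- admissible weight m₀.
    have hF₂ := (ladder_components hn hs hU (ε := -ε) (by omega) hm₁.1 hh hF₁ j).1
      (Nat.succ_ne_zero k)
    rw [show m₀ + 2 * ε + 2 * -ε = m₀ by ring, add_tsub_cancel_right] at hF₂
    exact ih (pderiv_mem_harmonicPolynomials hh j) hj hm₀ hF₂

theorem full_of_mem (hn : 1 ≤ n) (hs : s ≠ 0) (hU : IsGSubmodule U) (hR : IsRegion n q R)
    {l : ℕ} (hex : ∃ m, Admissible n q R m l 0) {k : ℕ} {m : ℤ}
    {h : MvPolynomial (Fin n) ℂ} (hh : h ∈ harmonicPolynomials n k) (h0 : h ≠ 0)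
    (hm : Admissible n q R m l k) (hF : kVec n q s m l k h ∈ U) (k' : ℕ) : Full U R l k' := by
  obtain ⟨m', g, hg, hg0, hm', hF'⟩ := exists_descend hn hs hU hR hex (Nat.zero_le k) hh h0 hm hF
  exact full_of_le hn hs hU hR (full_zero_of_mem hn hU hR hg hg0 hm' hF') hex (Nat.zero_le k')

/-- A coordinate function at (l, 1) has derivative 1 at (l+1, 0). This needs l ≠ 0, since the
coefficient contains l. -/
theorem full_shift (hn : 1 ≤ n) (hs : s ≠ 0) (hU : IsGSubmodule U) (hR : IsRegion n q R)
    {l : ℕ} (hl : l ≠ 0) (hfull : Full U R l 1) (hex : ∃ m, Admissible n q R m l 1) (k : ℕ) :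
    Full U R (l + 1) k := by
  obtain ⟨m, hm⟩ := hex
  obtain ⟨ε, hε, hm₁, hne⟩ := hR.exists_up hn (l' := l + 1) (k' := 0) hm (by omega)
  have hX := X_mem_harmonicPolynomials (⟨0, hn⟩ : Fin n)
  have hF := (ladder_components hn hs hU hε hm.1 hX (hfull m hm _ hX) ⟨0, hn⟩).2.1 one_ne_zero hl
    hne
  rw [pderiv_X_self] at hF
  exact full_of_mem hn hs hU hR ⟨_, hm₁⟩ one_mem_harmonicPolynomials one_ne_zero hm₁ hF k

/-- The reverse move sends the constant 1 at (l+1, 0) to a coordinate function at (l, 1). Its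
coefficient never vanishes, so l = 0 is also reached. -/
theorem exists_unshift (hn : 1 ≤ n) (hs : s ≠ 0) (hU : IsGSubmodule U) (hR : IsRegion n q R)
    {l : ℕ} (hfull : Full U R (l + 1) 0) (hex : ∃ m, Admissible n q R m l 1) :
    ∃ m g, g ∈ harmonicPolynomials n 1 ∧ g ≠ 0 ∧ Admissible n q R m l 1 ∧
      kVec n q s m l 1 g ∈ U := by
  obtain ⟨m, hm⟩ := hex
  obtain ⟨ε, hε, hm₁, -⟩ := hR.exists_up hn (l' := l + 1) (k' := 0) hm (by omega)
  have h1 := one_mem_harmonicPolynomials (n := n)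
  have hF := (ladder_components hn hs hU (ε := -ε) (by omega) hm₁.1 h1 (hfull _ hm₁ _ h1)
    ⟨0, hn⟩).2.2.1 (Nat.succ_ne_zero l)
  rw [show m + 2 * ε + 2 * -ε = m by ring, add_tsub_cancel_right, zero_add] at hF
  have e : harmonicMul 0 (⟨0, hn⟩ : Fin n) (1 : MvPolynomial (Fin n) ℂ) = X ⟨0, hn⟩ := by
    simp [harmonicMul]
  rw [e] at hF
  exact ⟨m, _, X_mem_harmonicPolynomials _, X_ne_zero _, hm, hF⟩

/-- One lowers l to 1, filling all k at each stage, and then raises it to any l' ≥ 1. -/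
theorem full_of_mem_of_pos (hn : 1 ≤ n) (hs : s ≠ 0) (hU : IsGSubmodule U) (hR : IsRegion n q R)
    (hex : ∃ m, Admissible n q R m 1 0) {l k : ℕ} (hl : 1 ≤ l) {m : ℤ}
    {h : MvPolynomial (Fin n) ℂ} (hh : h ∈ harmonicPolynomials n k) (h0 : h ≠ 0)
    (hm : Admissible n q R m l k) (hF : kVec n q s m l k h ∈ U) {l' : ℕ} (hl' : 1 ≤ l') (k' : ℕ) :
    Full U R l' k' := by
  have hadm : ∀ l k : ℕ, 1 ≤ l → ∃ m, Admissible n q R m l k := fun l k hl =>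
    hR.exists_admissible hn hex (d := 2 * (l - 1) + k) (by omega)
  have hone : ∀ k', Full U R 1 k' := by
    have hdown : ∀ l, 1 ≤ l → (∀ k', Full U R l k') → ∀ k', Full U R 1 k' := by
      intro l hl
      induction l, hl using Nat.le_induction with
      | base => exact id
      | succ l hl ih =>
        intro hf
        obtain ⟨m', g, hg, hg0, hm', hF'⟩ := exists_unshift hn hs hU hR (hf 0) (hadm l 1 hl)
        exact ih (full_of_mem hn hs hU hR (hadm l 0 hl) hg hg0 hm' hF')
    exact hdown l hl (full_of_mem hn hs hU hR (hadm l 0 hl) hh h0 hm hF)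
  induction l', hl' using Nat.le_induction generalizing k' with
  | base => exact hone k'
  | succ l hl ih => exact full_shift hn hs hU hR (by omega) (ih 1) (hadm l 1 hl) k'

end Connectivity

/-! ### The action of O(n) and the linear harmonic polynomials -/

section OrthogonalGroup
open MvPolynomial

variable {n : ℕ} {q : ℤ} {s : ℂ}

/-- The polynomial `y ↦ h (g y)`. -/
noncomputable def linearSubst (g : Matrix (Fin n) (Fin n) ℝ) :
    MvPolynomial (Fin n) ℂ →ₐ[ℂ] MvPolynomial (Fin n) ℂ :=
  aeval fun i => ∑ j, C (g i j : ℂ) * X j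

theorem linearSubst_X (g : Matrix (Fin n) (Fin n) ℝ) (i : Fin n) :
    linearSubst g (X i) = ∑ j, C (g i j : ℂ) * X j := aeval_X _ _

theorem eval_linearSubst (g : Matrix (Fin n) (Fin n) ℝ) (y : Fin n → ℝ)
    (h : MvPolynomial (Fin n) ℂ) :
    eval (fun j => (y j : ℂ)) (linearSubst g h) = eval (fun j => ((g *ᵥ y) j : ℂ)) h := by
  induction h using MvPolynomial.induction_on with
  | C a => simp [linearSubst]
  | add p r hp hr => simp only [map_add, hp, hr]
  | mul_X p i hp =>
    simp only [map_mul, hp, linearSubst_X, map_sum, eval_C, eval_X, Matrix.mulVec, dotProduct,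
      Complex.ofReal_sum, Complex.ofReal_mul]

theorem pderiv_linearSubst (g : Matrix (Fin n) (Fin n) ℝ) (j : Fin n)
    (h : MvPolynomial (Fin n) ℂ) :
    pderiv j (linearSubst g h) = ∑ i, C (g i j : ℂ) * linearSubst g (pderiv i h) := by
  induction h using MvPolynomial.induction_on with
  | C a => simp [linearSubst]
  | add p r hp hr => simp only [map_add, hp, hr, mul_add, Finset.sum_add_distrib]
  | mul_X p i hp =>
    have e : pderiv j (∑ x, C (g i x : ℂ) * X x) = C (g i j : ℂ) := by
      rw [map_sum, Finset.sum_eq_single j]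
      · simp
      · intro x _ hx
        simp [pderiv_X_of_ne hx]
      · simp
    simp only [map_mul, pderiv_mul, map_add, mul_add, Finset.sum_add_distrib, hp, linearSubst_X, e]
    congr 1
    · rw [Finset.sum_mul]
      exact Finset.sum_congr rfl fun x _ => by ring
    · rw [Finset.sum_eq_single i]
      · simp
        ring
      · intro x _ hx
        simp [pderiv_X_of_ne (Ne.symm hx)]
      · simp

/-- By the chain rule the second derivatives are contracted with g gᵀ = 1. -/
theorem polyLaplacian_linearSubst {g : Matrix (Fin n) (Fin n) ℝ} (hg : g * gᵀ = 1)
    (h : MvPolynomial (Fin n) ℂ) :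
    polyLaplacian (linearSubst g h) = linearSubst g (polyLaplacian h) := by
  have hg' : ∀ i i', ∑ j, (C (g i j : ℂ) * C (g i' j : ℂ) : MvPolynomial (Fin n) ℂ) =
      if i = i' then 1 else 0 := by
    intro i i'
    have := congrFun (congrFun hg i) i'
    rw [Matrix.mul_apply, Matrix.one_apply] at this
    simp only [Matrix.transpose_apply] at this
    simp only [← C_mul, ← Complex.ofReal_mul, ← map_sum, ← Complex.ofReal_sum, this]
    split_ifs <;> simp
  simp only [polyLaplacian, pderiv_linearSubst, map_sum, pderiv_C_mul, Finset.mul_sum]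
  calc
    _ = ∑ i, ∑ i', ∑ j, C (g i j : ℂ) * C (g i' j : ℂ) *
        linearSubst g (pderiv i' (pderiv i h)) := by
      rw [Finset.sum_comm]
      refine Finset.sum_congr rfl fun i _ => ?_
      rw [Finset.sum_comm]
      exact Finset.sum_congr rfl fun i' _ => Finset.sum_congr rfl fun j _ => by ring
    _ = _ := by
      simp only [← Finset.sum_mul, hg']
      simp

theorem linearSubst_mem_harmonicPolynomials {g : Matrix (Fin n) (Fin n) ℝ} (hg : g * gᵀ = 1)
    {k : ℕ} {h : MvPolynomial (Fin n) ℂ} (hh : h ∈ harmonicPolynomials n k) :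
    linearSubst g h ∈ harmonicPolynomials n k := by
  rw [mem_harmonicPolynomials] at hh ⊢
  refine ⟨?_, by rw [polyLaplacian_linearSubst hg, hh.2, map_zero]⟩
  have := hh.1.aeval (fun i => ∑ j, C (g i j : ℂ) * X j) (n := 1)
    (fun i => IsHomogeneous.sum _ _ _ fun j _ => isHomogeneous_C_mul_X _ _)
  rwa [one_mul] at this

theorem orthogonalGroup_mul_transpose (u : Matrix.orthogonalGroup (Fin n) ℝ) :
    u.1 * u.1ᵀ = 1 := by
  have := (Matrix.mem_orthogonalGroup_iff (Fin n) ℝ).1 u.2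
  simpa [Matrix.star_eq_conjTranspose, Matrix.conjTranspose_eq_transpose_of_trivial] using this

theorem orthogonalGroup_transpose_mul (u : Matrix.orthogonalGroup (Fin n) ℝ) :
    u.1ᵀ * u.1 = 1 := by
  have := (Matrix.mem_orthogonalGroup_iff' (Fin n) ℝ).1 u.2
  simpa [Matrix.star_eq_conjTranspose, Matrix.conjTranspose_eq_transpose_of_trivial] using this

theorem rotate_kVec (hn : 1 ≤ n) {m : ℤ} {l k : ℕ} {h : MvPolynomial (Fin n) ℂ}
    (hm : m ≡ 2 * k + q [ZMOD 4]) (hh : h ∈ harmonicPolynomials n k)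
    (u : Matrix.orthogonalGroup (Fin n) ℝ) :
    rotate u (kVec n q s m l k h) = kVec n q s m l k (linearSubst (u⁻¹).1 h) := by
  apply Subtype.ext
  funext p
  change (kVec n q s m l k h).1 (p.1, (u⁻¹).1 *ᵥ p.2) = _
  rw [coe_kVec hn hm hh, coe_kVec hn hm
    (linearSubst_mem_harmonicPolynomials (orthogonalGroup_mul_transpose u⁻¹) hh)]
  have e : ((u⁻¹).1 *ᵥ p.2) ⬝ᵥ ((u⁻¹).1 *ᵥ p.2) = p.2 ⬝ᵥ p.2 := by
    rw [Matrix.dotProduct_mulVec, Matrix.vecMul_mulVec, orthogonalGroup_transpose_mul,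
      Matrix.vecMul_one]
  simp only [kFiniteVector, e, eval_linearSubst]

/-- The action of an element of `O(n)` as a linear map. -/
def rotateLinear (u : Matrix.orthogonalGroup (Fin n) ℝ) :
    compactPicture n q s →ₗ[ℂ] compactPicture n q s where
  toFun := rotate u
  map_add' _ _ := rfl
  map_smul' _ _ := rfl

theorem rotate_mem_indexSpan (hn : 1 ≤ n) (S : Set (ℤ × ℕ × ℕ))
    (u : Matrix.orthogonalGroup (Fin n) ℝ) {F : compactPicture n q s}
    (hF : F ∈ indexSpan n q s S) : rotate u F ∈ indexSpan n q s S := by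
  suffices h : indexSpan n q s S ≤ (indexSpan n q s S).comap (rotateLinear u) from h hF
  refine indexSpan_le hn fun m l k hmem hm h hh => ?_
  change rotate u (kVec n q s m l k h) ∈ indexSpan n q s S
  rw [rotate_kVec hn hm hh]
  exact kVec_mem_indexSpan hn hm
    (linearSubst_mem_harmonicPolynomials (orthogonalGroup_mul_transpose u⁻¹) hh) hmem

theorem isGOSubmodule_indexSpan (hn : 1 ≤ n) (hs : s ≠ 0) {S : Set (ℤ × ℕ × ℕ)}
    (hS : IsStableSet n q S) : IsGOSubmodule (indexSpan n q s S) :=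
  ⟨isGSubmodule_indexSpan hn hs hS, fun u _ hF => rotate_mem_indexSpan hn S u hF⟩

/-- The reflection in the `i`-th coordinate. -/
def coordReflection (i : Fin n) : Matrix.orthogonalGroup (Fin n) ℝ :=
  ⟨Matrix.diagonal fun j => if j = i then -1 else 1, by
    rw [Matrix.mem_orthogonalGroup_iff, Matrix.diagonal_transpose,
      Matrix.diagonal_mul_diagonal, ← Matrix.diagonal_one]
    congr 1
    funext j
    simp
    split_ifs <;> simp⟩

/-- The permutation matrix of `σ`. -/
def coordPerm (σ : Equiv.Perm (Fin n)) : Matrix.orthogonalGroup (Fin n) ℝ :=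
  ⟨σ.permMatrix ℝ, by
    rw [Matrix.mem_orthogonalGroup_iff, Matrix.transpose_permMatrix, ← Matrix.permMatrix_mul]
    simp⟩

theorem linearSubst_coordReflection (i : Fin n) {h : MvPolynomial (Fin n) ℂ}
    (hh : h.IsHomogeneous 1) :
    linearSubst (coordReflection i).1 h = h - (2 : ℂ) • (X i * pderiv i h) := by
  rw [← mem_homogeneousSubmodule, homogeneousSubmodule_one_eq_span_X] at hh
  induction hh using Submodule.span_induction with
  | mem x hx =>
    obtain ⟨j, rfl⟩ := hx
    rw [linearSubst_X, Finset.sum_eq_single j]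
    · by_cases hj : j = i
      · subst hj
        simp only [coordReflection, Matrix.diagonal_apply_eq, if_true, pderiv_X_self, mul_one]
        simp only [Complex.ofReal_neg, Complex.ofReal_one, map_neg, map_one, two_smul]
        ring
      · simp [coordReflection, hj, pderiv_X_of_ne hj]
    · intro x _ hx
      simp [coordReflection, Matrix.diagonal_apply_ne _ (Ne.symm hx)]
    · simp
  | zero => simp
  | add x y hx hy ihx ihy =>
    rw [map_add, ihx, ihy, map_add, mul_add, smul_add]
    abel
  | smul a x hx ihx =>
    rw [map_smul, ihx, Derivation.map_smul, smul_sub, mul_smul_comm, smul_comm a]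

theorem linearSubst_coordPerm (σ : Equiv.Perm (Fin n)) (i : Fin n) :
    linearSubst (coordPerm σ).1 (X i) = X (σ i) := by
  rw [linearSubst_X, Finset.sum_eq_single (σ i)]
  · simp [coordPerm, Equiv.Perm.permMatrix, PEquiv.toMatrix_apply]
  · intro x _ hx
    simp [coordPerm, Equiv.Perm.permMatrix, PEquiv.toMatrix_apply, Ne.symm hx]
  · simp

/-- Irreducibility of 𝓗_1 under O(n): subtracting from a linear form its reflection in a coordinate
that occurs in it leaves a multiple of that coordinate, and transpositions then give all the others.
The reflections have determinant -1, which is why stability under 𝔤 alone does not suffice. -/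
theorem full_one_of_mem (hn : 1 ≤ n) {U : Submodule ℂ (compactPicture n q s)}
    (hU : IsGOSubmodule U) {R : ℤ → ℤ → Prop} (hR : IsRegion n q R) {l : ℕ}
    {h : MvPolynomial (Fin n) ℂ} (hh : h ∈ harmonicPolynomials n 1) (h0 : h ≠ 0) {m : ℤ}
    (hm : Admissible n q R m l 1) (hF : kVec n q s m l 1 h ∈ U) : Full U R l 1 := by
  have hrot : ∀ (g : Matrix.orthogonalGroup (Fin n) ℝ) (p : MvPolynomial (Fin n) ℂ),
      p ∈ harmonicPolynomials n 1 → kVec n q s m l 1 p ∈ U →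
      kVec n q s m l 1 (linearSubst g.1 p) ∈ U := by
    intro g p hp hpU
    have := hU.2 g⁻¹ _ hpU
    rwa [rotate_kVec hn hm.1 hp, inv_inv] at this
  obtain ⟨i, hi⟩ := exists_pderiv_ne_zero hh h0
  obtain ⟨c, hc⟩ := eq_C_of_mem_harmonicPolynomials_zero (pderiv_mem_harmonicPolynomials hh i)
  have hc0 : c ≠ 0 := fun h => hi (by rw [hc, h, map_zero])
  have hX := X_mem_harmonicPolynomials (n := n)
  have hXi : kVec n q s m l 1 (X i) ∈ U := by
    have h1 := hrot (coordReflection i) h hh hF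
    have e : linearSubst (coordReflection i).1 h = h + (-(2 * c)) • X i := by
      rw [linearSubst_coordReflection i (mem_harmonicPolynomials.1 hh).1, hc,
        mul_comm (X i), C_mul', smul_smul, neg_smul, sub_eq_add_neg]
    rw [e, kVec_add hn hm.1 hh (Submodule.smul_mem _ _ (hX i)), kVec_smul hn hm.1 (hX i)] at h1
    exact (U.smul_mem_iff (by simpa using hc0)).1 ((U.add_mem_iff_right hF).1 h1)
  intro m' hm' p hp
  refine transport hn hU.1 hR hp hm hm' ?_
  have e : p = ∑ j, X j * pderiv j p := by
    have := sum_X_mul_pderiv_of_mem hp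
    simpa using this.symm
  rw [e]
  choose d hd using fun j =>
    eq_C_of_mem_harmonicPolynomials_zero (pderiv_mem_harmonicPolynomials hp j)
  simp only [hd, mul_comm (X _), C_mul']
  rw [kVec_sum hn hm.1 _ fun j _ => Submodule.smul_mem _ _ (hX j)]
  refine U.sum_mem fun j _ => ?_
  rw [kVec_smul hn hm.1 (hX j)]
  refine U.smul_mem _ ?_
  have := hrot (coordPerm (Equiv.swap i j)) _ (hX i) hXi
  rwa [linearSubst_coordPerm, Equiv.swap_apply_left] at this

end OrthogonalGroup

/-! ### Regions, simple layers and composition series -/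

section Layers
open MvPolynomial

variable {n : ℕ} {q : ℤ} {s : ℂ}

theorem isRegion_plus : IsRegion n q fun β m => β ≤ m where
  convex β m x m' h _ h1 _ := h.trans h1
  step β m hβ _ _ h h' := by constructor <;> omega
  up β m hβ _ _ h := ⟨1, Or.inl rfl, by omega, by omega⟩

theorem isRegion_minus : IsRegion n q fun β m => m ≤ -β where
  convex β m x m' _ h _ h1 := h1.trans h
  step β m hβ h1 h2 h h' := by
    constructor <;> omega
  up β m hβ _ _ h := ⟨-1, Or.inr rfl, by omega, by omega⟩

/-- The weights outside the proper submodules that exist for the given `q`. -/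
def middleRegion (n : ℕ) (q : ℤ) (β m : ℤ) : Prop :=
  (q ≡ n [ZMOD 4] → m < β) ∧ (q ≡ -n [ZMOD 4] → -β < m)

/-- Since β - m ≡ n - q and β + m ≡ n + q mod 4, a coefficient that is not kept away from zero by an
inequality of the region is non-zero by its residue class. For the upward move ε = 1 always works.
-/
theorem isRegion_middle : IsRegion n q (middleRegion n q) where
  convex β m x m' h h' h1 h2 := by
    unfold middleRegion Int.ModEq at *
    omega
  step β m hβ h1 h2 h h' := by
    unfold middleRegion Int.ModEq at *
    omega
  up β m hβ h1 h2 h := by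
    refine ⟨1, Or.inl rfl, ?_, ?_⟩ <;> unfold middleRegion Int.ModEq at * <;> omega

/-- At l = k = 0 one has β = n. If both walls are present, n is even and n - 4 lies strictly between
-n and n exactly when n > 2. -/
theorem exists_admissible_middle_zero (h : ¬ (q ≡ n [ZMOD 4] ∧ q ≡ -n [ZMOD 4] ∧ n = 2))
    (hn : 1 ≤ n) : ∃ m, Admissible n q (middleRegion n q) m 0 0 := by
  unfold Admissible middleRegion
  by_cases h1 : q ≡ n [ZMOD 4]
  · refine ⟨n - 4, ?_⟩
    unfold Int.ModEq at *
    push_cast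
    omega
  · by_cases h2 : q ≡ -n [ZMOD 4]
    · refine ⟨4 - n, ?_⟩
      unfold Int.ModEq at *
      push_cast
      omega
    · exact ⟨q, by simp, fun h => absurd h h1, fun h => absurd h h2⟩

theorem exists_admissible_middle_one : ∃ m, Admissible n q (middleRegion n q) m 1 0 := by
  unfold Admissible middleRegion
  by_cases h1 : q ≡ n [ZMOD 4]
  · refine ⟨n, ?_⟩
    unfold Int.ModEq at *
    push_cast
    omega
  · by_cases h2 : q ≡ -n [ZMOD 4]
    · refine ⟨-n, ?_⟩
      unfold Int.ModEq at *
      push_cast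
      omega
    · exact ⟨q, by simp, fun h => absurd h h1, fun h => absurd h h2⟩

theorem exists_admissible_plus (hq : q ≡ n [ZMOD 4]) (l : ℕ) :
    ∃ m, Admissible n q (fun β m => β ≤ m) m l 0 := by
  refine ⟨4 * l + n, ?_⟩
  unfold Admissible Int.ModEq at *
  push_cast
  omega

theorem exists_admissible_minus (hq : q ≡ -n [ZMOD 4]) (l : ℕ) :
    ∃ m, Admissible n q (fun β m => m ≤ -β) m l 0 := by
  refine ⟨-(4 * l + n), ?_⟩
  unfold Admissible Int.ModEq at *
  push_cast
  omega

/-- Some component of the element has its index outside S, and this component lies in U by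
`component_mem`. -/
theorem exists_kVec_mem_of_notMem (hn : 1 ≤ n) {U : Submodule ℂ (compactPicture n q s)}
    (hU : IsGSubmodule U) {S S' : Set (ℤ × ℕ × ℕ)} {F : compactPicture n q s} (hF : F ∈ U)
    (hF' : F ∈ indexSpan n q s S') (hFS : F ∉ indexSpan n q s S) :
    ∃ (m : ℤ) (l k : ℕ) (h : MvPolynomial (Fin n) ℂ), (m, l, k) ∈ S' ∧ (m, l, k) ∉ S ∧
      m ≡ 2 * k + q [ZMOD 4] ∧ h ∈ harmonicPolynomials n k ∧ h ≠ 0 ∧ kVec n q s m l k h ∈ U := by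
  obtain ⟨f, hf, hf0, rfl⟩ := exists_finsupp_of_mem_indexSpan hF'
  have hex : ∃ t, t ∉ S ∧ f t ≠ 0 := by
    by_contra! hcon
    refine hFS (Submodule.sum_mem _ fun t ht => ?_)
    have hne := Finsupp.mem_support_iff.1 ht
    have htS : t ∈ S := by
      by_contra h
      exact hne (hcon t h)
    exact weightSpace_le_indexSpan htS (hf t)
  obtain ⟨t, htS, hne⟩ := hex
  have htS' : t ∈ S' := by
    by_contra h
    exact hne (hf0 t h)
  by_cases hm : t.1 ≡ 2 * t.2.2 + q [ZMOD 4]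
  · obtain ⟨g, hg, heq⟩ := (mem_weightSpace hn hm).1 (hf t)
    refine ⟨t.1, t.2.1, t.2.2, g, htS', htS, hm, hg, ?_, ?_⟩
    · rintro rfl
      rw [kVec_zero hn hm] at heq
      exact hne heq
    · rw [← heq]
      exact component_mem hn hU f hf hF t
  · have := hf t
    rw [weightSpace_eq_bot hm, Submodule.mem_bot] at this
    exact absurd this hne

theorem indexSpan_lt (hn : 1 ≤ n) {S S' : Set (ℤ × ℕ × ℕ)} (hSS' : S ⊆ S') {m : ℤ} {l k : ℕ}
    {h : MvPolynomial (Fin n) ℂ} (hm : m ≡ 2 * k + q [ZMOD 4]) (hh : h ∈ harmonicPolynomials n k)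
    (h0 : h ≠ 0) (hS' : (m, l, k) ∈ S') (hS : (m, l, k) ∉ S) :
    indexSpan n q s S < indexSpan n q s S' := by
  refine lt_of_le_of_ne (indexSpan_mono hSS') fun heq => h0 ?_
  have h1 := kVec_mem_indexSpan (s := s) hn hm hh hS'
  rw [← heq] at h1
  have h2 := kVec_mem_indexSpan (s := s) hn hm hh (Set.mem_singleton (m, l, k))
  exact eq_zero_of_kVec_eq_zero hn hm hh
    (Submodule.disjoint_def.1 (disjoint_indexSpan hn (Set.disjoint_singleton_right.2 hS)) _ h1 h2)

/-- `A ⊂ B` is a proper inclusion with no submodule in the sense of `P` strictly in between. -/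
def IsSimpleLayer (P : Submodule ℂ (compactPicture n q s) → Prop)
    (A B : Submodule ℂ (compactPicture n q s)) : Prop :=
  A < B ∧ ∀ U, P U → A ≤ U → U ≤ B → U = A ∨ U = B

variable {P : Submodule ℂ (compactPicture n q s) → Prop} {S S' : Set (ℤ × ℕ × ℕ)}
  {R : ℤ → ℤ → Prop}

/-- Reduces simplicity to connectivity: an intermediate submodule larger than the lower term
contains a weight vector of the difference, and by hypothesis then all of them. -/
theorem isSimpleLayer_of_full (hn : 1 ≤ n) (hP : ∀ U, P U → IsGSubmodule U) (hSS' : S ⊆ S')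
    (hex : ∃ (m : ℤ) (l k : ℕ) (h : MvPolynomial (Fin n) ℂ), (m, l, k) ∈ S' ∧ (m, l, k) ∉ S ∧
      m ≡ 2 * k + q [ZMOD 4] ∧ h ∈ harmonicPolynomials n k ∧ h ≠ 0)
    (hfull : ∀ U, P U → ∀ (m : ℤ) (l k : ℕ) (h : MvPolynomial (Fin n) ℂ), (m, l, k) ∈ S' →
      (m, l, k) ∉ S → m ≡ 2 * k + q [ZMOD 4] → h ∈ harmonicPolynomials n k → h ≠ 0 →
      kVec n q s m l k h ∈ U → ∀ (m' : ℤ) (l' k' : ℕ), (m', l', k') ∈ S' → (m', l', k') ∉ S →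
      m' ≡ 2 * k' + q [ZMOD 4] → ∀ g ∈ harmonicPolynomials n k', kVec n q s m' l' k' g ∈ U) :
    IsSimpleLayer P (indexSpan n q s S) (indexSpan n q s S') := by
  obtain ⟨m, l, k, h, hS', hS, hm, hh, h0⟩ := hex
  refine ⟨indexSpan_lt hn hSS' hm hh h0 hS' hS, fun U hU hSU hUS' => ?_⟩
  by_cases hle : U ≤ indexSpan n q s S
  · exact Or.inl (le_antisymm hle hSU)
  · right
    obtain ⟨F, hF, hFS⟩ := SetLike.not_le_iff_exists.1 hle
    obtain ⟨m, l, k, h, hS', hS, hm, hh, h0, hmem⟩ :=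
      exists_kVec_mem_of_notMem hn (hP U hU) hF (hUS' hF) hFS
    refine le_antisymm hUS' (indexSpan_le hn fun m' l' k' ht' hm' g hg => ?_)
    by_cases hSt : (m', l', k') ∈ S
    · exact hSU (kVec_mem_indexSpan hn hm' hg hSt)
    · exact hfull U hU m l k h hS' hS hm hh h0 hmem m' l' k' ht' hSt hm' g hg

theorem isSimpleLayer_zero (hn : 1 ≤ n) (hs : s ≠ 0) (hP : ∀ U, P U → IsGSubmodule U)
    (hSS' : S ⊆ S') (hR : IsRegion n q R) (hex : ∃ m, Admissible n q R m 0 0)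
    (hdiff : ∀ (m : ℤ) (l k : ℕ),
      (m, l, k) ∈ S' ∧ (m, l, k) ∉ S ↔ l = 0 ∧ R (4 * l + 2 * k + n) m) :
    IsSimpleLayer P (indexSpan n q s S) (indexSpan n q s S') := by
  refine isSimpleLayer_of_full hn hP hSS' ?_ ?_
  · obtain ⟨m, hm, hRm⟩ := hex
    obtain ⟨h1, h2⟩ := (hdiff m 0 0).2 ⟨rfl, hRm⟩
    exact ⟨m, 0, 0, 1, h1, h2, hm, one_mem_harmonicPolynomials, one_ne_zero⟩
  · intro U hU m l k h hS' hS hm hh h0 hF m' l' k' hS'' hS₁ hm' g hg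
    obtain ⟨rfl, hRm⟩ := (hdiff m l k).1 ⟨hS', hS⟩
    obtain ⟨rfl, hRm'⟩ := (hdiff m' l' k').1 ⟨hS'', hS₁⟩
    exact full_of_mem hn hs (hP U hU) hR hex hh h0 ⟨hm, hRm⟩ hF k' m' ⟨hm', hRm'⟩ g hg

theorem isSimpleLayer_pos (hn : 1 ≤ n) (hs : s ≠ 0) (hP : ∀ U, P U → IsGSubmodule U)
    (hSS' : S ⊆ S') (hR : IsRegion n q R) (hex : ∃ m, Admissible n q R m 1 0)
    (hdiff : ∀ (m : ℤ) (l k : ℕ),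
      (m, l, k) ∈ S' ∧ (m, l, k) ∉ S ↔ 1 ≤ l ∧ R (4 * l + 2 * k + n) m) :
    IsSimpleLayer P (indexSpan n q s S) (indexSpan n q s S') := by
  refine isSimpleLayer_of_full hn hP hSS' ?_ ?_
  · obtain ⟨m, hm, hRm⟩ := hex
    obtain ⟨h1, h2⟩ := (hdiff m 1 0).2 ⟨le_rfl, hRm⟩
    exact ⟨m, 1, 0, 1, h1, h2, hm, one_mem_harmonicPolynomials, one_ne_zero⟩
  · intro U hU m l k h hS' hS hm hh h0 hF m' l' k' hS'' hS₁ hm' g hg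
    obtain ⟨hl, hRm⟩ := (hdiff m l k).1 ⟨hS', hS⟩
    obtain ⟨hl', hRm'⟩ := (hdiff m' l' k').1 ⟨hS'', hS₁⟩
    exact full_of_mem_of_pos hn hs (hP U hU) hR hex hl hh h0 ⟨hm, hRm⟩ hF hl' k' m'
      ⟨hm', hRm'⟩ g hg

/-- The exceptional layer. The descent ends at k = 1, where stability under O(2) replaces the
one-dimensionality of 𝓗_0. -/
theorem isSimpleLayer_two (hn : n = 2) (hs : s ≠ 0) (hq : q ≡ n [ZMOD 4]) (hSS' : S ⊆ S')
    (hdiff : ∀ (m : ℤ) (l k : ℕ),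
      (m, l, k) ∈ S' ∧ (m, l, k) ∉ S ↔ l = 0 ∧ middleRegion n q (4 * l + 2 * k + n) m) :
    IsSimpleLayer IsGOSubmodule (indexSpan n q s S) (indexSpan n q s S') := by
  subst hn
  have hn : 1 ≤ 2 := one_le_two
  have hR := isRegion_middle (n := 2) (q := q)
  have hadm : Admissible 2 q (middleRegion 2 q) 0 0 1 := by
    refine ⟨?_, fun _ => by norm_num, fun _ => by norm_num⟩
    unfold Int.ModEq at hq ⊢
    omega
  -- For k = 0 one would need -2 < m < 2 with m ≡ 2 mod 4.
  have hpos : ∀ m k, Admissible 2 q (middleRegion 2 q) m 0 k → 1 ≤ k := by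
    intro m k hm
    unfold Int.ModEq at hq
    unfold Admissible middleRegion Int.ModEq at hm
    push_cast at hq hm
    omega
  refine isSimpleLayer_of_full hn (fun U hU => hU.1) hSS' ?_ ?_
  · obtain ⟨h1, h2⟩ := (hdiff 0 0 1).2 ⟨rfl, hadm.2⟩
    exact ⟨0, 0, 1, X 0, h1, h2, hadm.1, X_mem_harmonicPolynomials 0, X_ne_zero 0⟩
  · intro U hU m l k h hS' hS hm hh h0 hF m' l' k' hS'' hS₁ hm' g hg
    obtain ⟨rfl, hRm⟩ := (hdiff m l k).1 ⟨hS', hS⟩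
    obtain ⟨rfl, hRm'⟩ := (hdiff m' l' k').1 ⟨hS'', hS₁⟩
    obtain ⟨m₁, p, hp, hp0, hm₁, hF₁⟩ := exists_descend hn hs hU.1 hR ⟨0, hadm⟩
      (hpos m k ⟨hm, hRm⟩) hh h0 ⟨hm, hRm⟩ hF
    exact full_of_le hn hs hU.1 hR (full_one_of_mem hn hU hR hp hp0 hm₁ hF₁) ⟨0, hadm⟩
      (hpos m' k' ⟨hm', hRm'⟩) m' ⟨hm', hRm'⟩ g hg

/-- Without walls every non-zero submodule of the total space contains a weight vector. If its l is
positive, the moves lowering l still lead to l = 0, although no move leads back; from there all of l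
= 0 is reached. -/
theorem HZero_le_of_ne_bot (hn : 1 ≤ n) (hs : s ≠ 0) (h1 : ¬ q ≡ n [ZMOD 4])
    (h2 : ¬ q ≡ -n [ZMOD 4]) {U : Submodule ℂ (compactPicture n q s)} (hU : IsGSubmodule U)
    (hle : U ≤ HTotal n q s) (hne : U ≠ ⊥) : HZero n q s ≤ U := by
  have hR := isRegion_middle (n := n) (q := q)
  have hmid : ∀ β m, middleRegion n q β m := fun β m =>
    ⟨fun h => absurd h h1, fun h => absurd h h2⟩
  have hex := exists_admissible_middle_zero (n := n) (q := q) (fun h => h1 h.1) hn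
  obtain ⟨F, hF, hF0⟩ := Submodule.exists_mem_ne_zero_of_ne_bot hne
  obtain ⟨m, l, k, h, -, -, hm, hh, h0, hmem⟩ := exists_kVec_mem_of_notMem (S := ∅) hn hU hF
    (by simpa only [HTotal_eq hn] using hle hF) (by simpa only [indexSpan_empty, Submodule.mem_bot])
  obtain ⟨m, k, h, hm, hh, h0, hmem⟩ : ∃ m k h, m ≡ 2 * (k : ℕ) + q [ZMOD 4] ∧
      h ∈ harmonicPolynomials n k ∧ h ≠ 0 ∧ kVec n q s m 0 k h ∈ U := by
    rcases Nat.eq_zero_or_pos l with rfl | hl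
    · exact ⟨m, k, h, hm, hh, h0, hmem⟩
    · have hfull := full_of_mem_of_pos hn hs hU hR exists_admissible_middle_one hl hh h0
        ⟨hm, hmid _ _⟩ hmem le_rfl 0
      obtain ⟨m', g, hg, hg0, hm', hF'⟩ := exists_unshift hn hs hU hR hfull
        (hR.exists_admissible hn hex (d := 1) rfl)
      exact ⟨m', 1, g, hm'.1, hg, hg0, hF'⟩
  rw [HZero_eq hn]
  refine indexSpan_le hn fun m' l' k' ht' hm' g hg => ?_
  obtain rfl : l' = 0 := ht'
  exact full_of_mem hn hs hU hR hex hh h0 ⟨hm, hmid _ _⟩ hmem k' m' ⟨hm', hmid _ _⟩ g hg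

theorem HZero_sup_HPlus (hn : 1 ≤ n) :
    HZero n q s ⊔ HPlus n q s = indexSpan n q s (zeroSet ∪ plusSet n) := by
  rw [HZero_eq hn, HPlus_eq hn, ← indexSpan_union, Set.union_sdiff_self]

theorem HZero_sup_HMinus (hn : 1 ≤ n) :
    HZero n q s ⊔ HMinus n q s = indexSpan n q s (zeroSet ∪ minusSet n) := by
  rw [HZero_eq hn, HMinus_eq hn, ← indexSpan_union, Set.union_sdiff_self]

theorem HZero_sup_HMinus_sup_HPlus (hn : 1 ≤ n) :
    HZero n q s ⊔ HMinus n q s ⊔ HPlus n q s =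
      indexSpan n q s (zeroSet ∪ minusSet n ∪ plusSet n) := by
  rw [sup_right_comm, HZero_sup_HPlus hn, HMinus_eq hn, ← indexSpan_union]
  congr 1
  ext t
  simp only [Set.mem_union, Set.mem_sdiff]
  tauto

theorem HZeroPlus_sup_HZeroMinus (hn : 1 ≤ n) :
    HZeroPlus n q s ⊔ HZeroMinus n q s =
      indexSpan n q s (zeroSet ∩ plusSet n ∪ zeroSet ∩ minusSet n) := by
  rw [HZeroPlus_eq hn, HZeroMinus_eq hn, ← indexSpan_union]

theorem disjoint_plusSet_minusSet (hn : 1 ≤ n) : Disjoint (plusSet n) (minusSet n) := by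
  refine Set.disjoint_left.2 ?_
  rintro ⟨m, l, k⟩ h1 h2
  simp only [plusSet, minusSet, Set.mem_ofPred_eq] at h1 h2
  omega

theorem isSimpleLayer_HZeroMinus (hn : 1 ≤ n) (hs : s ≠ 0) (hP : ∀ U, P U → IsGSubmodule U)
    (hq : q ≡ -n [ZMOD 4]) : IsSimpleLayer P ⊥ (HZeroMinus n q s) := by
  rw [← indexSpan_empty, HZeroMinus_eq hn]
  refine isSimpleLayer_zero hn hs hP (Set.empty_subset _) isRegion_minus
    (exists_admissible_minus hq 0) fun m l k => ?_
  simp only [zeroSet, minusSet, Set.mem_inter_iff, Set.mem_ofPred_eq, Set.mem_empty_iff_false,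
    not_false_eq_true, and_true]
  omega

theorem isSimpleLayer_HZeroPlus (hn : 1 ≤ n) (hs : s ≠ 0) (hP : ∀ U, P U → IsGSubmodule U)
    (hq : q ≡ n [ZMOD 4]) : IsSimpleLayer P ⊥ (HZeroPlus n q s) := by
  rw [← indexSpan_empty, HZeroPlus_eq hn]
  refine isSimpleLayer_zero hn hs hP (Set.empty_subset _) isRegion_plus
    (exists_admissible_plus hq 0) fun m l k => ?_
  simp only [zeroSet, plusSet, Set.mem_inter_iff, Set.mem_ofPred_eq, Set.mem_empty_iff_false,
    not_false_eq_true, and_true]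
  omega

/-- The composition series for both congruences, provided that its one layer which depends on the
notion of submodule is simple. -/
theorem isCompositionSeriesFor_of_layer (hn : 1 ≤ n) (hs : s ≠ 0)
    (hP : ∀ U, P U → IsGSubmodule U) (hPS : ∀ S, IsStableSet n q S → P (indexSpan n q s S))
    (hq : q ≡ n [ZMOD 4]) (hq' : q ≡ -n [ZMOD 4])
    (hlayer : ∀ S S' : Set (ℤ × ℕ × ℕ), S ⊆ S' → (∀ (m : ℤ) (l k : ℕ),
      (m, l, k) ∈ S' ∧ (m, l, k) ∉ S ↔ l = 0 ∧ middleRegion n q (4 * l + 2 * k + n) m) →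
      IsSimpleLayer P (indexSpan n q s S) (indexSpan n q s S')) :
    IsCompositionSeriesFor P (HTotal n q s)
      ![⊥, HZeroMinus n q s, HZeroPlus n q s ⊔ HZeroMinus n q s, HZero n q s,
        HZero n q s ⊔ HMinus n q s, HZero n q s ⊔ HMinus n q s ⊔ HPlus n q s,
        HTotal n q s] := by
  have hZ := isStableSet_zeroSet (n := n) (q := q)
  have hp := isStableSet_plusSet hq
  have hm := isStableSet_minusSet hq'
  have l0 := isSimpleLayer_HZeroMinus hn hs hP hq'
  have l1 : IsSimpleLayer P (HZeroMinus n q s) (HZeroPlus n q s ⊔ HZeroMinus n q s) := by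
    rw [HZeroPlus_sup_HZeroMinus hn, HZeroMinus_eq hn]
    refine isSimpleLayer_zero hn hs hP Set.subset_union_right isRegion_plus
      (exists_admissible_plus hq 0) fun m l k => ?_
    simp only [zeroSet, plusSet, minusSet, Set.mem_inter_iff, Set.mem_union, Set.mem_ofPred_eq]
    omega
  -- The indices here are l = 0 and |m| < 2k + n, the only layer whose simplicity can depend on
  -- O(n).
  have l2 : IsSimpleLayer P (HZeroPlus n q s ⊔ HZeroMinus n q s) (HZero n q s) := by
    rw [HZeroPlus_sup_HZeroMinus hn, HZero_eq hn]
    refine hlayer _ _ (Set.union_subset Set.inter_subset_left Set.inter_subset_left)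
      fun m l k => ?_
    simp only [zeroSet, plusSet, minusSet, Set.mem_inter_iff, Set.mem_union, Set.mem_ofPred_eq,
      middleRegion, hq, hq', true_imp_iff]
    omega
  have l3 : IsSimpleLayer P (HZero n q s) (HZero n q s ⊔ HMinus n q s) := by
    rw [HZero_sup_HMinus hn, HZero_eq hn]
    refine isSimpleLayer_pos hn hs hP Set.subset_union_left isRegion_minus
      (exists_admissible_minus hq' 1) fun m l k => ?_
    simp only [zeroSet, minusSet, Set.mem_union, Set.mem_ofPred_eq]
    omega
  have l4 : IsSimpleLayer P (HZero n q s ⊔ HMinus n q s)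
      (HZero n q s ⊔ HMinus n q s ⊔ HPlus n q s) := by
    rw [HZero_sup_HMinus_sup_HPlus hn, HZero_sup_HMinus hn]
    refine isSimpleLayer_pos hn hs hP Set.subset_union_left isRegion_plus
      (exists_admissible_plus hq 1) fun m l k => ?_
    simp only [zeroSet, plusSet, minusSet, Set.mem_union, Set.mem_ofPred_eq]
    omega
  have l5 : IsSimpleLayer P (HZero n q s ⊔ HMinus n q s ⊔ HPlus n q s) (HTotal n q s) := by
    rw [HZero_sup_HMinus_sup_HPlus hn, HTotal_eq hn]
    refine isSimpleLayer_pos hn hs hP (Set.subset_univ _) isRegion_middle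
      exists_admissible_middle_one fun m l k => ?_
    simp only [zeroSet, plusSet, minusSet, Set.mem_union, Set.mem_ofPred_eq, Set.mem_univ,
      middleRegion, hq, hq', true_imp_iff, true_and]
    omega
  refine ⟨rfl, rfl, fun i => ?_, fun i => ?_, fun i => ?_⟩
  · fin_cases i
    · change P ⊥
      rw [← indexSpan_empty]
      exact hPS _ isStableSet_empty
    · change P (HZeroMinus n q s)
      rw [HZeroMinus_eq hn]
      exact hPS _ (hZ.inter hm)
    · change P (HZeroPlus n q s ⊔ HZeroMinus n q s)
      rw [HZeroPlus_sup_HZeroMinus hn]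
      exact hPS _ ((hZ.inter hp).union (hZ.inter hm))
    · change P (HZero n q s)
      rw [HZero_eq hn]
      exact hPS _ hZ
    · change P (HZero n q s ⊔ HMinus n q s)
      rw [HZero_sup_HMinus hn]
      exact hPS _ (hZ.union hm)
    · change P (HZero n q s ⊔ HMinus n q s ⊔ HPlus n q s)
      rw [HZero_sup_HMinus_sup_HPlus hn]
      exact hPS _ ((hZ.union hm).union hp)
    · change P (HTotal n q s)
      rw [HTotal_eq hn]
      exact hPS _ isStableSet_univ
  · fin_cases i
    exacts [l0.1, l1.1, l2.1, l3.1, l4.1, l5.1]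
  · fin_cases i
    exacts [l0.2, l1.2, l2.2, l3.2, l4.2, l5.2]

/-- With no wall the middle region imposes no condition on m, so l = 0 and l ≥ 1 are the only
layers. -/
theorem isCompositionSeriesFor_generic (hn : 1 ≤ n) (hs : s ≠ 0) (hq : ¬ q ≡ n [ZMOD 4])
    (hq' : ¬ q ≡ -n [ZMOD 4]) :
    IsCompositionSeriesFor IsGSubmodule (HTotal n q s) ![⊥, HZero n q s, HTotal n q s] := by
  have l0 : IsSimpleLayer IsGSubmodule ⊥ (HZero n q s) := by
    rw [← indexSpan_empty, HZero_eq hn]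
    refine isSimpleLayer_zero hn hs (fun _ h => h) (Set.empty_subset _) isRegion_middle
      (exists_admissible_middle_zero (fun h => hq h.1) hn) fun m l k => ?_
    simp [zeroSet, middleRegion, hq, hq']
  have l1 : IsSimpleLayer IsGSubmodule (HZero n q s) (HTotal n q s) := by
    rw [HTotal_eq hn, HZero_eq hn]
    refine isSimpleLayer_pos hn hs (fun _ h => h) (Set.subset_univ _) isRegion_middle
      exists_admissible_middle_one fun m l k => ?_
    simp [zeroSet, middleRegion, hq, hq', Nat.one_le_iff_ne_zero]
  refine ⟨rfl, rfl, fun i => ?_, fun i => ?_, fun i => ?_⟩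
  · fin_cases i
    · exact isGSubmodule_bot
    · change IsGSubmodule (HZero n q s)
      rw [HZero_eq hn]
      exact isGSubmodule_indexSpan hn hs isStableSet_zeroSet
    · change IsGSubmodule (HTotal n q s)
      rw [HTotal_eq hn]
      exact isGSubmodule_indexSpan hn hs isStableSet_univ
  · fin_cases i
    exacts [l0.1, l1.1]
  · fin_cases i
    exacts [l0.2, l1.2]

theorem isIrreducibleFor_iff_eq_HZero (hn : 1 ≤ n) (hs : s ≠ 0) (hq : ¬ q ≡ n [ZMOD 4])
    (hq' : ¬ q ≡ -n [ZMOD 4]) {W : Submodule ℂ (compactPicture n q s)} (hW : W ≤ HTotal n q s) :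
    IsIrreducibleFor IsGSubmodule W ↔ W = HZero n q s := by
  have hser := isCompositionSeriesFor_generic (s := s) hn hs hq hq'
  have hlt : ⊥ < HZero n q s := hser.lt 0
  have hG : IsGSubmodule (HZero n q s) := hser.submodule 1
  constructor
  · rintro ⟨hWG, hne, hirr⟩
    exact ((hirr _ hG (HZero_le_of_ne_bot hn hs hq hq' hWG hW hne)).resolve_left hlt.ne').symm
  · rintro rfl
    exact ⟨hG, hlt.ne', fun U hU hle => hser.irreducible 0 U hU bot_le hle⟩

theorem isCompositionSeriesFor_plus (hn : 1 ≤ n) (hs : s ≠ 0) (hq : q ≡ n [ZMOD 4])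
    (hq' : ¬ q ≡ -n [ZMOD 4]) :
    IsCompositionSeriesFor IsGSubmodule (HTotal n q s)
      ![⊥, HZeroPlus n q s, HZero n q s, HZero n q s ⊔ HPlus n q s, HTotal n q s] := by
  have hZ := isStableSet_zeroSet (n := n) (q := q)
  have hp := isStableSet_plusSet hq
  have l0 := isSimpleLayer_HZeroPlus (s := s) hn hs (fun _ h => h) hq
  have l1 : IsSimpleLayer IsGSubmodule (HZeroPlus n q s) (HZero n q s) := by
    rw [HZeroPlus_eq hn, HZero_eq hn]
    refine isSimpleLayer_zero hn hs (fun _ h => h) Set.inter_subset_left isRegion_middle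
      (exists_admissible_middle_zero (fun h => hq' h.2.1) hn) fun m l k => ?_
    simp only [zeroSet, plusSet, Set.mem_inter_iff, Set.mem_ofPred_eq, middleRegion, hq, hq',
      true_imp_iff, false_imp_iff, and_true]
    omega
  have l2 : IsSimpleLayer IsGSubmodule (HZero n q s) (HZero n q s ⊔ HPlus n q s) := by
    rw [HZero_sup_HPlus hn, HZero_eq hn]
    refine isSimpleLayer_pos hn hs (fun _ h => h) Set.subset_union_left isRegion_plus
      (exists_admissible_plus hq 1) fun m l k => ?_
    simp only [zeroSet, plusSet, Set.mem_union, Set.mem_ofPred_eq]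
    omega
  have l3 : IsSimpleLayer IsGSubmodule (HZero n q s ⊔ HPlus n q s) (HTotal n q s) := by
    rw [HZero_sup_HPlus hn, HTotal_eq hn]
    refine isSimpleLayer_pos hn hs (fun _ h => h) (Set.subset_univ _) isRegion_middle
      exists_admissible_middle_one fun m l k => ?_
    simp only [zeroSet, plusSet, Set.mem_union, Set.mem_ofPred_eq, Set.mem_univ, middleRegion, hq,
      hq', true_imp_iff, false_imp_iff, and_true, true_and]
    omega
  refine ⟨rfl, rfl, fun i => ?_, fun i => ?_, fun i => ?_⟩
  · fin_cases i
    · exact isGSubmodule_bot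
    · change IsGSubmodule (HZeroPlus n q s)
      rw [HZeroPlus_eq hn]
      exact isGSubmodule_indexSpan hn hs (hZ.inter hp)
    · change IsGSubmodule (HZero n q s)
      rw [HZero_eq hn]
      exact isGSubmodule_indexSpan hn hs hZ
    · change IsGSubmodule (HZero n q s ⊔ HPlus n q s)
      rw [HZero_sup_HPlus hn]
      exact isGSubmodule_indexSpan hn hs (hZ.union hp)
    · change IsGSubmodule (HTotal n q s)
      rw [HTotal_eq hn]
      exact isGSubmodule_indexSpan hn hs isStableSet_univ
  · fin_cases i
    exacts [l0.1, l1.1, l2.1, l3.1]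
  · fin_cases i
    exacts [l0.2, l1.2, l2.2, l3.2]

theorem isCompositionSeriesFor_minus (hn : 1 ≤ n) (hs : s ≠ 0) (hq : ¬ q ≡ n [ZMOD 4])
    (hq' : q ≡ -n [ZMOD 4]) :
    IsCompositionSeriesFor IsGSubmodule (HTotal n q s)
      ![⊥, HZeroMinus n q s, HZero n q s, HZero n q s ⊔ HMinus n q s, HTotal n q s] := by
  have hZ := isStableSet_zeroSet (n := n) (q := q)
  have hm := isStableSet_minusSet hq'
  have l0 := isSimpleLayer_HZeroMinus (s := s) hn hs (fun _ h => h) hq'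
  have l1 : IsSimpleLayer IsGSubmodule (HZeroMinus n q s) (HZero n q s) := by
    rw [HZeroMinus_eq hn, HZero_eq hn]
    refine isSimpleLayer_zero hn hs (fun _ h => h) Set.inter_subset_left isRegion_middle
      (exists_admissible_middle_zero (fun h => hq h.1) hn) fun m l k => ?_
    simp only [zeroSet, minusSet, Set.mem_inter_iff, Set.mem_ofPred_eq, middleRegion, hq, hq',
      true_imp_iff, false_imp_iff, true_and]
    omega
  have l2 : IsSimpleLayer IsGSubmodule (HZero n q s) (HZero n q s ⊔ HMinus n q s) := by
    rw [HZero_sup_HMinus hn, HZero_eq hn]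
    refine isSimpleLayer_pos hn hs (fun _ h => h) Set.subset_union_left isRegion_minus
      (exists_admissible_minus hq' 1) fun m l k => ?_
    simp only [zeroSet, minusSet, Set.mem_union, Set.mem_ofPred_eq]
    omega
  have l3 : IsSimpleLayer IsGSubmodule (HZero n q s ⊔ HMinus n q s) (HTotal n q s) := by
    rw [HZero_sup_HMinus hn, HTotal_eq hn]
    refine isSimpleLayer_pos hn hs (fun _ h => h) (Set.subset_univ _) isRegion_middle
      exists_admissible_middle_one fun m l k => ?_
    simp only [zeroSet, minusSet, Set.mem_union, Set.mem_ofPred_eq, Set.mem_univ, middleRegion, hq,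
      hq', true_imp_iff, false_imp_iff, true_and]
    omega
  refine ⟨rfl, rfl, fun i => ?_, fun i => ?_, fun i => ?_⟩
  · fin_cases i
    · exact isGSubmodule_bot
    · change IsGSubmodule (HZeroMinus n q s)
      rw [HZeroMinus_eq hn]
      exact isGSubmodule_indexSpan hn hs (hZ.inter hm)
    · change IsGSubmodule (HZero n q s)
      rw [HZero_eq hn]
      exact isGSubmodule_indexSpan hn hs hZ
    · change IsGSubmodule (HZero n q s ⊔ HMinus n q s)
      rw [HZero_sup_HMinus hn]
      exact isGSubmodule_indexSpan hn hs (hZ.union hm)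
    · change IsGSubmodule (HTotal n q s)
      rw [HTotal_eq hn]
      exact isGSubmodule_indexSpan hn hs isStableSet_univ
  · fin_cases i
    exacts [l0.1, l1.1, l2.1, l3.1]
  · fin_cases i
    exacts [l0.2, l1.2, l2.2, l3.2]

end Layers

/-! ### The four congruence cases -/

theorem theorem7 (n : ℕ) (hn : 1 ≤ n) (q : ℤ) (s : ℂ) (hs : s ≠ 0) :
    -- the sums are direct
    iSupIndep (fun p : ℕ × ℕ => Hlk n q s p.1 p.2) ∧
    (¬ q ≡ n [ZMOD 4] → ¬ q ≡ -n [ZMOD 4] →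
      IsCompositionSeriesFor IsGSubmodule (HTotal n q s) ![⊥, HZero n q s, HTotal n q s] ∧
      ∀ W ≤ HTotal n q s, IsIrreducibleFor IsGSubmodule W ↔ W = HZero n q s) ∧
    (q ≡ n [ZMOD 4] → ¬ q ≡ -n [ZMOD 4] →
      IsCompositionSeriesFor IsGSubmodule (HTotal n q s)
        ![⊥, HZeroPlus n q s, HZero n q s, HZero n q s ⊔ HPlus n q s, HTotal n q s]) ∧
    (¬ q ≡ n [ZMOD 4] → q ≡ -n [ZMOD 4] →
      IsCompositionSeriesFor IsGSubmodule (HTotal n q s)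
        ![⊥, HZeroMinus n q s, HZero n q s, HZero n q s ⊔ HMinus n q s, HTotal n q s]) ∧
    (q ≡ n [ZMOD 4] → q ≡ -n [ZMOD 4] →
      Disjoint (HZeroPlus n q s) (HZeroMinus n q s) ∧ Disjoint (HPlus n q s) (HMinus n q s) ∧
      -- for `n = 2` one of the quotients is irreducible only under `𝔤` and `O(2)` together
      (n ≠ 2 → IsCompositionSeriesFor IsGSubmodule (HTotal n q s)
        ![⊥, HZeroMinus n q s, HZeroPlus n q s ⊔ HZeroMinus n q s, HZero n q s,
          HZero n q s ⊔ HMinus n q s, HZero n q s ⊔ HMinus n q s ⊔ HPlus n q s,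
          HTotal n q s]) ∧
      IsCompositionSeriesFor IsGOSubmodule (HTotal n q s)
        ![⊥, HZeroMinus n q s, HZeroPlus n q s ⊔ HZeroMinus n q s, HZero n q s,
          HZero n q s ⊔ HMinus n q s, HZero n q s ⊔ HMinus n q s ⊔ HPlus n q s,
          HTotal n q s]) := by
  refine ⟨iSupIndep_Hlk hn,
    fun hq hq' => ⟨isCompositionSeriesFor_generic hn hs hq hq', fun W hW =>
      isIrreducibleFor_iff_eq_HZero hn hs hq hq' hW⟩,
    isCompositionSeriesFor_plus hn hs, isCompositionSeriesFor_minus hn hs, fun hq hq' => ?_⟩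
  have hd := disjoint_plusSet_minusSet hn
  refine ⟨?_, ?_, fun h2 => ?_, ?_⟩
  · rw [HZeroPlus_eq hn, HZeroMinus_eq hn]
    exact disjoint_indexSpan hn (hd.mono Set.inter_subset_right Set.inter_subset_right)
  · rw [HPlus_eq hn, HMinus_eq hn]
    exact disjoint_indexSpan hn (hd.mono Set.sdiff_subset Set.sdiff_subset)
  · exact isCompositionSeriesFor_of_layer hn hs (fun _ h => h)
      (fun _ hS => isGSubmodule_indexSpan hn hs hS) hq hq' fun S S' hSS' hdiff =>
        isSimpleLayer_zero hn hs (fun _ h => h) hSS' isRegion_middle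
          (exists_admissible_middle_zero (fun h => h2 h.2.2) hn) hdiff
  · refine isCompositionSeriesFor_of_layer hn hs (fun _ h => h.1)
      (fun _ hS => isGOSubmodule_indexSpan hn hs hS) hq hq' fun S S' hSS' hdiff => ?_
    by_cases h2 : n = 2
    · exact isSimpleLayer_two h2 hs hq hSS' hdiff
    · exact isSimpleLayer_zero hn hs (fun _ h => h.1) hSS' isRegion_middle
        (exists_admissible_middle_zero (fun h => h2 h.2.2) hn) hdiff
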